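/- **Random $K$-XOR.** A $K$-tuple over $n$ variables is a map $C:\{\pm1\}^n\to\{\pm1\}^K$ whose $K$ output coordinates are literals of $K$ different variables. A $K$-formula with $m$ constraints is $J=(C_1,\dots,C_m)$, a sequence of $K$-tuples; its value is $\mathrm{VAL}(J)=\max_{\psi\in\{\pm1\}^n}\frac1m\left|\{j:\mathrm{XOR}(C_j(\psi))=1\}\right|$, where $\mathrm{XOR}(z)=\prod_i z_i$. For $K=K(n)$, $m=m(n)$ and $0<\eta<\frac12$, the problem $\mathrm{CSP}^{\mathrm{rand},1-\eta}_{m}(\mathrm{XOR}_K)$ is *easy* if there is a randomized algorithm, running in time polynomial in $n+K+m$, that (i) for every $n$ and every $K(n)$-formula $J$ with $n$ variables, $m(n)$ constraints and $\mathrm{VAL}(J)\ge1-\eta$, answers "non-random" with probability at least $\frac34$ over its coins, and (ii) with probability $1-o_n(1)$ over a uniformly random such formula $J$, answers "random" with probability at least $\frac34$ over its coins. Otherwise the problem is *hard*. **Assumption 1.** There are constants $c>0$ and $0<\eta<\frac12$ such that for every integer $K\ge1$ and $m=\lceil n^{c\log(K)\sqrt K}\rceil$, the problem $\mathrm{CSP}^{\mathrm{rand},1-\eta}_{m}(\mathrm{XOR}_K)$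 is hard. **Assumption 2.** There are constants $c>0$ and $0<\eta<\frac12$ such that for every integer $s\ge1$, $K=\lceil\log^s(n)\rceil$ and $m=\lceil n^{cK}\rceil$, the problem $\mathrm{CSP}^{\mathrm{rand},1-\eta}_{m}(\mathrm{XOR}_K)$ is hard. **Learning.** Let $p$ be a polynomial. A distribution $\mathcal D$ on $\{\pm1\}^n\times\{\pm1\}$ is *$\eta$-almost-realizable-with-margin* (with norm bound $p$) if there is $w\in\mathbb R^n$ with $\sum_{i=1}^n|w_i|\le p(n)$ and $\Pr_{(x,y)\sim\mathcal D}\left(y\langle w,x\rangle\le1\right)\le\eta$. A $\mathrm{poly}(n)$-time learning algorithm is a randomized algorithm that is given $n$ and independent examples from an unknown distribution $\mathcal D$ on $\{\pm1\}^n\times\{\pm1\}$, runs in time polynomial in $n$, and outputs a description of an arbitrary classifier $h:\{\pm1\}^n\to\{\pm1\}$ that can be evaluated in time polynomial in $n$ given its description. It has *non-trivial performance* on a family of distributions if there are constants $c,\delta>0$ such that, for all sufficiently large $n$ and every distribution $\mathcal D$ on $\{\pm1\}^n\times\{\pm1\}$ in the family, with probability at least $\delta$ it outputs $h$ with $\Pr_{(x,y)\sim\mathcal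 D}(h(x)\ne y)\le\frac12-\frac1{n^c}$. **Theorem.** There is a polynomial $p$ such that, for "almost-realizable-with-margin" with norm bound $p$: 1. Under Assumption 1, for all $\eta>0$, there is no $\mathrm{poly}(n)$-time learning algorithm with non-trivial performance on the distributions on $\{\pm1\}^n\times\{\pm1\}$ that are $\eta$-almost-realizable-with-margin. 2. Under Assumption 2, for all $\nu>0$, there is no $\mathrm{poly}(n)$-time learning algorithm with non-trivial performance on the distributions on $\{\pm1\}^n\times\{\pm1\}$ that are $2^{-\log^{1-\nu}(n)}$-almost-realizable-with-margin. -/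

import Mathlib

open Filter Topology

/-! ## Programs and running time

The machine model is a multi-stack machine over the binary alphabet, programmed by structured
commands. Every elementary command and every test costs one unit and touches one stack cell, so
one stack is one tape of a multi-tape Turing machine, and conversely two stacks are a tape:
running times agree with those of multi-tape Turing machines up to a polynomial (indeed up to
constant factors). A program mentions only finitely many of the stacks. -/

/-- Programs over binary stacks `0, 1, 2, …`. -/
inductive Prog : Type
  /-- do nothing -/
  | skip : Prog
  /-- push the bit `b` on stack `i` -/
  | push (i : ℕ) (b : Bool) : Prog
  /-- remove the top of stack `i` (no effect if it is empty) -/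
  | pop (i : ℕ) : Prog
  /-- first `P`, then `Q` -/
  | seq (P Q : Prog) : Prog
  /-- look at the top of stack `i`: run `P` if the stack is empty, `Q` if the top is `false`,
  `R` if the top is `true` -/
  | branch (i : ℕ) (P Q R : Prog) : Prog
  /-- while stack `i` is non-empty, run `P` -/
  | loop (i : ℕ) (P : Prog) : Prog

/-- The contents of the stacks (the head of a list is the top of the stack). -/
abbrev Store : Type := ℕ → List Bool

/-- `Exec P s s' t`: started in `s`, the program `P` halts in `s'` after `t` steps. -/
inductive Exec : Prog → Store → Store → ℕ → Prop
  | skip (s : Store) : Exec Prog.skip s s 1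
  | push (i : ℕ) (b : Bool) (s : Store) :
      Exec (Prog.push i b) s (Function.update s i (b :: s i)) 1
  | pop (i : ℕ) (s : Store) :
      Exec (Prog.pop i) s (Function.update s i (s i).tail) 1
  | seq {P Q : Prog} {s s' s'' : Store} {t t' : ℕ} :
      Exec P s s' t → Exec Q s' s'' t' → Exec (Prog.seq P Q) s s'' (t + t')
  | branchNil {i : ℕ} {P Q R : Prog} {s s' : Store} {t : ℕ} :
      s i = [] → Exec P s s' t → Exec (Prog.branch i P Q R) s s' (t + 1)
  | branchFalse {i : ℕ} {P Q R : Prog} {s s' : Store} {t : ℕ} {l : List Bool} :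
      s i = false :: l → Exec Q s s' t → Exec (Prog.branch i P Q R) s s' (t + 1)
  | branchTrue {i : ℕ} {P Q R : Prog} {s s' : Store} {t : ℕ} {l : List Bool} :
      s i = true :: l → Exec R s s' t → Exec (Prog.branch i P Q R) s s' (t + 1)
  | loopDone {i : ℕ} {P : Prog} {s : Store} :
      s i = [] → Exec (Prog.loop i P) s s 1
  | loopStep {i : ℕ} {P : Prog} {s s' s'' : Store} {t t' : ℕ} :
      s i ≠ [] → Exec P s s' t → Exec (Prog.loop i P) s' s'' t' →
        Exec (Prog.loop i P) s s'' (t + t' + 1)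

/-- `P.OutputsWithin inputs out T`: started with the strings `inputs` on stacks `0, 1, 2, …`
(all further stacks empty), `P` halts after at most `T` steps with `out` on stack `0`. -/
def Prog.OutputsWithin (P : Prog) (inputs : List (List Bool)) (out : List Bool) (T : ℕ) : Prop :=
  ∃ (s : Store) (t : ℕ), Exec P (fun i => inputs.getD i []) s t ∧ s 0 = out ∧ t ≤ T

/-! ## Encodings and probabilities -/

/-- The discrete cube `{±1}ⁿ`. -/
abbrev Cube (n : ℕ) : Type := Fin n → ℤˣ

/-- A labelled example `(x, y) ∈ {±1}ⁿ × {±1}`. -/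
abbrev Example (n : ℕ) : Type := Cube n × ℤˣ

/-- The number `n` in unary. -/
def unary (n : ℕ) : List Bool := List.replicate n true

/-- A sign as a bit: `1` is `true`, `-1` is `false`. -/
def signBit (u : ℤˣ) : Bool := decide (u = 1)

/-- A vector of signs as a bit string. -/
def encodeCube {n : ℕ} (x : Cube n) : List Bool := List.ofFn fun i => signBit (x i)

/-- A sample as a bit string: the examples one after the other, `n + 1` bits each. -/
def encodeSample {n m : ℕ} (S : Fin m → Example n) : List Bool :=
  (List.ofFn fun j => encodeCube (S j).1 ++ [signBit (S j).2]).flatten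

open Classical in
/-- The probability of the event `E` for a uniformly random element of the finite type `α`. -/
noncomputable def uniformProb {α : Type*} [Fintype α] (E : α → Prop) : ℝ :=
  ((Finset.univ.filter E).card : ℝ) / (Fintype.card α : ℝ)

open Classical in
/-- The probability of the event `E` under the distribution `D` on the finite type `α`. -/
noncomputable def prob {α : Type*} [Fintype α] (D : PMF α) (E : α → Prop) : ℝ :=
  ∑ a ∈ Finset.univ.filter E, (D a).toReal

/-! ## Random `K`-XOR -/

/-- `K`-tuples over `n` variables: `K` literals on `K` different variables. The literal number `i`
is the variable `C.1 i`, negated iff `C.2 i = -1`. -/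
abbrev KTuple (n K : ℕ) : Type := (Fin K ↪ Fin n) × (Fin K → ℤˣ)

/-- The value `C(ψ) ∈ {±1}^K` of a `K`-tuple at the assignment `ψ`. -/
def KTuple.apply {n K : ℕ} (C : KTuple n K) (ψ : Cube n) : Cube K :=
  fun i => C.2 i * ψ (C.1 i)

/-- The exclusive or in `±1` notation is the product. -/
def xorSign {K : ℕ} (z : Cube K) : ℤˣ := ∏ i, z i

/-- `K`-formulas with `m` constraints over `n` variables. -/
abbrev Formula (n K m : ℕ) : Type := Fin m → KTuple n K

/-- The fraction of the constraints of `J` that `ψ` satisfies. -/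
noncomputable def valueAt {n K m : ℕ} (J : Formula n K m) (ψ : Cube n) : ℝ :=
  ((Finset.univ.filter fun j => xorSign ((J j).apply ψ) = 1).card : ℝ) / (m : ℝ)

/-- The value of a formula: the maximum over all assignments. -/
noncomputable def value {n K m : ℕ} (J : Formula n K m) : ℝ := ⨆ ψ : Cube n, valueAt J ψ

/-- A formula as a bit string: its literals one after the other, each as its sign followed by the
index of its variable in unary and a closing `false`. -/
def encodeFormula {n K m : ℕ} (J : Formula n K m) : List Bool :=
  (List.ofFn fun j => (List.ofFn fun i =>
    signBit ((J j).2 i) :: (unary ((J j).1 i : ℕ) ++ [false])).flatten).flatten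

/-- The problem of distinguishing random `K(n)`-XOR formulas with `m(n)` constraints from formulas
of value at least `1 - η` is easy: there is a randomized algorithm `A`, running (on all inputs and
for all outcomes of its coins) in time polynomial in the size of the formula, which answers
`true` ("non-random") with probability at least `3/4` on formulas of value at least `1 - η`, and
`false` ("random") with probability at least `3/4` on all but an `o(1)` fraction of the formulas.
The coins are a uniformly random string of polynomial length, provided on an extra stack. -/
def XorEasy (K m : ℕ → ℕ) (η : ℝ) : Prop :=
  ∃ (A : Prog) (coins time : Polynomial ℕ)
    (answer : (n : ℕ) → Formula n (K n) (m n) →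
      (Fin (coins.eval (n + K n + m n)) → Bool) → Bool),
    (∀ n J r, A.OutputsWithin
      [unary n, unary (K n), unary (m n), encodeFormula J, List.ofFn r]
      [answer n J r] (time.eval (n + K n + m n))) ∧
    (∀ n J, 1 - η ≤ value J → 3 / 4 ≤ uniformProb fun r => answer n J r = true) ∧
    Tendsto (fun n => uniformProb fun J => 3 / 4 ≤ uniformProb fun r => answer n J r = false)
      atTop (𝓝 1)

/-- The random `K`-XOR assumption for constant `K`. -/
def XorAssumption : Prop :=
  ∃ c η : ℝ, 0 < c ∧ 0 < η ∧ η < 1 / 2 ∧ ∀ K : ℕ, 1 ≤ K →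
    ¬ XorEasy (fun _ => K) (fun n => ⌈(n : ℝ) ^ (c * Real.log K * √(K : ℝ))⌉₊) η

/-- `⌈log^s n⌉`. -/
noncomputable def polylog (s n : ℕ) : ℕ := ⌈Real.log n ^ s⌉₊

/-- The random `K`-XOR assumption for poly-logarithmic `K`. -/
def StrongXorAssumption : Prop :=
  ∃ c η : ℝ, 0 < c ∧ 0 < η ∧ η < 1 / 2 ∧ ∀ s : ℕ, 1 ≤ s →
    ¬ XorEasy (polylog s) (fun n => ⌈(n : ℝ) ^ (c * (polylog s n : ℝ))⌉₊) η

/-! ## Learning -/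

/-- A (randomized, improper) learning algorithm of polynomial running time for examples in
`{±1}ⁿ × {±1}`. Given `n`, polynomially many examples and polynomially many coins, the program `L`
outputs in time polynomial in `n` a description `d` of the classifier `hyp n S r`, and the program
`E` evaluates this classifier at any point, given `d`, in time polynomial in `n`. A polynomial-time
algorithm asks for at most polynomially many examples, so they may all be drawn in advance. -/
structure PolyTimeLearner : Type where
  /-- number of examples -/
  sampleSize : Polynomial ℕ
  /-- number of coins -/
  coins : Polynomial ℕ
  /-- the returned classifier -/
  hyp : (n : ℕ) → (Fin (sampleSize.eval n) → Example n) → (Fin (coins.eval n) → Bool) →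
    Cube n → ℤˣ
  polyTime : ∃ (L E : Prog) (time : Polynomial ℕ), ∀ n S r, ∃ d : List Bool,
    L.OutputsWithin [unary n, encodeSample S, List.ofFn r] d (time.eval n) ∧
    ∀ x, E.OutputsWithin [unary n, d, encodeCube x] [signBit (hyp n S r x)] (time.eval n)

/-- The error of a classifier `h` with respect to the distribution `D`. -/
noncomputable def err {n : ℕ} (D : PMF (Example n)) (h : Cube n → ℤˣ) : ℝ :=
  prob D fun e => h e.1 ≠ e.2

/-- The probability, over independent examples from `D` and the coins of `L`, that `L` returns
a classifier of error at most `ε`. -/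
noncomputable def PolyTimeLearner.successProb (L : PolyTimeLearner) {n : ℕ}
    (D : PMF (Example n)) (ε : ℝ) : ℝ :=
  ∑ S : Fin (L.sampleSize.eval n) → Example n,
    (∏ j, (D (S j)).toReal) * uniformProb fun r => err D (L.hyp n S r) ≤ ε

/-- `L` has non-trivial performance on the family `F` of distributions: for some `c > 0`, if `n` is
large enough then with at least a constant probability its output has error at most
`1/2 - 1/n^c`, whenever the distribution belongs to the family. (For `n = 1` the bound
`1/2 - 1/n^c` is negative.) -/
def PolyTimeLearner.NonTrivialOn (L : PolyTimeLearner)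
    (F : (n : ℕ) → PMF (Example n) → Prop) : Prop :=
  ∃ c δ : ℝ, 0 < c ∧ 0 < δ ∧ ∀ᶠ n : ℕ in atTop, ∀ D : PMF (Example n), F n D →
    δ ≤ L.successProb D (1 / 2 - 1 / (n : ℝ) ^ c)

/-- `D` is `η`-almost realizable with margin, by a vector of `ℓ¹` norm at most `B`. -/
def AlmostRealizableWithMargin {n : ℕ} (B η : ℝ) (D : PMF (Example n)) : Prop :=
  ∃ w : Fin n → ℝ, ∑ i, |w i| ≤ B ∧
    prob D (fun e => ((e.2 : ℤ) : ℝ) * ∑ i, w i * ((e.1 i : ℤ) : ℝ) ≤ 1) ≤ η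

/-! ## Running programs inside other programs -/

/-! A learner with non-trivial performance is turned into a refutation algorithm for random `K`-XOR.
From a formula `J` and coins one makes an example as follows. Its label `b` is a coin. Then `2d + 1`
constraints of `J` are picked at random. For a constraint with variables `v_i` and signs `σ_i`,
further coins give signs `ρ_i`, and the features are the `2d`-fold tensor power of a sign vector
encoding `1` and the `ρ_i x_{v_i}`, multiplied by the sign `κ = b ∏ σ_i ρ_i`.

Formulas of high value. Let `ψ` satisfy a `1 - η` fraction of the constraints. Then `κ ∏ ρ_i ψ(v_i)`
is `b` times the XOR of the constraint at `ψ`, hence equals the label for most constraints. A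
product of `K` signs is a function of their sum (`exists_parity_function`). The sum of the `ρ_i
ψ(v_i)` is a Rademacher sum, so it lies in `[-d, d]` up to probability `2 exp(-d²/2K)`, and on the
integers of this interval the product agrees with a polynomial of degree `2d`, that is, with a
linear form in the tensor power. Integer nodes keep the coefficients small
(`exists_constraint_weights`). Adding the forms of the `2d + 1` constraints takes a majority vote,
which makes the error exponentially small because `η < 1/2` (`exists_weights`,
`uniformProb_majority_le`). Thus the examples are almost realizable with margin
(`almostRealizable_exampleDist`), the learner beats guessing with constant probability, and this is
visible on fresh examples; a bounded number of rounds raises the probability to `3/4`.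

Random formulas. Multiplying the first literal of each constraint used by an example by the label of
that example permutes the formulas. If no constraint is used by two examples, this change of
variables removes the labels from the features, so the labels are independent fair coins and nobody
can guess them (`avg_uniformProb_labels_le`). Sharing a constraint is unlikely once `m` is a large
power of the dimension `N` of the examples (`uniformProb_collision_le`).

`xorEasy_of_nonTrivialOn` combines the two cases. It remains to choose `d`: somewhat larger than
`√K`, so that the Rademacher tail is small, but small enough that a fixed power of `N`, which is
roughly `n^{2d}`, stays below `m`.

The reduction must also run on the machine. `PolyFun` is a calculus of functions computable in time
polynomial in the total length of their input strings, closed under substitution, case distinction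
and bounded recursion. Numbers are in unary, so that a length bound on all intermediate values is
all that a recursion needs. -/

/-- Rename the stacks of a program. -/
def Prog.rename (f : ℕ → ℕ) : Prog → Prog
  | .skip => .skip
  | .push i b => .push (f i) b
  | .pop i => .pop (f i)
  | .seq P Q => .seq (P.rename f) (Q.rename f)
  | .branch i P Q R => .branch (f i) (P.rename f) (Q.rename f) (R.rename f)
  | .loop i P => .loop (f i) (P.rename f)

/-- All stacks mentioned by a program have a smaller number. -/
def Prog.stackBound : Prog → ℕ
  | .skip => 0
  | .push i _ => i + 1
  | .pop i => i + 1
  | .seq P Q => max P.stackBound Q.stackBound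
  | .branch i P Q R => max (i + 1) (max P.stackBound (max Q.stackBound R.stackBound))
  | .loop i P => max (i + 1) P.stackBound

/-- Injectivity keeps an update of one renamed stack from touching another. Stacks outside the range
of `f` are never mentioned, so a subprogram can run beside the data of its caller. -/
theorem Exec.rename {f : ℕ → ℕ} (hf : Function.Injective f) {P : Prog} {s s' : Store} {t : ℕ}
    (h : Exec P s s' t) : ∀ S : Store, (∀ i, S (f i) = s i) →
      ∃ S' : Store, Exec (P.rename f) S S' t ∧ (∀ i, S' (f i) = s' i) ∧
        ∀ j, j ∉ Set.range f → S' j = S j := by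
  induction h with
  | skip s => exact fun S hS => ⟨S, .skip S, hS, fun _ _ => rfl⟩
  | push i b s =>
    refine fun S hS => ⟨_, .push (f i) b S, fun k => ?_, fun j hj => ?_⟩
    · by_cases h : k = i
      · subst h; simp [hS]
      · simp [h, hf.ne h, hS]
    · rw [Function.update_of_ne]
      rintro rfl; exact hj ⟨i, rfl⟩
  | pop i s =>
    refine fun S hS => ⟨_, .pop (f i) S, fun k => ?_, fun j hj => ?_⟩
    · by_cases h : k = i
      · subst h; simp [hS]
      · simp [h, hf.ne h, hS]
    · rw [Function.update_of_ne]
      rintro rfl; exact hj ⟨i, rfl⟩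
  | seq _ _ ih1 ih2 =>
    intro S hS
    obtain ⟨S1, e1, a1, b1⟩ := ih1 S hS
    obtain ⟨S2, e2, a2, b2⟩ := ih2 S1 a1
    exact ⟨S2, .seq e1 e2, a2, fun j hj => (b2 j hj).trans (b1 j hj)⟩
  | branchNil h0 _ ih =>
    intro S hS
    obtain ⟨S1, e1, a1, b1⟩ := ih S hS
    exact ⟨S1, .branchNil ((hS _).trans h0) e1, a1, b1⟩
  | branchFalse h0 _ ih =>
    intro S hS
    obtain ⟨S1, e1, a1, b1⟩ := ih S hS
    exact ⟨S1, .branchFalse ((hS _).trans h0) e1, a1, b1⟩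
  | branchTrue h0 _ ih =>
    intro S hS
    obtain ⟨S1, e1, a1, b1⟩ := ih S hS
    exact ⟨S1, .branchTrue ((hS _).trans h0) e1, a1, b1⟩
  | loopDone h0 =>
    exact fun S hS => ⟨S, .loopDone ((hS _).trans h0), hS, fun _ _ => rfl⟩
  | loopStep h0 _ _ ih1 ih2 =>
    intro S hS
    obtain ⟨S1, e1, a1, b1⟩ := ih1 S hS
    obtain ⟨S2, e2, a2, b2⟩ := ih2 S1 a1
    exact ⟨S2, .loopStep (by rw [hS]; exact h0) e1 e2, a2,
      fun j hj => (b2 j hj).trans (b1 j hj)⟩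

/-- Used to see that clearing finitely many stacks removes everything a subprogram leaves behind. -/
theorem Exec.eq_of_stackBound_le {P : Prog} {s s' : Store} {t : ℕ} (h : Exec P s s' t) :
    ∀ j, P.stackBound ≤ j → s' j = s j := by
  induction h with
  | skip s => exact fun _ _ => rfl
  | push i b s => intro j hj; simp only [Prog.stackBound] at hj; simp [show j ≠ i by omega]
  | pop i s => intro j hj; simp only [Prog.stackBound] at hj; simp [show j ≠ i by omega]
  | seq _ _ ih1 ih2 =>
    intro j hj; simp only [Prog.stackBound] at hj
    exact (ih2 j (by omega)).trans (ih1 j (by omega))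
  | branchNil h0 _ ih => intro j hj; simp only [Prog.stackBound] at hj; exact ih j (by omega)
  | branchFalse h0 _ ih => intro j hj; simp only [Prog.stackBound] at hj; exact ih j (by omega)
  | branchTrue h0 _ ih => intro j hj; simp only [Prog.stackBound] at hj; exact ih j (by omega)
  | loopDone h0 => exact fun _ _ => rfl
  | loopStep h0 _ _ ih1 ih2 =>
    intro j hj
    have := hj; simp only [Prog.stackBound] at this
    exact (ih2 j hj).trans (ih1 j (by omega))

/-- Each unit of time pushes at most one bit. This bounds outputs, and the cost of cleaning up, by
the running time. -/
theorem Exec.length_le {P : Prog} {s s' : Store} {t : ℕ} (h : Exec P s s' t) :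
    ∀ j, (s' j).length ≤ (s j).length + t := by
  induction h with
  | skip s => intro j; omega
  | push i b s =>
    intro j
    by_cases h : j = i
    · subst h; simp
    · simp [h]
  | pop i s =>
    intro j
    by_cases h : j = i
    · subst h; simp; omega
    · simp [h]
  | seq _ _ ih1 ih2 => intro j; have := ih1 j; have := ih2 j; omega
  | branchNil h0 _ ih => intro j; have := ih j; omega
  | branchFalse h0 _ ih => intro j; have := ih j; omega
  | branchTrue h0 _ ih => intro j; have := ih j; omega
  | loopDone h0 => intro j; omega
  | loopStep h0 _ _ ih1 ih2 => intro j; have := ih1 j; have := ih2 j; omega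

/-! ### Elementary programs: moving, copying and clearing stacks. -/

/-- `P` leads from `s` to `s'` in at most `T` steps. -/
def Runs (P : Prog) (s s' : Store) (T : ℕ) : Prop := ∃ t ≤ T, Exec P s s' t

theorem Runs.mono {P : Prog} {s s' : Store} {T T' : ℕ} (h : Runs P s s' T) (hT : T ≤ T') :
    Runs P s s' T' := by
  obtain ⟨t, ht, e⟩ := h
  exact ⟨t, ht.trans hT, e⟩

theorem Runs.congr {P : Prog} {s s' s'' : Store} {T T' : ℕ} (h : Runs P s s' T) (hT : T ≤ T')
    (hs : s'' = s') : Runs P s s'' T' := hs ▸ h.mono hT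

theorem Exec.congr_left {P : Prog} {s s' s'' : Store} {t : ℕ} (h : Exec P s s' t)
    (hs : s'' = s) : Exec P s'' s' t := hs ▸ h

theorem Exec.congr_right {P : Prog} {s s' s'' : Store} {t : ℕ} (h : Exec P s s' t)
    (hs : s'' = s') : Exec P s s'' t := hs ▸ h

theorem Runs.seq {P Q : Prog} {s s' s'' : Store} {T T' : ℕ} (h : Runs P s s' T)
    (h' : Runs Q s' s'' T') : Runs (.seq P Q) s s'' (T + T') := by
  obtain ⟨t, ht, e⟩ := h
  obtain ⟨t', ht', e'⟩ := h'
  exact ⟨t + t', by omega, .seq e e'⟩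

/-- Move the content of stack `a` to stack `b`, reversing it. -/
def Prog.moveRev (a b : ℕ) : Prog :=
  .loop a (.branch a .skip (.seq (.pop a) (.push b false)) (.seq (.pop a) (.push b true)))

/-- Move the content of stack `a` to both stacks `b` and `c`, reversing it. -/
def Prog.dupRev (a b c : ℕ) : Prog :=
  .loop a (.branch a .skip
    (.seq (.pop a) (.seq (.push b false) (.push c false)))
    (.seq (.pop a) (.seq (.push b true) (.push c true))))

/-- Empty stack `a`. -/
def Prog.clear (a : ℕ) : Prog := .loop a (.pop a)

theorem runs_moveRev {a b : ℕ} (hab : a ≠ b) (l : List Bool) : ∀ s : Store, s a = l →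
    Runs (.moveRev a b) s (Function.update (Function.update s a []) b (l.reverse ++ s b))
      (4 * l.length + 1) := by
  induction l with
  | nil =>
    intro s hs
    refine ⟨1, by omega, ?_⟩
    have : Function.update (Function.update s a []) b ([].reverse ++ s b) = s := by
      funext x; by_cases hx : x = b
      · subst hx; simp
      · by_cases hx' : x = a
        · subst hx'; simp [hx, hs]
        · simp [hx, hx']
    rw [this]; exact .loopDone hs
  | cons x l ih =>
    intro s hs
    obtain ⟨t, ht, e⟩ := ih (Function.update (Function.update s a l) b (x :: s b))
      (by simp [hab])
    refine ⟨(1 + 1 + 1) + t + 1, by simp; omega, ?_⟩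
    refine .loopStep (by simp [hs]) (s' := Function.update (Function.update s a l) b (x :: s b)) ?_ ?_
    · have e1 : Exec (.pop a) s (Function.update s a l) 1 := by
        have := Exec.pop a s; rwa [hs] at this
      have e2 : ∀ y, Exec (.push b y) (Function.update s a l)
          (Function.update (Function.update s a l) b (y :: s b)) 1 := fun y => by
        have := Exec.push b y (Function.update s a l)
        rwa [Function.update_of_ne hab.symm] at this
      cases x
      · exact .branchFalse hs (.seq e1 (e2 _))
      · exact .branchTrue hs (.seq e1 (e2 _))
    · refine e.congr_right ?_
      funext y; by_cases hy : y = b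
      · subst hy; simp
      · by_cases hy' : y = a
        · subst hy'; simp [hy]
        · simp [hy, hy']

theorem runs_dupRev {a b c : ℕ} (hab : a ≠ b) (hac : a ≠ c) (hbc : b ≠ c) (l : List Bool) :
    ∀ s : Store, s a = l →
    Runs (.dupRev a b c) s
      (Function.update (Function.update (Function.update s a []) b (l.reverse ++ s b)) c
        (l.reverse ++ s c)) (5 * l.length + 1) := by
  induction l with
  | nil =>
    intro s hs
    refine ⟨1, by omega, ?_⟩
    have : Function.update (Function.update (Function.update s a []) b ([].reverse ++ s b)) c
        ([].reverse ++ s c) = s := by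
      funext x; by_cases hx : x = c
      · subst hx; simp
      · by_cases hx' : x = b
        · subst hx'; simp [hx]
        · by_cases hx'' : x = a
          · subst hx''; simp [hx, hx', hs]
          · simp [hx, hx', hx'']
    rw [this]; exact .loopDone hs
  | cons x l ih =>
    intro s hs
    obtain ⟨t, ht, e⟩ := ih (Function.update (Function.update (Function.update s a l) b (x :: s b))
      c (x :: s c)) (by simp [hab, hac])
    refine ⟨(1 + (1 + 1) + 1) + t + 1, by simp; omega, ?_⟩
    refine .loopStep (by simp [hs]) (s' := Function.update (Function.update (Function.update s a l)
      b (x :: s b)) c (x :: s c)) ?_ ?_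
    · have e1 : Exec (.pop a) s (Function.update s a l) 1 := by
        have := Exec.pop a s; rwa [hs] at this
      have e2 : ∀ y, Exec (.push b y) (Function.update s a l)
          (Function.update (Function.update s a l) b (y :: s b)) 1 := fun y => by
        have := Exec.push b y (Function.update s a l)
        rwa [Function.update_of_ne hab.symm] at this
      have e3 : ∀ y, Exec (.push c y) (Function.update (Function.update s a l) b (y :: s b))
          (Function.update (Function.update (Function.update s a l) b (y :: s b)) c (y :: s c)) 1 :=
        fun y => by
        have := Exec.push c y (Function.update (Function.update s a l) b (y :: s b))
        rwa [Function.update_of_ne hbc.symm, Function.update_of_ne hac.symm] at this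
      cases x
      · exact .branchFalse hs (.seq e1 (.seq (e2 _) (e3 _)))
      · exact .branchTrue hs (.seq e1 (.seq (e2 _) (e3 _)))
    · refine e.congr_right ?_
      funext y; by_cases hy : y = c
      · subst hy; simp
      · by_cases hy' : y = b
        · subst hy'; simp [hy]
        · by_cases hy'' : y = a
          · subst hy''; simp [hy, hy']
          · simp [hy, hy', hy'']

theorem runs_clear {a : ℕ} (l : List Bool) : ∀ s : Store, s a = l →
    Runs (.clear a) s (Function.update s a []) (2 * l.length + 1) := by
  induction l with
  | nil =>
    intro s hs
    refine ⟨1, by omega, ?_⟩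
    rw [show Function.update s a [] = s by rw [← hs]; simp]
    exact .loopDone hs
  | cons x l ih =>
    intro s hs
    obtain ⟨t, ht, e⟩ := ih (Function.update s a l) (by simp)
    refine ⟨1 + t + 1, by simp; omega, ?_⟩
    refine .loopStep (by simp [hs]) (s' := Function.update s a l) ?_ ?_
    · have := Exec.pop a s; rwa [hs] at this
    · exact e.congr_right (by simp)

/-- Copy stack `a` to stack `b`, with the help of the empty stack `c`. -/
def Prog.dup (a b c : ℕ) : Prog := .seq (.moveRev a c) (.dupRev c a b)

/-- Two reversals cancel: `a` is moved to the scratch stack `c`, and from there back to `a` and to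
`b` simultaneously. -/
theorem runs_dup {a b c : ℕ} (hab : a ≠ b) (hac : a ≠ c) (hbc : b ≠ c) (s : Store)
    (hc : s c = []) (hb : s b = []) :
    Runs (.dup a b c) s (Function.update s b (s a)) (9 * (s a).length + 2) := by
  have h1 := runs_moveRev hac (s a) s rfl
  have h2 := runs_dupRev hac.symm hbc.symm hab (s a).reverse
    (Function.update (Function.update s a []) c ((s a).reverse ++ s c)) (by simp [hc])
  refine (h1.seq h2).congr (by simp; omega) ?_
  funext y; by_cases hy : y = b
  · subst hy; simp [hab.symm, hbc, hb]
  · by_cases hy' : y = a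
    · subst hy'; simp [hy, hac]
    · by_cases hy'' : y = c
      · subst hy''; simp [hy, hy', hc]
      · simp [hy, hy', hy'']

/-- Empty the stacks `a, …, a + k - 1`. -/
def Prog.clearRange (a : ℕ) : ℕ → Prog
  | 0 => .skip
  | k + 1 => .seq (Prog.clearRange a k) (.clear (a + k))

theorem runs_clearRange (a k B : ℕ) (s : Store) (hB : ∀ x, a ≤ x → (s x).length ≤ B) :
    Runs (.clearRange a k) s (fun x => if a ≤ x ∧ x < a + k then [] else s x)
      (k * (2 * B + 1) + 1) := by
  induction k with
  | zero =>
    refine ⟨1, by omega, ?_⟩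
    refine (Exec.skip s).congr_right ?_
    funext x; rw [if_neg (by omega)]
  | succ k ih =>
    have h2 := runs_clear (a := a + k) _ (fun x => if a ≤ x ∧ x < a + k then [] else s x) rfl
    refine (ih.seq h2).congr ?_ ?_
    · have := hB (a + k) (by omega)
      simp
      nlinarith
    · funext x; by_cases hx : x = a + k
      · subst hx; simp
      · simp only [Function.update_of_ne hx]
        congr 1
        apply propext; omega

/-- Copy the stacks with numbers in `js` to the stacks `off + 1 + r, off + 2 + r, …`. -/
def Prog.copyIn (off : ℕ) : ℕ → List ℕ → Prog
  | _, [] => .skip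
  | r, j :: js => .seq (.dup j (off + 1 + r) off) (Prog.copyIn off (r + 1) js)

/-- Total length of a list of strings. -/
def total (l : List (List Bool)) : ℕ := (l.map List.length).sum

@[simp] theorem total_nil : total [] = 0 := rfl
@[simp] theorem total_cons (a : List Bool) (l : List (List Bool)) :
    total (a :: l) = a.length + total l := by simp [total]
@[simp] theorem total_append (l l' : List (List Bool)) :
    total (l ++ l') = total l + total l' := by simp [total]

theorem length_le_total {a : List Bool} {l : List (List Bool)} (h : a ∈ l) :
    a.length ≤ total l := by
  induction l with
  | nil => simp at h
  | cons b l ih =>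
    rcases List.mem_cons.1 h with rfl | h
    · simp
    · have := ih h; simp; omega

theorem length_getD_le_total (l : List (List Bool)) (i : ℕ) :
    (l.getD i []).length ≤ total l := by
  by_cases h : i < l.length
  · rw [List.getD_eq_getElem _ _ h]; exact length_le_total (List.getElem_mem h)
  · rw [List.getD_eq_default _ _ (by omega)]; simp

theorem runs_copyIn (off : ℕ) (js : List ℕ) : ∀ (r : ℕ) (s : Store), (∀ j ∈ js, j < off) →
    s off = [] → (∀ x, off + 1 + r ≤ x → s x = []) →
    Runs (.copyIn off r js) s
      (fun x => if off + 1 + r ≤ x then (js.map s).getD (x - (off + 1 + r)) [] else s x)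
      (9 * total (js.map s) + 2 * js.length + 1) := by
  induction js with
  | nil =>
    intro r s _ _ hs
    refine ⟨1, by omega, ?_⟩
    refine (Exec.skip s).congr_right ?_
    funext x; split_ifs with h
    · simp [hs x h]
    · rfl
  | cons j js ih =>
    intro r s hjs hoff hs
    have hj : j < off := hjs j (by simp)
    have h1 := runs_dup (a := j) (b := off + 1 + r) (c := off) (by omega) (by omega) (by omega) s
      hoff (hs _ le_rfl)
    have h2 := ih (r + 1) (Function.update s (off + 1 + r) (s j))
      (fun j' hj' => hjs j' (by simp [hj'])) (by rw [Function.update_of_ne (by omega)]; exact hoff)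
      (fun x hx => by rw [Function.update_of_ne (by omega)]; exact hs x (by omega))
    have hmap : js.map (Function.update s (off + 1 + r) (s j)) = js.map s := by
      apply List.map_congr_left
      intro j' hj'
      have := hjs j' (by simp [hj'])
      rw [Function.update_of_ne (by omega)]
    rw [hmap] at h2
    refine (h1.seq h2).congr ?_ ?_
    · simp; omega
    · funext x
      by_cases hx : x = off + 1 + r
      · subst hx; simp
      · by_cases hx' : off + 1 + r ≤ x
        · rw [if_pos hx', if_pos (by omega)]
          obtain ⟨y, rfl⟩ := Nat.exists_eq_add_of_lt (lt_of_le_of_ne hx' (Ne.symm hx))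
          rw [show off + 1 + r + y + 1 - (off + 1 + r) = y + 1 by omega,
            show off + 1 + r + y + 1 - (off + 1 + (r + 1)) = y by omega]
          simp
        · rw [if_neg hx', if_neg (by omega), Function.update_of_ne hx]

/-- Run `P` on copies of the stacks `js` and write its output on stack `o`. The stacks from `off`
on serve as working space. -/
def Prog.call (js : List ℕ) (P : Prog) (o off : ℕ) : Prog :=
  .seq (.copyIn off 0 js) (.seq (P.rename fun i => off + 1 + i) (.seq (.clear o)
    (.seq (.moveRev (off + 1) off) (.seq (.moveRev off o)
      (.clearRange (off + 1) (max P.stackBound js.length))))))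

/-- The constant depends only on the program and not on the store. The working space is empty again
at the end, so calls can be chained and put into loops with the same `off`. -/
theorem runs_call (js : List ℕ) (P : Prog) (o off : ℕ) (hjs : ∀ j ∈ js, j < off) (ho : o < off) :
    ∃ C, ∀ (s : Store) (out : List Bool) (T : ℕ), (∀ x, off ≤ x → s x = []) →
      P.OutputsWithin (js.map s) out T →
      Runs (.call js P o off) s (Function.update s o out)
        (C * (total (js.map s) + T + (s o).length + 1)) := by
  refine ⟨9 + 2 * js.length + 1 + 1 + 3 + 10 + (max P.stackBound js.length) * 3 + 1, ?_⟩
  rintro s out T hs ⟨s', t, hex, hout, ht⟩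
  have h1 := runs_copyIn off js 0 s hjs (hs _ le_rfl) (fun x hx => hs x (by omega))
  set s1 : Store := fun x => if off + 1 + 0 ≤ x then (js.map s).getD (x - (off + 1 + 0)) [] else s x
    with hs1
  obtain ⟨S, e, hS1, hS2⟩ := hex.rename (f := fun i => off + 1 + i)
    (fun a b h => by simpa using h) s1 (fun i => by
      simp only [hs1]; rw [if_pos (by omega), show off + 1 + i - (off + 1 + 0) = i by omega])
  have h2 : Runs (P.rename fun i => off + 1 + i) s1 S T := ⟨t, ht, e⟩
  have hlow : ∀ x, x ≤ off → S x = s x := by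
    intro x hx
    rw [hS2 x (by rintro ⟨y, hy⟩; simp only at hy; omega)]
    simp only [hs1]; rw [if_neg (by omega)]
  have hoff : S off = [] := by rw [hlow off le_rfl]; exact hs off le_rfl
  have h3 := runs_clear (a := o) _ S rfl
  set S3 := Function.update S o [] with hS3
  have h4 := runs_moveRev (a := off + 1) (b := off) (by omega) _ S3 rfl
  have hout' : S3 (off + 1) = out := by
    rw [hS3, Function.update_of_ne (by omega), ← hout]; exact hS1 0
  rw [hout'] at h4
  set S4 := Function.update (Function.update S3 (off + 1) []) off (out.reverse ++ S3 off) with hS4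
  have hS4off : S4 off = out.reverse := by
    simp [hS4, hS3, hoff, show off ≠ o by omega]
  have h5 := runs_moveRev (a := off) (b := o) (by omega) _ S4 rfl
  rw [hS4off] at h5
  set S5 := Function.update (Function.update S4 off []) o (out.reverse.reverse ++ S4 o) with hS5
  set B := total (js.map s) + T with hB
  have hlen : ∀ x, off + 1 ≤ x → (S5 x).length ≤ B := by
    intro x hx
    rw [hS5, Function.update_of_ne (by omega), Function.update_of_ne (by omega), hS4,
      Function.update_of_ne (by omega)]
    by_cases hx' : x = off + 1
    · subst hx'; simp
    · rw [Function.update_of_ne hx', hS3, Function.update_of_ne (by omega)]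
      obtain ⟨y, rfl⟩ := Nat.exists_eq_add_of_le hx
      rw [hS1]
      have a1 := hex.length_le y
      have a2 := length_getD_le_total (js.map s) y
      omega
  have h6 := runs_clearRange (off + 1) (max P.stackBound js.length) B S5 hlen
  have hol : out.length ≤ B := by
    have a1 := hex.length_le 0
    have a2 := length_getD_le_total (js.map s) 0
    rw [hout] at a1
    omega
  refine (h1.seq (h2.seq (h3.seq (h4.seq (h5.seq h6))))).congr ?_ ?_
  · have : (S o).length = (s o).length := by rw [hlow o ho.le]
    rw [this]
    simp only [List.length_reverse]
    set M := max P.stackBound js.length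
    have e1 : M * (2 * B + 1) ≤ M * 3 * (B + (s o).length + 1) := by nlinarith
    have e2 : 2 * js.length ≤ 2 * js.length * (B + (s o).length + 1) := by nlinarith
    nlinarith
  · funext x
    by_cases hxo : x = o
    · subst hxo
      rw [if_neg (by omega)]
      simp only [hS5, hS4, hS3, Function.update_self]
      rw [Function.update_of_ne (by omega), Function.update_of_ne (by omega)]
      simp
    · rw [Function.update_of_ne hxo]
      by_cases hx : x < off
      · rw [if_neg (by omega)]
        simp only [hS5, hS4, hS3]
        rw [Function.update_of_ne hxo, Function.update_of_ne (by omega),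
          Function.update_of_ne (by omega), Function.update_of_ne (by omega),
          Function.update_of_ne hxo, hlow x (by omega)]
      · rw [hs x (by omega)]
        by_cases hx' : x = off
        · subst hx'
          rw [if_neg (by omega)]
          simp [hS5, hxo]
        · obtain ⟨y, rfl⟩ := Nat.exists_eq_add_of_le (show off + 1 ≤ x by omega)
          split_ifs with hy
          · rfl
          -- Beyond the cleared range there are neither copied arguments nor stacks that `P` can
          -- write to.
          · have hy' : max P.stackBound js.length ≤ y := by omega
            simp only [hS5, hS4, hS3]
            by_cases hy0 : y = 0
            · subst hy0
              rw [Function.update_of_ne hxo, Function.update_of_ne (by omega),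
                Function.update_of_ne (by omega)]
              simp
            · rw [Function.update_of_ne hxo, Function.update_of_ne (by omega),
                Function.update_of_ne (by omega), Function.update_of_ne (by omega),
                Function.update_of_ne hxo, hS1, hex.eq_of_stackBound_le y (by omega)]
              rw [List.getD_eq_default]
              simp; omega

/-! ## Polynomial-time functions of several strings -/

theorem Polynomial.eval_mono_nat (p : Polynomial ℕ) {a b : ℕ} (h : a ≤ b) :
    p.eval a ≤ p.eval b := by
  rw [Polynomial.eval_eq_sum_range, Polynomial.eval_eq_sum_range]
  gcongr

/-- The strings `env`, at the parameter `i`. -/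
abbrev envAt {I : Type*} (env : List (I → List Bool)) (i : I) : List (List Bool) :=
  env.map fun f => f i

/-- `out` can be computed from the strings `env` in time polynomial in their total length,
uniformly in the parameter `i`. -/
def PolyFun {I : Type*} (env : List (I → List Bool)) (out : I → List Bool) : Prop :=
  ∃ (P : Prog) (p : Polynomial ℕ), ∀ i,
    P.OutputsWithin (envAt env i) (out i) (p.eval (total (envAt env i)))

namespace PolyFun

variable {I J : Type*} {env env' : List (I → List Bool)} {a b c out : I → List Bool}

theorem reindex (h : PolyFun env out) (φ : J → I) :
    PolyFun (env.map fun f => f ∘ φ) (out ∘ φ) := by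
  obtain ⟨P, p, hP⟩ := h
  refine ⟨P, p, fun j => ?_⟩
  have := hP (φ j)
  simpa [envAt, Function.comp_def] using this

theorem congr (h : PolyFun env out) (h' : ∀ i, a i = out i) : PolyFun env a := by
  rwa [show a = out from funext h']

theorem length_le (h : PolyFun env out) :
    ∃ p : Polynomial ℕ, ∀ i, (out i).length ≤ p.eval (total (envAt env i)) := by
  obtain ⟨P, p, hP⟩ := h
  refine ⟨Polynomial.X + p, fun i => ?_⟩
  obtain ⟨s, t, e, ho, ht⟩ := hP i
  have h1 := e.length_le 0
  have h2 := length_getD_le_total (envAt env i) 0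
  rw [ho] at h1
  simp only [Polynomial.eval_add, Polynomial.eval_X]
  omega

theorem of_runs {P : Prog} (p : Polynomial ℕ)
    (h : ∀ i, ∃ s' : Store, Runs P (fun j => (envAt env i).getD j []) s'
      (p.eval (total (envAt env i))) ∧ s' 0 = out i) : PolyFun env out := by
  refine ⟨P, p, fun i => ?_⟩
  obtain ⟨s', ⟨t, ht, e⟩, h0⟩ := h i
  exact ⟨s', t, e, h0, ht⟩

/-- Since a call copies its arguments, it realises every permutation, repetition or omission of the
strings of an environment. All structural rules follow from this. -/
theorem select {js : List ℕ} (hjs : ∀ j ∈ js, j < env.length)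
    (henv : ∀ i, envAt env' i = js.map fun j => (envAt env i).getD j [])
    (htot : ∀ i, total (envAt env' i) ≤ js.length * total (envAt env i))
    (h : PolyFun env' out) : PolyFun env out := by
  obtain ⟨P, p, hP⟩ := h
  obtain ⟨C, hC⟩ := runs_call js P 0 (env.length + 1) (fun j hj => by have := hjs j hj; omega)
    (by omega)
  refine of_runs (P := .call js P 0 (env.length + 1))
    (.C C * (.C js.length * .X + p.comp (.C js.length * .X) + .X + 1)) (fun i =>
    ⟨Function.update (fun j => (envAt env i).getD j []) 0 (out i), ?_, by simp⟩)
  refine (hC (fun j => (envAt env i).getD j []) (out i) (p.eval (total (envAt env' i))) ?_ ?_).mono ?_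
  · intro x hx
    rw [List.getD_eq_default]; simp; omega
  · rw [← henv]; exact hP i
  · rw [← henv]
    have h1 := htot i
    have h2 := length_getD_le_total (envAt env i) 0
    have h3 := p.eval_mono_nat h1
    simp only [Polynomial.eval_mul, Polynomial.eval_add, Polynomial.eval_C, Polynomial.eval_X,
      Polynomial.eval_comp, Polynomial.eval_one]
    gcongr

theorem select' {js : List ℕ} (hjs : ∀ j ∈ js, j < env.length)
    (henv : ∀ i, envAt env' i = js.map fun j => (envAt env i).getD j [])
    (h : PolyFun env' out) : PolyFun env out := by
  refine select hjs henv (fun i => ?_) h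
  rw [henv]
  clear henv hjs
  induction js with
  | nil => simp
  | cons j js ih =>
    have := length_getD_le_total (envAt env i) j
    simp only [List.map_cons, total_cons, List.length_cons]
    rw [Nat.add_mul]; omega

theorem weaken_append (h : PolyFun env out) : PolyFun (env ++ env') out := by
  refine select' (js := List.range env.length) (fun j hj => ?_) (fun i => ?_) h
  · have := List.mem_range.1 hj; simp; omega
  · apply List.ext_getElem
    · simp
    · intro n h _
      simp only [envAt, List.length_map] at h
      simp [List.getElem?_append_left (show n < (env.map fun f => f i).length by simpa using h), h]

theorem weaken_prepend (h : PolyFun env out) : PolyFun (env' ++ env) out := by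
  refine select' (js := (List.range env.length).map (env'.length + ·)) (fun j hj => ?_)
    (fun i => ?_) h
  · obtain ⟨k, hk, rfl⟩ := List.mem_map.1 hj
    have := List.mem_range.1 hk
    simp; omega
  · apply List.ext_getElem <;> simp
    intro n h
    simp [h]

theorem var (h : a ∈ env) : PolyFun env a := by
  obtain ⟨j, hj, rfl⟩ := List.getElem_of_mem h
  have : PolyFun [env[j]] env[j] :=
    of_runs (P := .skip) 1 (fun i => ⟨_, ⟨1, by simp, .skip _⟩, by simp⟩)
  refine select' (js := [j]) (by simpa using hj) (fun i => ?_) this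
  simp [hj]

/-- The auxiliary string is written on the first unused stack, which turns the store for `env` into
the store for `env ++ [a]`. Its length is polynomially bounded, so the composed running time is
polynomial. -/
theorem let_ (ha : PolyFun env a) (h : PolyFun (env ++ [a]) out) : PolyFun env out := by
  obtain ⟨pa, hpa⟩ := ha.length_le
  obtain ⟨P, p, hP⟩ := ha
  obtain ⟨Q, q, hQ⟩ := h
  set k := env.length with hk
  obtain ⟨C, hC⟩ := runs_call (List.range k) P k (k + 1)
    (fun j hj => by have := List.mem_range.1 hj; omega) (by omega)
  have hmap : ∀ i, (List.range k).map (fun j => (envAt env i).getD j []) = envAt env i := by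
    intro i
    apply List.ext_getElem <;> simp [hk]
    intro n h; simp [h]
  refine ⟨.seq (.call (List.range k) P k (k + 1)) Q,
    .C C * (.X + p + 1) + q.comp (.X + pa), fun i => ?_⟩
  have h1 := hC (fun j => (envAt env i).getD j []) (a i) (p.eval (total (envAt env i)))
    (fun x hx => by rw [List.getD_eq_default]; simp; omega)
    (by rw [hmap]; exact hP i)
  obtain ⟨s, t, e, ho, ht⟩ := hQ i
  have h2 : Runs Q _ s (q.eval (total (envAt (env ++ [a]) i))) := ⟨t, ht, e⟩
  have hst : Function.update (fun j => (envAt env i).getD j []) k (a i) =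
      fun j => (envAt (env ++ [a]) i).getD j [] := by
    funext j
    by_cases hj : j = k
    · subst hj; simp [hk]
    · rw [Function.update_of_ne hj]
      rcases lt_or_gt_of_ne hj with h | h
      · simp only [envAt, List.map_append, List.getD_eq_getElem?_getD]
        rw [List.getElem?_append_left (by simpa using h)]
      · rw [List.getD_eq_default, List.getD_eq_default] <;> simp <;> omega
  rw [← hst] at h2
  obtain ⟨t', ht', e'⟩ := h1.seq h2
  refine ⟨s, t', e', ho, ht'.trans ?_⟩
  rw [hmap]
  have h3 : ((envAt env i).getD k []).length = 0 := by
    rw [List.getD_eq_default]; simp; simp [hk]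
  simp only [h3, Polynomial.eval_mul, Polynomial.eval_add, Polynomial.eval_C, Polynomial.eval_X,
      Polynomial.eval_comp, Polynomial.eval_one]
  have h4 := q.eval_mono_nat (show total (envAt (env ++ [a]) i) ≤ total (envAt env i) +
    pa.eval (total (envAt env i)) by simp [envAt]; exact hpa i)
  rw [add_zero]
  gcongr

theorem subst_append (he : ∀ f ∈ env', PolyFun env f) (h : PolyFun (env ++ env') out) :
    PolyFun env out := by
  induction env' using List.reverseRecOn with
  | nil => simpa using h
  | append_singleton e f ih =>
    refine ih (fun g hg => he g (by simp [hg])) ?_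
    rw [← List.append_assoc] at h
    exact let_ (weaken_append (he f (by simp))) h

theorem subst (he : ∀ f ∈ env', PolyFun env f) (h : PolyFun env' out) : PolyFun env out :=
  subst_append he (weaken_prepend h)

theorem mono (hs : env' ⊆ env) (h : PolyFun env' out) : PolyFun env out :=
  subst (fun _ hf => var (hs hf)) h

theorem comp {envJ : List (J → List Bool)} {F : J → List Bool} (hF : PolyFun envJ F) (φ : I → J)
    (h : ∀ f ∈ envJ, PolyFun env (f ∘ φ)) : PolyFun env (F ∘ φ) := by
  refine subst ?_ (hF.reindex φ)
  intro f hf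
  obtain ⟨g, hg, rfl⟩ := List.mem_map.1 hf
  exact h g hg

theorem nil : PolyFun env (fun _ => []) := by
  have : PolyFun ([] : List (I → List Bool)) (fun _ => []) :=
    of_runs (P := .skip) 1 (fun i => ⟨_, ⟨1, by simp, .skip _⟩, by simp⟩)
  exact this.mono (by simp)

theorem cons (x : Bool) (h : PolyFun env a) : PolyFun env (fun i => x :: a i) := by
  obtain ⟨P, p, hP⟩ := h
  refine ⟨.seq P (.push 0 x), p + 1, fun i => ?_⟩
  obtain ⟨s, t, e, ho, ht⟩ := hP i
  exact ⟨_, _, .seq e (.push 0 x s), by simp [ho], by simpa using ht⟩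

theorem tail (h : PolyFun env a) : PolyFun env (fun i => (a i).tail) := by
  obtain ⟨P, p, hP⟩ := h
  refine ⟨.seq P (.pop 0), p + 1, fun i => ?_⟩
  obtain ⟨s, t, e, ho, ht⟩ := hP i
  exact ⟨_, _, .seq e (.pop 0 s), by simp [ho], by simpa using ht⟩

/-- The restriction of an environment to the parameters with a property. -/
abbrev restrict (env : List (I → List Bool)) (p : I → Prop) : List ({i // p i} → List Bool) :=
  env.map fun f => f ∘ Subtype.val

/-- Each case needs to be computable only for the parameters that reach it, hence the restricted
environments. This later allows size conditions that hold only for large `n`. -/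
theorem branch (hc : PolyFun env c)
    (h0 : PolyFun (restrict env fun i => c i = []) (out ∘ Subtype.val))
    (hf : PolyFun (restrict env fun i => (c i).head? = some false) (out ∘ Subtype.val))
    (ht : PolyFun (restrict env fun i => (c i).head? = some true) (out ∘ Subtype.val)) :
    PolyFun env out := by
  refine let_ hc ?_
  obtain ⟨P0, p0, h0⟩ := weaken_append (env' := [c ∘ Subtype.val]) h0
  obtain ⟨Pf, pf, hf⟩ := weaken_append (env' := [c ∘ Subtype.val]) hf
  obtain ⟨Pt, pt, ht⟩ := weaken_append (env' := [c ∘ Subtype.val]) ht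
  refine ⟨.branch env.length P0 Pf Pt, p0 + pf + pt + 1, fun i => ?_⟩
  have key : ∀ (q : I → Prop) (h : q i),
      envAt (restrict env q ++ [c ∘ Subtype.val]) ⟨i, h⟩ = envAt (env ++ [c]) i := by
    intro q h; simp [envAt]
  have hget : (envAt (env ++ [c]) i).getD env.length [] = c i := by simp
  simp only [Polynomial.eval_add, Polynomial.eval_one]
  rcases hci : c i with _ | ⟨_ | _, l⟩
  · obtain ⟨s, t, e, ho, ht⟩ := h0 ⟨i, hci⟩
    rw [key] at e ht
    exact ⟨s, _, .branchNil (hget.trans hci) e, ho, by omega⟩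
  · obtain ⟨s, t, e, ho, ht⟩ := hf ⟨i, by simp [hci]⟩
    rw [key] at e ht
    exact ⟨s, _, .branchFalse (hget.trans hci) e, ho, by omega⟩
  · obtain ⟨s, t, e, ho, ht⟩ := ht ⟨i, by simp [hci]⟩
    rw [key] at e ht
    exact ⟨s, _, .branchTrue (hget.trans hci) e, ho, by omega⟩

/-- Stack `k` is consumed as a clock, `k + 1` carries the state and `k + 2` counts the finished
steps in unary. The bound `B` on all states is essential: iterating a polynomial growth of lengths
could be exponential. -/
theorem runs_iterate (k : ℕ) (env : List (I → List Bool)) (cnt : I → List Bool)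
    (acc : I → ℕ → List Bool) (P : Prog) (p : Polynomial ℕ)
    (hk : k = env.length)
    (hP : ∀ i n, n < (cnt i).length → P.OutputsWithin (envAt env i ++ [unary n, acc i n])
      (acc i (n + 1)) (p.eval (total (envAt env i) + n + (acc i n).length))) :
    ∃ Q : Prog, ∃ C : ℕ, ∀ i B, (∀ n ≤ (cnt i).length, (acc i n).length ≤ B) →
      Runs Q (fun j => (envAt env i ++ [cnt i, acc i 0]).getD j [])
        (fun j => (envAt env i ++ [[], acc i (cnt i).length, unary (cnt i).length]).getD j [])
        ((cnt i).length * (C * (total (envAt env i) + (cnt i).length + B +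
          p.eval (total (envAt env i) + (cnt i).length + B) + B + 1) + 5) + 1) := by
  -- The order `k + 2`, `k + 1` matches the argument order of `P`: first the counter, then the
  -- state. The output overwrites the state.
  obtain ⟨C, hC⟩ := runs_call (List.range k ++ [k + 2, k + 1]) P (k + 1) (k + 3)
    (fun j hj => by simp at hj; omega) (by omega)
  refine ⟨.loop k (.seq (.pop k) (.seq (.call (List.range k ++ [k + 2, k + 1]) P (k + 1) (k + 3))
    (.push (k + 2) true))), C, fun i B hB => ?_⟩
  set T := C * (total (envAt env i) + (cnt i).length + B +
          p.eval (total (envAt env i) + (cnt i).length + B) + B + 1) + 5 with hT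
  have hstate : ∀ (l : List Bool) (n : ℕ), n + l.length = (cnt i).length →
      Runs (.loop k (.seq (.pop k) (.seq (.call (List.range k ++ [k + 2, k + 1]) P (k + 1) (k + 3))
        (.push (k + 2) true)))) (fun j => (envAt env i ++ [l, acc i n, unary n]).getD j [])
        (fun j => (envAt env i ++ [[], acc i (cnt i).length, unary (cnt i).length]).getD j [])
        (l.length * T + 1) := by
    have hlen : (envAt env i).length = k := by simp [hk]
    have get0 : ∀ l : List (List Bool), ∀ x, x < k → (envAt env i ++ l).getD x [] =
        (envAt env i).getD x [] := by
      intro l x hx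
      simp only [List.getD_eq_getElem?_getD]
      rw [List.getElem?_append_left (by omega)]
    have get1 : ∀ l : List (List Bool), ∀ x, (envAt env i ++ l).getD (k + x) [] = l.getD x [] := by
      intro l x
      simp only [List.getD_eq_getElem?_getD]
      rw [List.getElem?_append_right (by omega), show k + x - (envAt env i).length = x by omega]
    have ext : ∀ s s' : Store, (∀ x < k, s x = s' x) → (∀ x, s (k + x) = s' (k + x)) → s = s' := by
      intro s s' h1 h2
      funext x
      by_cases hx : x < k
      · exact h1 x hx
      · obtain ⟨y, rfl⟩ := Nat.exists_eq_add_of_le (not_lt.1 hx); exact h2 y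
    intro l
    induction l with
    | nil =>
      intro n hn
      simp at hn; subst hn
      exact ⟨1, by simp, .loopDone (by simpa using get1 [[], acc i (cnt i).length, unary (cnt i).length] 0)⟩
    | cons x l ih =>
      intro n hn
      simp only [List.length_cons] at hn
      have r1 : Runs (.pop k) (fun j => (envAt env i ++ [x :: l, acc i n, unary n]).getD j [])
          (fun j => (envAt env i ++ [l, acc i n, unary n]).getD j []) 1 := by
        refine ⟨1, le_rfl, (Exec.pop _ _).congr_right ?_⟩
        apply ext
        · intro y hy; rw [Function.update_of_ne (by omega)]; rw [get0 _ _ hy, get0 _ _ hy]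
        · intro y
          rcases y with _ | y
          · have h1 := get1 [l, acc i n, unary n] 0
            have h2 := get1 [x :: l, acc i n, unary n] 0
            simp only [add_zero] at h1 h2 ⊢
            rw [Function.update_self, h1, h2]; simp
          · rw [Function.update_of_ne (by omega)]; rw [get1, get1]; simp
      have hmap : (List.range k ++ [k + 2, k + 1]).map
          (fun j => (envAt env i ++ [l, acc i n, unary n]).getD j []) =
          envAt env i ++ [unary n, acc i n] := by
        rw [List.map_append]
        congr 1
        · apply List.ext_getElem
          · simp [hk]
          · intro y h1 h2
            simp only [List.getElem_map, List.getElem_range]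
            rw [get0 _ _ (by omega), List.getD_eq_getElem _ _ h2]
            simp
        · simp only [List.map_cons, List.map_nil]
          rw [get1, get1]; simp
      have r2 := hC (fun j => (envAt env i ++ [l, acc i n, unary n]).getD j []) (acc i (n + 1)) _
        (fun y hy => by
          obtain ⟨z, rfl⟩ := Nat.exists_eq_add_of_le hy
          rw [show k + 3 + z = k + (3 + z) by omega, get1, List.getD_eq_default]
          simp)
        (by rw [hmap]; exact hP i n (by omega))
      have r3 : Runs (.push (k + 2) true) (Function.update
          (fun j => (envAt env i ++ [l, acc i n, unary n]).getD j []) (k + 1) (acc i (n + 1)))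
          (fun j => (envAt env i ++ [l, acc i (n + 1), unary (n + 1)]).getD j []) 1 := by
        refine ⟨1, le_rfl, (Exec.push _ _ _).congr_right ?_⟩
        apply ext
        · intro y hy
          rw [Function.update_of_ne (by omega), Function.update_of_ne (by omega)]
          rw [get0 _ _ hy, get0 _ _ hy]
        · intro y
          rw [get1]
          by_cases h2 : y = 2
          · subst h2
            rw [Function.update_self, Function.update_of_ne (by omega), get1]
            simp [unary, List.replicate_succ]
          · rw [Function.update_of_ne (by omega)]
            by_cases h1 : y = 1
            · subst h1; rw [Function.update_self]; simp
            · rw [Function.update_of_ne (by omega), get1]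
              rcases y with _ | _ | _ | y <;> simp at h1 h2 ⊢
      have r4 := ih (n + 1) (by omega)
      obtain ⟨t1, ht1, e1⟩ := r1.seq (r2.seq r3)
      obtain ⟨t2, ht2, e2⟩ := r4
      refine ⟨t1 + t2 + 1, ?_, .loopStep ?_ e1 e2⟩
      · rw [hmap, get1] at ht1
        have hb1 : (acc i n).length ≤ B := hB n (by omega)
        have hm := p.eval_mono_nat (show total (envAt env i) + n + (acc i n).length ≤
          total (envAt env i) + (cnt i).length + B by omega)
        have hstep : t1 + 2 ≤ T := by
          have : C * (total (envAt env i ++ [unary n, acc i n]) +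
              p.eval (total (envAt env i) + n + (acc i n).length) +
              ([l, acc i n, unary n].getD 1 []).length + 1) ≤
              C * (total (envAt env i) + (cnt i).length + B +
              p.eval (total (envAt env i) + (cnt i).length + B) + B + 1) := by
            apply Nat.mul_le_mul_left
            simp [unary]; omega
          omega
        have : (x :: l).length * T + 1 = l.length * T + 1 + T := by
          rw [List.length_cons]; ring
        omega
      · have := get1 [x :: l, acc i n, unary n] 0
        simp only [add_zero] at this ⊢
        rw [this]; simp
  refine (hstate (cnt i) 0 (by simp)).imp fun t h => ⟨h.1, h.2.congr_left ?_⟩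
  funext j
  have : envAt env i ++ [cnt i, acc i 0, unary 0] = (envAt env i ++ [cnt i, acc i 0]) ++ [[]] := by
    simp [unary]
  rw [this]
  by_cases hj : j < (envAt env i ++ [cnt i, acc i 0]).length
  · simp only [List.getD_eq_getElem?_getD]
    rw [List.getElem?_append_left (l₂ := [[]]) hj]
  · rw [List.getD_eq_default _ _ (by omega)]
    simp only [List.getD_eq_getElem?_getD]
    rw [List.getElem?_append_right (by omega)]
    rcases j - (envAt env i ++ [cnt i, acc i 0]).length with _ | y <;> simp

/-- Primitive recursion: the state `acc i n` is updated as many times as the length of `cnt`. -/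
theorem iterate' (cnt : I → List Bool) (acc : I → ℕ → List Bool) (pb : Polynomial ℕ)
    (hcnt : PolyFun env cnt) (h0 : PolyFun env fun i => acc i 0)
    (hacc : ∀ i, ∀ n ≤ (cnt i).length, (acc i n).length ≤ pb.eval (total (envAt env i)))
    (hstep : PolyFun (I := {x : I × ℕ // x.2 < (cnt x.1).length})
      ((env.map fun f => fun x => f x.1.1) ++ [fun x => unary x.1.2, fun x => acc x.1.1 x.1.2])
      fun x => acc x.1.1 (x.1.2 + 1)) :
    PolyFun env fun i => acc i (cnt i).length := by
  refine subst_append (env' := [cnt, fun i => acc i 0]) (by simp [hcnt, h0]) ?_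
  obtain ⟨P, p, hP⟩ := hstep
  obtain ⟨Q, C, hQ⟩ := runs_iterate env.length env cnt acc P p rfl (fun i n hn => by
    have := hP ⟨(i, n), hn⟩
    simpa [envAt, Function.comp_def, unary, add_assoc] using this)
  -- Calling `skip` copies the final state to stack `0`, where outputs are read.
  obtain ⟨D, hD⟩ := runs_call [env.length + 1] .skip 0 (env.length + 3) (by simp) (by omega)
  refine of_runs (P := .seq Q (.call [env.length + 1] .skip 0 (env.length + 3)))
    ((.X * (.C C * (.X + .X + pb + p.comp (.X + .X + pb) + pb + 1) + 5) + 1) +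
      .C D * (pb + 1 + (.X + pb) + 1))
    (fun i => ⟨Function.update (fun j => (envAt env i ++
      [[], acc i (cnt i).length, unary (cnt i).length]).getD j []) 0 (acc i (cnt i).length),
      ?_, by simp⟩)
  · have h1 := hQ i (pb.eval (total (envAt env i))) (hacc i)
    have hget : (envAt env i ++ [[], acc i (cnt i).length, unary (cnt i).length]).getD
        (env.length + 1) [] = acc i (cnt i).length := by
      simp only [List.getD_eq_getElem?_getD]
      rw [List.getElem?_append_right (by simp)]
      simp
    have h2 := hD (fun j => (envAt env i ++
      [[], acc i (cnt i).length, unary (cnt i).length]).getD j []) (acc i (cnt i).length) 1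
      (fun x hx => by rw [List.getD_eq_default]; simp; omega)
      (by simp only [List.map_cons, List.map_nil, hget]
          exact ⟨_, 1, .skip _, by simp, le_rfl⟩)
    have hle' := hacc i _ le_rfl
    have h3 : envAt env i ++ [cnt i, acc i 0] = envAt (env ++ [cnt, fun i => acc i 0]) i := by
      simp [envAt]
    rw [h3] at h1
    refine (h1.seq h2).mono ?_
    set X := total (envAt (env ++ [cnt, fun i => acc i 0]) i) with hX
    have hX1 : total (envAt env i) ≤ X := by simp [hX, envAt]
    have hX2 : (cnt i).length ≤ X := by
      simp only [hX, envAt, List.map_append, total_append, List.map_cons, List.map_nil, total_cons]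
      omega
    have hpbX := pb.eval_mono_nat hX1
    simp only [Polynomial.eval_mul, Polynomial.eval_add, Polynomial.eval_C, Polynomial.eval_X,
      Polynomial.eval_comp, Polynomial.eval_one, List.map_cons, List.map_nil, hget, total_cons,
      total_nil, Polynomial.eval_ofNat]
    have hpm := p.eval_mono_nat (show total (envAt env i) + (cnt i).length +
      pb.eval (total (envAt env i)) ≤ X + X + pb.eval X by omega)
    have h0len : ((envAt env i ++ [[], acc i (cnt i).length, unary (cnt i).length]).getD 0
        []).length ≤ X + pb.eval X := by
      rcases hE : envAt env i with _ | ⟨e, l⟩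
      · simp
      · have : e.length ≤ total (envAt env i) := length_le_total (by rw [hE]; simp)
        simp
        omega
    gcongr
    all_goals omega

end PolyFun

-- Recursion with a computable bound, and operations on strings and bits.

universe u

namespace PolyFun

variable {I : Type u} {env env' : List (I → List Bool)} {a b c out : I → List Bool}

/-- Primitive recursion with a body that may use everything computable from `env`, the unary
counter and the current state. -/
theorem iterate (cnt : I → List Bool) (acc : I → ℕ → List Bool) {bound : I → List Bool}
    (hcnt : PolyFun env cnt) (h0 : PolyFun env fun i => acc i 0) (hb : PolyFun env bound)
    (hacc : ∀ i, ∀ n ≤ (cnt i).length, (acc i n).length ≤ (bound i).length)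
    (hstep : ∀ (J : Type u) (env' : List (J → List Bool)) (φ : J → I) (k : J → ℕ),
      (∀ j, k j < (cnt (φ j)).length) →
      (∀ g, PolyFun env g → PolyFun env' fun j => g (φ j)) → PolyFun env' (fun j => unary (k j)) →
      PolyFun env' (fun j => acc (φ j) (k j)) → PolyFun env' fun j => acc (φ j) (k j + 1)) :
    PolyFun env fun i => acc i (cnt i).length := by
  obtain ⟨pb, hpb⟩ := hb.length_le
  refine iterate' cnt acc pb hcnt h0 (fun i n hn => (hacc i n hn).trans (hpb i))
    (hstep {x : I × ℕ // x.2 < (cnt x.1).length} _ (fun x => x.1.1) (fun x => x.1.2)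
      (fun x => x.2) ?_ ?_ ?_)
  · exact fun g hg => weaken_append (hg.reindex fun x : {x : I × ℕ // _} => x.1.1)
  · exact var (by simp)
  · exact var (by simp)

theorem comp_val {p : I → Prop} (h : PolyFun env a) :
    PolyFun (restrict env p) fun i => a i.1 := h.reindex Subtype.val

theorem take_one_append (hc : PolyFun env c) (ha : PolyFun env a) :
    PolyFun env fun i => (c i).take 1 ++ a i := by
  refine branch hc (ha.comp_val.congr ?_) ((ha.comp_val.cons false).congr ?_)
    ((ha.comp_val.cons true).congr ?_)
  · rintro ⟨i, h⟩; simp [h]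
  · rintro ⟨i, h⟩; simp only [Function.comp_apply]; rcases hc : c i with _ | ⟨x, l⟩ <;> simp_all
  · rintro ⟨i, h⟩; simp only [Function.comp_apply]; rcases hc : c i with _ | ⟨x, l⟩ <;> simp_all

theorem ite_dep {t : I → Bool} (ht : PolyFun env fun i => [t i])
    (ha : PolyFun (restrict env fun i => t i = true) fun i => out i.1)
    (hb : PolyFun (restrict env fun i => t i = false) fun i => out i.1) : PolyFun env out := by
  refine branch ht ?_ ?_ ?_
  · refine (nil (env := _)).congr ?_
    rintro ⟨i, h⟩; simp at h
  · have h : ∀ i : {i // ([t i].head? = some false)}, t i.1 = false := by rintro ⟨i, h⟩; simpa using h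
    have := hb.reindex fun i : {i // ([t i].head? = some false)} => (⟨i.1, h i⟩ : {i // t i = false})
    rw [List.map_map] at this
    exact this
  · have h : ∀ i : {i // ([t i].head? = some true)}, t i.1 = true := by rintro ⟨i, h⟩; simpa using h
    have := ha.reindex fun i : {i // ([t i].head? = some true)} => (⟨i.1, h i⟩ : {i // t i = true})
    rw [List.map_map] at this
    exact this

theorem ite {t : I → Bool} (ht : PolyFun env fun i => [t i]) (ha : PolyFun env a)
    (hb : PolyFun env b) : PolyFun env fun i => if t i then a i else b i := by
  refine ite_dep ht (ha.comp_val.congr ?_) (hb.comp_val.congr ?_)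
  · rintro ⟨i, h⟩; simp [h]
  · rintro ⟨i, h⟩; simp [h]

theorem head (hc : PolyFun env c) : PolyFun env fun i => [(c i).headD false] := by
  refine branch hc ((nil.cons false).congr ?_) ((nil.cons false).congr ?_)
    ((nil.cons true).congr ?_)
  · rintro ⟨i, h⟩; simp [h]
  · rintro ⟨i, h⟩; simp only [Function.comp_apply]; rcases hc : c i with _ | ⟨x, l⟩ <;> simp_all
  · rintro ⟨i, h⟩; simp only [Function.comp_apply]; rcases hc : c i with _ | ⟨x, l⟩ <;> simp_all

theorem isEmpty (hc : PolyFun env c) : PolyFun env fun i => [(c i).isEmpty] := by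
  refine branch hc ((nil.cons true).congr ?_) ((nil.cons false).congr ?_)
    ((nil.cons false).congr ?_)
  · rintro ⟨i, h⟩; simp [h]
  · rintro ⟨i, h⟩; simp only [Function.comp_apply]; rcases hc : c i with _ | ⟨x, l⟩ <;> simp_all
  · rintro ⟨i, h⟩; simp only [Function.comp_apply]; rcases hc : c i with _ | ⟨x, l⟩ <;> simp_all

theorem not {t : I → Bool} (ht : PolyFun env fun i => [t i]) : PolyFun env fun i => [!t i] :=
  (ite ht (nil.cons false) (nil.cons true)).congr fun i => by cases t i <;> rfl

theorem and {t u : I → Bool} (ht : PolyFun env fun i => [t i]) (hu : PolyFun env fun i => [u i]) :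
    PolyFun env fun i => [t i && u i] :=
  (ite ht hu (nil.cons false)).congr fun i => by cases t i <;> rfl

theorem beq {t u : I → Bool} (ht : PolyFun env fun i => [t i]) (hu : PolyFun env fun i => [u i]) :
    PolyFun env fun i => [t i == u i] :=
  (ite ht hu hu.not).congr fun i => by cases t i <;> cases u i <;> rfl

theorem drop_length (ha : PolyFun env a) (hc : PolyFun env c) :
    PolyFun env fun i => (a i).drop (c i).length := by
  refine iterate c (fun i n => (a i).drop n) hc (by simpa using ha) ha (fun i n _ => by simp) ?_
  intro J env' φ k _ _ _ h
  exact h.tail.congr fun i => by simp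

theorem drop {k : I → ℕ} (ha : PolyFun env a) (hk : PolyFun env fun i => unary (k i)) :
    PolyFun env fun i => (a i).drop (k i) :=
  (drop_length ha hk).congr fun i => by simp [unary]

theorem unary_length (ha : PolyFun env a) : PolyFun env fun i => unary (a i).length := by
  refine iterate a (fun i n => unary n) ha (nil.congr fun i => rfl) ha
    (fun i n h => by simpa [unary] using h) ?_
  intro J env' φ k _ _ _ h
  exact (h.cons true).congr fun i => rfl

/-- The bits of `a` are moved onto `b` one at a time. The recursion needs some computable string
`bd` that is at least as long as the result. For reversing, `a` itself will do. -/
theorem append_aux (ha : PolyFun env a) (hb : PolyFun env b) {bd : I → List Bool}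
    (hbd : PolyFun env bd) (hle : ∀ i, (a i).length + (b i).length ≤ (bd i).length) :
    PolyFun env fun i => (a i).reverse ++ b i := by
  refine (iterate a (fun i n => ((a i).take n).reverse ++ b i) ha (by simpa using hb)
    hbd (fun i n hn => ?_) ?_).congr fun i => by simp
  · have := hle i
    simp; omega
  · intro J env' φ k hlt lift hk h
    refine (take_one_append (drop (lift a ha) hk) h).congr fun j => ?_
    have hn := hlt j
    rw [List.take_add_one, List.getElem?_eq_getElem hn, List.drop_eq_getElem_cons hn,
      List.reverse_append]
    rfl

theorem reverse (ha : PolyFun env a) : PolyFun env fun i => (a i).reverse :=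
  (append_aux ha nil ha (by simp)).congr fun i => by simp

/-- Provides the length bound for concatenation. The polynomial form `iterate'` of recursion avoids
circularity, since no string of the required length is available yet. -/
theorem append_length_aux (ha : PolyFun env a) (hb : PolyFun env b) :
    PolyFun env fun i => unary ((a i).length + (b i).length) := by
  obtain ⟨pa, hpa⟩ := ha.length_le
  obtain ⟨pb, hpb⟩ := hb.length_le
  refine iterate' a (fun i n => unary (n + (b i).length)) (pa + pb) ha
    (hb.unary_length.congr fun i => by simp) (fun i n hn => ?_) ?_
  · have h1 := hpa i
    have h2 := hpb i
    simp [unary]; omega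
  · refine ((var (a := fun x => unary (x.1.2 + (b x.1.1).length)) (by simp)).cons true).congr ?_
    rintro ⟨⟨i, n⟩, hn⟩
    simp [unary, ← List.replicate_succ, add_right_comm]

theorem append (ha : PolyFun env a) (hb : PolyFun env b) : PolyFun env fun i => a i ++ b i :=
  (append_aux ha.reverse hb (append_length_aux ha hb) (by simp [unary])).congr fun i => by simp

/-- Concatenation over a range of unary numbers. -/
theorem flatMap_range {count : I → ℕ} (f : I → ℕ → List Bool)
    (hcnt : PolyFun env fun i => unary (count i))
    (hf : ∀ (J : Type u) (env' : List (J → List Bool)) (φ : J → I) (k : J → ℕ),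
      (∀ j, k j < count (φ j)) →
      (∀ g, PolyFun env g → PolyFun env' fun j => g (φ j)) → PolyFun env' (fun j => unary (k j)) →
      PolyFun env' fun j => f (φ j) (k j)) :
    PolyFun env fun i => (List.range (count i)).flatMap (f i) := by
  obtain ⟨pc, hpc⟩ := hcnt.length_le
  have h := hf {x : I × ℕ // x.2 < count x.1} ((env.map fun g => fun x => g x.1.1) ++
    [fun x => unary x.1.2]) (fun x => x.1.1) (fun x => x.1.2) (fun x => x.2)
    (fun g hg => weaken_append (hg.reindex fun x : {x : I × ℕ // _} => x.1.1)) (var (by simp))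
  obtain ⟨pf, hpf⟩ := h.length_le
  have hlen : ∀ i, (unary (count i)).length = count i := fun i => by simp [unary]
  refine (iterate' (fun i => unary (count i)) (fun i n => (List.range n).flatMap (f i))
    (pc * pf.comp (.X + pc)) hcnt (nil.congr fun i => rfl) (fun i n hn => ?_) ?_).congr
    fun i => by simp [hlen]
  · rw [hlen] at hn
    have hc := hpc i
    rw [hlen] at hc
    set B := pf.eval (total (envAt env i) + pc.eval (total (envAt env i))) with hB
    have key : ∀ k < count i, (f i k).length ≤ B := by
      intro k hk
      refine (hpf ⟨(i, k), hk⟩).trans (pf.eval_mono_nat ?_)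
      have htot : total (envAt (env.map (fun g => fun x : {x : I × ℕ // x.2 < count x.1} =>
          g x.1.1) ++ [fun x => unary x.1.2]) ⟨(i, k), hk⟩) = total (envAt env i) + k := by
        simp [envAt, Function.comp_def, unary]
      omega
    simp only [Polynomial.eval_mul, Polynomial.eval_comp, Polynomial.eval_add, Polynomial.eval_X]
    have : ((List.range n).flatMap (f i)).length ≤ n * B := by
      clear hpf hpc
      induction n with
      | zero => simp
      | succ n ih =>
        rw [List.range_succ, List.flatMap_append, List.length_append]
        have h1 := ih (by omega)
        have h2 := key n (by omega)
        simp only [List.flatMap_cons, List.flatMap_nil, List.append_nil]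
        rw [Nat.succ_mul]; omega
    exact this.trans (Nat.mul_le_mul (hn.trans hc) le_rfl)
  · set env2 : List ({x : I × ℕ // x.2 < (unary (count x.1)).length} → List Bool) :=
      (env.map fun f => fun x => f x.1.1) ++ [fun x => unary x.1.2,
        fun x => (List.range x.1.2).flatMap (f x.1.1)] with henv2
    have h1 : PolyFun env2 fun x => f x.1.1 x.1.2 := by
      have := comp h (fun x : {x : I × ℕ // x.2 < (unary (count x.1)).length} =>
        (⟨x.1, by have := x.2; rwa [hlen] at this⟩ : {x : I × ℕ // x.2 < count x.1}))
        (env := env2) (by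
          intro g hg
          rcases List.mem_append.1 hg with hg | hg
          · obtain ⟨g', hg', rfl⟩ := List.mem_map.1 hg
            exact var (List.mem_append_left _ (List.mem_map.2 ⟨g', hg', rfl⟩))
          · simp only [List.mem_singleton] at hg
            subst hg
            exact var (by simp [henv2, Function.comp_def]))
      exact this
    have h2 : PolyFun env2 fun x => (List.range x.1.2).flatMap (f x.1.1) := var (by simp [henv2])
    refine (append h2 h1).congr ?_
    rintro ⟨⟨i, n⟩, hn⟩
    simp [List.range_succ]

/-! ### Unary arithmetic -/

section

variable {x y z : I → ℕ}

theorem num_zero : PolyFun env fun _ => unary 0 := nil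

theorem num_succ (hx : PolyFun env fun i => unary (x i)) : PolyFun env fun i => unary (x i + 1) :=
  hx.cons true

theorem num_const (k : ℕ) : PolyFun env fun _ => unary k := by
  induction k with
  | zero => exact nil
  | succ k ih => exact ih.cons true

theorem num_add (hx : PolyFun env fun i => unary (x i)) (hy : PolyFun env fun i => unary (y i)) :
    PolyFun env fun i => unary (x i + y i) :=
  (append hx hy).congr fun i => by simp [unary, List.replicate_append_replicate]

theorem num_sub (hx : PolyFun env fun i => unary (x i)) (hy : PolyFun env fun i => unary (y i)) :
    PolyFun env fun i => unary (x i - y i) :=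
  (drop hx hy).congr fun i => by simp [unary]

theorem num_mul (hx : PolyFun env fun i => unary (x i)) (hy : PolyFun env fun i => unary (y i)) :
    PolyFun env fun i => unary (x i * y i) := by
  refine (flatMap_range (fun i _ => unary (y i)) hx fun J env' φ k _ lift _ => lift _ hy).congr fun i => ?_
  refine (List.eq_replicate_iff.2 ⟨?_, fun b hb => ?_⟩).symm
  · simp [unary, List.length_flatMap]
  · simp only [unary, List.mem_flatMap] at hb
    obtain ⟨_, _, hb⟩ := hb
    exact (List.mem_replicate.1 hb).2

theorem num_pow_const (hx : PolyFun env fun i => unary (x i)) (k : ℕ) :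
    PolyFun env fun i => unary (x i ^ k) := by
  induction k with
  | zero => exact (num_const 1).congr fun i => by simp
  | succ k ih => exact (num_mul ih hx).congr fun i => by rw [pow_succ]

theorem num_eval (p : Polynomial ℕ) (hx : PolyFun env fun i => unary (x i)) :
    PolyFun env fun i => unary (p.eval (x i)) := by
  induction p using Polynomial.induction_on' with
  | add p q hp hq => exact (num_add hp hq).congr fun i => by simp
  | monomial k a =>
    exact (num_mul (num_const a) (num_pow_const hx k)).congr fun i => by simp

theorem decide_le (hx : PolyFun env fun i => unary (x i)) (hy : PolyFun env fun i => unary (y i)) :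
    PolyFun env fun i => [decide (x i ≤ y i)] :=
  (num_sub hx hy).isEmpty.congr fun i => by
    congr 1; rw [Bool.eq_iff_iff]; simp [unary, Nat.sub_eq_zero_iff_le]

theorem decide_eq (hx : PolyFun env fun i => unary (x i)) (hy : PolyFun env fun i => unary (y i)) :
    PolyFun env fun i => [decide (x i = y i)] :=
  (and (decide_le hx hy) (decide_le hy hx)).congr fun i => by
    congr 1; rw [Bool.eq_iff_iff]; simp [le_antisymm_iff]

theorem num_ite {t : I → Bool} (ht : PolyFun env fun i => [t i])
    (hx : PolyFun env fun i => unary (x i)) (hy : PolyFun env fun i => unary (y i)) :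
    PolyFun env fun i => unary (if t i then x i else y i) :=
  (ite ht hx hy).congr fun i => by cases t i <;> rfl

/-- Unary powers can be exponentially long, so a computable bound on all intermediate powers has to
be supplied. -/
theorem num_pow {B : I → ℕ} (hx : PolyFun env fun i => unary (x i))
    (hy : PolyFun env fun i => unary (y i)) (hB : PolyFun env fun i => unary (B i))
    (h : ∀ i, ∀ k ≤ y i, x i ^ k ≤ B i) : PolyFun env fun i => unary (x i ^ y i) := by
  refine (iterate (fun i => unary (y i)) (fun i k => unary (x i ^ k)) hy
    ((num_const 1).congr fun i => by simp) hB (fun i n hn => ?_) ?_).congr fun i => by simp [unary]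
  · simp only [unary, List.length_replicate] at hn ⊢; exact h i n hn
  · intro J env' φ k _ lift _ ha
    exact (num_mul ha (lift _ hx)).congr fun i => by rw [pow_succ]

/-- Half of `x` is the number of `k < x` with `2 * k + 2 ≤ x`, and counting is a concatenation over
a range. -/
theorem num_half (hx : PolyFun env fun i => unary (x i)) :
    PolyFun env fun i => unary (x i / 2) := by
  refine (flatMap_range (fun i k => if decide (2 * k + 2 ≤ x i) then [true] else []) hx
    fun J env' φ k _ lift hk => ite (decide_le (num_add (num_mul (num_const 2) hk) (num_const 2))
      (lift _ hx)) (nil.cons true) nil).congr fun i => ?_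
  have : ∀ n, (List.range n).flatMap (fun k => if decide (2 * k + 2 ≤ x i) then [true] else []) =
      unary (min n (x i / 2)) := by
    intro n
    induction n with
    | zero => simp [unary]
    | succ n ih =>
      rw [List.range_succ, List.flatMap_append, ih]
      by_cases h : 2 * n + 2 ≤ x i
      · rw [min_eq_left (by omega), min_eq_left (by omega)]
        simp [h, unary, List.replicate_succ']
      · rw [min_eq_right (by omega), min_eq_right (by omega)]
        simp [h]
  rw [this, min_eq_right (by omega)]

/-- The logarithm is the number of `k < x` for which halving `x` repeatedly `k + 1` times leaves
something positive. -/
theorem num_log (hx : PolyFun env fun i => unary (x i)) :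
    PolyFun env fun i => unary (Nat.log 2 (x i)) := by
  refine (flatMap_range (fun i k => if decide (1 ≤ x i / 2 ^ (k + 1)) then [true] else []) hx
    fun J env' φ k _ lift hk => ite (decide_le (num_const 1) ?_) (nil.cons true) nil).congr fun i => ?_
  · refine (iterate (fun j => unary (k j + 1)) (fun j n => unary (x (φ j) / 2 ^ n))
      (hk.cons true) ((lift _ hx).congr fun i => by simp) (lift _ hx) (fun i n hn => ?_) ?_).congr
        fun i => by simp [unary]
    · simp [unary, Nat.div_le_self]
    · intro J env' φ k _ lift _ ha
      exact (num_half ha).congr fun i => by rw [pow_succ, Nat.div_div_eq_div_mul]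
  · have : ∀ n, (List.range n).flatMap
        (fun k => if decide (1 ≤ x i / 2 ^ (k + 1)) then [true] else []) =
        unary (min n (Nat.log 2 (x i))) := by
      intro n
      induction n with
      | zero => simp [unary]
      | succ n ih =>
        rw [List.range_succ, List.flatMap_append, ih]
        have key : 1 ≤ x i / 2 ^ (n + 1) ↔ n + 1 ≤ Nat.log 2 (x i) := by
          rw [Nat.one_le_div_iff (by positivity)]
          rcases Nat.eq_zero_or_pos (x i) with h | h
          · simp [h]
          · exact (Nat.le_log_iff_pow_le (by norm_num) h.ne').symm
        by_cases h : n + 1 ≤ Nat.log 2 (x i)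
        · rw [min_eq_left (by omega), min_eq_left (by omega)]
          simp only [key, h, decide_true, List.flatMap_cons, List.flatMap_nil, if_true]
          simp [unary, List.replicate_succ']
        · rw [min_eq_right (by omega), min_eq_right (by omega)]
          simp [key, h]
    rw [this, min_eq_right (Nat.log_le_self _ _)]

theorem getD_bit (ha : PolyFun env a) (hx : PolyFun env fun i => unary (x i)) :
    PolyFun env fun i => [(a i).getD (x i) false] :=
  (drop ha hx).head.congr fun i => by
    rw [List.headD_eq_head?_getD, List.head?_drop, List.getD_eq_getElem?_getD]

end

end PolyFun

/-! ## The reduction as a function on bit strings -/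

/-- The number with binary digits `f 0, …, f (k - 1)`, the most significant one first. -/
def bitsVal (f : ℕ → Bool) : ℕ → ℕ
  | 0 => 0
  | k + 1 => 2 * bitsVal f k + (f k).toNat

/-- The product of `k` signs, where `true` stands for `1`. -/
def parity (f : ℕ → Bool) : ℕ → Bool
  | 0 => true
  | k + 1 => parity f k == f k

/-- Remove the first literal of an encoded formula. -/
def dropLit (l : List Bool) : List Bool := (l.tail.dropWhile id).tail

/-- The sign of literal number `p` of an encoded formula. -/
def litSign (l : List Bool) (p : ℕ) : Bool := (dropLit^[p] l).headD false

/-- The variable of literal number `p` of an encoded formula. -/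
def litVar (l : List Bool) (p : ℕ) : ℕ :=
  (dropLit^[p] l).tail.length - ((dropLit^[p] l).tail.dropWhile id).length

/-- The literal `ρ · x_v` as a sign vector: two signs for every variable, which are both `ρ` at
`v` and cancel elsewhere. -/
def oneHot (n v : ℕ) (ρ : Bool) : List Bool :=
  (List.range n).flatMap fun u => if decide (u = v) then [ρ, ρ] else [true, false]

/-- `K` literals as a sign vector, preceded by the constant `1`. -/
def literalVector (n K : ℕ) (v : ℕ → ℕ) (ρ : ℕ → Bool) : List Bool :=
  true :: (List.range K).flatMap fun i => oneHot n (v i) (ρ i)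

/-- The `k`-th tensor power of the sign vector `u`, multiplied by the sign `κ`. -/
def tensorPower (u : List Bool) (κ : Bool) : ℕ → List Bool
  | 0 => [κ]
  | k + 1 => u.flatMap fun b => (tensorPower u κ k).map fun x => x == b

/-- The length of `literalVector`. -/
def width (n K : ℕ) : ℕ := 1 + K * (n * 2)

/-- The dimension of the examples. -/
def featureDim (n K d : ℕ) : ℕ := (2 * d + 1) * width n K ^ (2 * d)

/-- The number of coins for one example. -/
def blockLength (m K d : ℕ) : ℕ := 1 + (2 * d + 1) * (m + K)

/-- The index of the constraint chosen by `m` coins. -/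
def pickIndex (m : ℕ) (χ : ℕ → Bool) : ℕ := bitsVal χ m % m

/-- The features of one constraint of the encoded formula `enc`, chosen and given random signs by
the coins `χ`, for an example with label `b`. -/
def constraintBits (n K m d : ℕ) (enc : List Bool) (b : Bool) (χ : ℕ → Bool) : List Bool :=
  tensorPower (literalVector n K (fun i => litVar enc (pickIndex m χ * K + i)) fun i => χ (m + i))
    (b == parity (fun i => litSign enc (pickIndex m χ * K + i) == χ (m + i)) K) (2 * d)

/-- The features of an example. Its label is the coin `χ 0`. -/
def exampleBits (n K m d : ℕ) (enc : List Bool) (χ : ℕ → Bool) : List Bool :=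
  (List.range (2 * d + 1)).flatMap fun t =>
    constraintBits n K m d enc (χ 0) fun k => χ (1 + t * (m + K) + k)

/-- The bit `b` as a sign. -/
def toSign (b : Bool) : ℤˣ := if b then 1 else -1

@[simp] theorem signBit_toSign (b : Bool) : signBit (toSign b) = b := by
  cases b <;> decide

/-- The example of dimension `featureDim n K d` obtained from the formula `J` with coins `χ`. -/
def mkExample {n K m : ℕ} (d : ℕ) (J : Formula n K m) (χ : ℕ → Bool) :
    Example (featureDim n K d) :=
  (fun p => toSign ((exampleBits n K m d (encodeFormula J) χ).getD p false), toSign (χ 0))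

/-! ### Lengths and encodings of the features. -/

theorem length_tensorPower (u : List Bool) (κ : Bool) (k : ℕ) :
    (tensorPower u κ k).length = u.length ^ k := by
  induction k with
  | zero => rfl
  | succ k ih => simp [tensorPower, List.length_flatMap, ih, pow_succ']

theorem length_flatMap_const {α β : Type*} (l : List α) (f : α → List β) (c : ℕ)
    (h : ∀ a ∈ l, (f a).length = c) : (l.flatMap f).length = l.length * c := by
  induction l with
  | nil => simp
  | cons a l ih =>
    rw [List.flatMap_cons, List.length_append, h a (by simp), ih fun b hb => h b (by simp [hb])]
    simp [Nat.succ_mul, add_comm]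

theorem length_oneHot (n v : ℕ) (ρ : Bool) : (oneHot n v ρ).length = n * 2 := by
  rw [oneHot, length_flatMap_const _ _ 2, List.length_range]
  intro u _; by_cases h : u = v <;> simp [h]

theorem length_literalVector (n K : ℕ) (v : ℕ → ℕ) (ρ : ℕ → Bool) :
    (literalVector n K v ρ).length = width n K := by
  rw [literalVector, List.length_cons, length_flatMap_const _ _ (n * 2), List.length_range, width,
    add_comm]
  intro u _; exact length_oneHot ..

theorem length_constraintBits (n K m d : ℕ) (enc : List Bool) (b : Bool) (χ : ℕ → Bool) :
    (constraintBits n K m d enc b χ).length = width n K ^ (2 * d) := by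
  rw [constraintBits, length_tensorPower, length_literalVector]

theorem length_exampleBits (n K m d : ℕ) (enc : List Bool) (χ : ℕ → Bool) :
    (exampleBits n K m d enc χ).length = featureDim n K d := by
  rw [exampleBits, length_flatMap_const _ _ (width n K ^ (2 * d)), List.length_range, featureDim]
  intro t _; exact length_constraintBits ..

theorem encodeCube_getD {N : ℕ} (l : List Bool) (h : l.length = N) :
    encodeCube (fun p : Fin N => toSign (l.getD p false)) = l := by
  subst h
  simp only [encodeCube, signBit_toSign]
  apply List.ext_getElem
  · simp
  · intro k h1 h2
    simp

theorem encodeCube_mkExample {n K m : ℕ} (d : ℕ) (J : Formula n K m) (χ : ℕ → Bool) :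
    encodeCube (mkExample d J χ).1 = exampleBits n K m d (encodeFormula J) χ :=
  encodeCube_getD _ (length_exampleBits ..)

theorem flatten_ofFn {α : Type*} {A : ℕ} (f : ℕ → List α) :
    (List.ofFn fun j : Fin A => f j).flatten = (List.range A).flatMap f := by
  rw [List.flatMap_def, List.ofFn_eq_map, ← List.map_coe_finRange_eq_range, List.map_map]
  rfl

theorem encodeSample_mkExample {n K m A : ℕ} (d : ℕ) (J : Formula n K m) (χ : ℕ → ℕ → Bool) :
    encodeSample (fun j : Fin A => mkExample d J (χ j)) =
      (List.range A).flatMap fun j => exampleBits n K m d (encodeFormula J) (χ j) ++ [χ j 0] := by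
  rw [encodeSample]
  simp only [encodeCube_mkExample]
  simp only [mkExample, signBit_toSign]
  exact flatten_ofFn fun j => exampleBits n K m d (encodeFormula J) (χ j) ++ [χ j 0]

/-- Writes `dropWhile` as a recursion of fixed length whose step becomes idle at the first `false`;
bounded recursion has no early exit. -/
theorem iterate_dropWhile_step (l : List Bool) :
    (fun l : List Bool => if l.headD false then l.tail else l)^[l.length] l = l.dropWhile id := by
  induction l with
  | nil => rfl
  | cons b l ih =>
    cases b with
    | true => simpa using ih
    | false =>
      have h : ∀ k, (fun l : List Bool => if l.headD false then l.tail else l)^[k] (false :: l) =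
          false :: l := by
        intro k
        induction k with
        | zero => rfl
        | succ k ih => rw [Function.iterate_succ_apply]; simpa using ih
      rw [h]; simp

theorem iterate_dropWhile_step_length (l : List Bool) (k : ℕ) :
    ((fun l : List Bool => if l.headD false then l.tail else l)^[k] l).length ≤ l.length := by
  induction k with
  | zero => simp
  | succ k ih =>
    rw [Function.iterate_succ_apply']
    refine le_trans ?_ ih
    split_ifs <;> simp

theorem length_dropLit_iterate (l : List Bool) (k : ℕ) : (dropLit^[k] l).length ≤ l.length := by
  induction k with
  | zero => simp
  | succ k ih =>
    rw [Function.iterate_succ_apply']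
    refine le_trans ?_ ih
    simp only [dropLit, List.length_tail]
    have := List.length_dropWhile_le (p := id) (dropLit^[k] l).tail
    simp at this
    omega

/-! ### Polynomial-time computability of the examples. -/

namespace PolyFun

variable {I : Type u} {env : List (I → List Bool)} {a b c out enc coins : I → List Bool}
  {x n K m d o : I → ℕ}

theorem dropWhile_id (ha : PolyFun env a) : PolyFun env fun i => (a i).dropWhile id := by
  refine (iterate a (fun i n => (fun l : List Bool => if l.headD false then l.tail else l)^[n] (a i))
    ha ha ha (fun i n _ => iterate_dropWhile_step_length _ _) ?_).congr
    fun i => (iterate_dropWhile_step (a i)).symm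
  intro J env' φ k _ lift _ ha
  exact (ite ha.head ha.tail ha).congr fun i => by rw [Function.iterate_succ_apply']

theorem dropLit_iterate (ha : PolyFun env a) (hx : PolyFun env fun i => unary (x i)) :
    PolyFun env fun i => dropLit^[x i] (a i) := by
  refine (iterate (fun i => unary (x i)) (fun i n => dropLit^[n] (a i))
    hx ha ha (fun i n _ => length_dropLit_iterate _ _) ?_).congr fun i => by simp [unary]
  intro J env' φ k _ lift _ ha
  exact ha.tail.dropWhile_id.tail.congr fun i => by rw [Function.iterate_succ_apply']; rfl

theorem litSign (ha : PolyFun env a) (hx : PolyFun env fun i => unary (x i)) :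
    PolyFun env fun i => [litSign (a i) (x i)] := (dropLit_iterate ha hx).head

theorem litVar (ha : PolyFun env a) (hx : PolyFun env fun i => unary (x i)) :
    PolyFun env fun i => unary (litVar (a i) (x i)) :=
  num_sub (dropLit_iterate ha hx).tail.unary_length (dropLit_iterate ha hx).tail.dropWhile_id.unary_length

theorem coin (hc : PolyFun env coins) (ho : PolyFun env fun i => unary (o i))
    (hx : PolyFun env fun i => unary (x i)) :
    PolyFun env fun i => [(coins i).getD (o i + x i) false] := getD_bit hc (num_add ho hx)

theorem parity {count : I → ℕ} (f : I → ℕ → Bool)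
    (hcnt : PolyFun env fun i => unary (count i))
    (hf : ∀ (J : Type u) (env' : List (J → List Bool)) (φ : J → I) (k : J → ℕ),
      (∀ j, k j < count (φ j)) →
      (∀ g, PolyFun env g → PolyFun env' fun j => g (φ j)) → PolyFun env' (fun j => unary (k j)) →
      PolyFun env' fun j => [f (φ j) (k j)]) :
    PolyFun env fun i => [parity (f i) (count i)] := by
  refine (iterate (fun i => unary (count i)) (fun i n => [_root_.parity (f i) n]) hcnt
    (nil.cons true) (num_const 1) (fun i n _ => by simp [unary]) ?_).congr fun i => by simp [unary]
  intro J env' φ k hk lift hk' h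
  exact beq h (hf J env' φ k (fun j => by simpa [unary] using hk j) lift hk')

theorem num_bit {t : I → Bool} (ht : PolyFun env fun i => [t i]) :
    PolyFun env fun i => unary (t i).toNat :=
  (num_ite ht (num_const 1) (num_const 0)).congr fun i => by cases t i <;> rfl

/-- The number itself would be exponentially long in unary, so it is reduced modulo `m` after every
digit. One subtraction suffices, because twice a residue plus a bit is below `2 * m`. -/
theorem bitsVal_mod (hm : PolyFun env fun i => unary (m i)) (hm0 : ∀ i, 0 < m i)
    (hx : PolyFun env fun i => unary (x i)) (hc : PolyFun env coins)
    (ho : PolyFun env fun i => unary (o i)) :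
    PolyFun env fun i => unary (bitsVal (fun k => (coins i).getD (o i + k) false) (x i) % m i) := by
  refine (iterate (fun i => unary (x i))
    (fun i n => unary (bitsVal (fun k => (coins i).getD (o i + k) false) n % m i)) hx
    (nil.congr fun i => by simp [bitsVal, unary]) hm (fun i n _ => ?_) ?_).congr
      fun i => by simp [unary]
  · simpa [unary] using (Nat.mod_lt _ (hm0 i)).le
  · intro J env' φ k hk lift hk' h
    have hv := num_add (num_mul (num_const 2) h) (num_bit (coin (lift _ hc) (lift _ ho) hk'))
    refine (num_ite (decide_le (lift _ hm) hv) (num_sub hv (lift _ hm)) hv).congr fun j => ?_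
    congr 1
    simp only [bitsVal]
    set v := bitsVal (fun k => (coins (φ j)).getD (o (φ j) + k) false) (k j)
    set b := ((coins (φ j)).getD (o (φ j) + k j) false)
    have hlt := Nat.mod_lt v (hm0 (φ j))
    have hb : b.toNat ≤ 1 := Bool.toNat_le b
    have : (2 * v + b.toNat) % m (φ j) = (2 * (v % m (φ j)) + b.toNat) % m (φ j) := by
      simp [Nat.add_mod, Nat.mul_mod]
    rw [this]
    by_cases hle : m (φ j) ≤ 2 * (v % m (φ j)) + b.toNat
    · simp only [hle, decide_true, if_true]
      rw [Nat.mod_eq_sub_mod hle, Nat.mod_eq_of_lt (by omega)]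
    · simp only [hle, decide_false]
      rw [Nat.mod_eq_of_lt (by omega)]; simp

theorem oneHot {t : I → Bool} (hn : PolyFun env fun i => unary (n i))
    (hx : PolyFun env fun i => unary (x i)) (ht : PolyFun env fun i => [t i]) :
    PolyFun env fun i => oneHot (n i) (x i) (t i) := by
  refine flatMap_range (fun i u => if decide (u = x i) then [t i, t i] else [true, false]) hn ?_
  intro J env' φ k _ lift hk
  exact ite (decide_eq hk (lift _ hx)) (append (lift _ ht) (lift _ ht)) ((nil.cons false).cons true)

theorem map_beq {t : I → Bool} (ha : PolyFun env a) (ht : PolyFun env fun i => [t i]) :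
    PolyFun env fun i => (a i).map fun y => y == t i := by
  refine (flatMap_range (fun i k => [(a i).getD k false == t i]) ha.unary_length ?_).congr
    fun i => ?_
  · intro J env' φ k _ lift hk
    exact beq (getD_bit (lift _ ha) hk) (lift _ ht)
  · rw [← List.map_eq_flatMap]
    apply List.ext_getElem
    · simp
    · intro k h1 h2
      simp at h1 h2
      simp [h2]

theorem flatMap_list (f : I → Bool → List Bool) (ha : PolyFun env a)
    (hf : ∀ (J : Type u) (env' : List (J → List Bool)) (φ : J → I) (t : J → Bool),
      (∀ g, PolyFun env g → PolyFun env' fun j => g (φ j)) → PolyFun env' (fun j => [t j]) →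
      PolyFun env' fun j => f (φ j) (t j)) :
    PolyFun env fun i => (a i).flatMap (f i) := by
  refine (flatMap_range (fun i k => f i ((a i).getD k false)) ha.unary_length ?_).congr
    fun i => ?_
  · intro J env' φ k _ lift hk
    exact hf J env' φ _ lift (getD_bit (lift _ ha) hk)
  · have : a i = (List.range (a i).length).map fun k => (a i).getD k false := by
      apply List.ext_getElem
      · simp
      · intro k h1 h2
        simp [h1]
    conv_lhs => rw [this]
    rw [List.flatMap_map]

theorem tensorPower {t : I → Bool} {B : I → ℕ} (ha : PolyFun env a)
    (ht : PolyFun env fun i => [t i]) (hx : PolyFun env fun i => unary (x i))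
    (hB : PolyFun env fun i => unary (B i)) (h : ∀ i, ∀ k ≤ x i, (a i).length ^ k ≤ B i) :
    PolyFun env fun i => tensorPower (a i) (t i) (x i) := by
  refine (iterate (fun i => unary (x i)) (fun i k => _root_.tensorPower (a i) (t i) k) hx
    ht hB (fun i k hk => ?_) ?_).congr fun i => by simp [unary]
  · rw [length_tensorPower]
    simp only [unary, List.length_replicate] at hk ⊢
    exact h i k hk
  · intro J env' φ k _ lift hk h
    refine (flatMap_list (fun j b => (_root_.tensorPower (a (φ j)) (t (φ j)) (k j)).map
      fun y => y == b) (lift _ ha) ?_).congr fun j => rfl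
    intro J' env'' φ' t' lift' ht'
    exact map_beq (lift' _ h) ht'

/-- The parameters of the reduction are computable. -/
structure Params (env : List (I → List Bool)) (n K m d : I → ℕ) (enc coins : I → List Bool) :
    Prop where
  hn : PolyFun env fun i => unary (n i)
  hK : PolyFun env fun i => unary (K i)
  hm : PolyFun env fun i => unary (m i)
  hd : PolyFun env fun i => unary (d i)
  henc : PolyFun env enc
  hcoins : PolyFun env coins
  pos : ∀ i, 0 < m i
  -- The dimension is not polynomial in `n` and `K`. It is affordable only because the number `m` of
  -- constraints, given in unary, dominates it.
  bound : ∀ i, featureDim (n i) (K i) (d i) ≤ m i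

theorem Params.lift (h : Params env n K m d enc coins) {J : Type u} {env' : List (J → List Bool)}
    {φ : J → I} (lift : ∀ g, PolyFun env g → PolyFun env' fun j => g (φ j)) :
    Params env' (fun j => n (φ j)) (fun j => K (φ j)) (fun j => m (φ j)) (fun j => d (φ j))
      (fun j => enc (φ j)) (fun j => coins (φ j)) :=
  ⟨lift _ h.hn, lift _ h.hK, lift _ h.hm, lift _ h.hd, lift _ h.henc, lift _ h.hcoins,
    fun _ => h.pos _, fun _ => h.bound _⟩

theorem width_pow_le {n K d m : ℕ} (h : featureDim n K d ≤ m) {k : ℕ} (hk : k ≤ 2 * d) :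
    width n K ^ k ≤ m := by
  refine le_trans ?_ h
  calc width n K ^ k ≤ width n K ^ (2 * d) := Nat.pow_le_pow_right (by simp [width]) hk
    _ ≤ (2 * d + 1) * width n K ^ (2 * d) := Nat.le_mul_of_pos_left _ (by omega)

theorem constraintBits {t : I → Bool} (h : Params env n K m d enc coins)
    (ht : PolyFun env fun i => [t i]) (ho : PolyFun env fun i => unary (o i)) :
    PolyFun env fun i => constraintBits (n i) (K i) (m i) (d i) (enc i) (t i)
      fun k => (coins i).getD (o i + k) false := by
  have hidx : PolyFun env fun i => unary (pickIndex (m i) fun k => (coins i).getD (o i + k) false) :=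
    bitsVal_mod h.hm h.pos h.hm h.hcoins ho
  have hpos := num_mul hidx h.hK
  refine tensorPower (B := m) (a := fun i => literalVector (n i) (K i)
      (fun j => _root_.litVar (enc i) (pickIndex (m i) (fun k => (coins i).getD (o i + k) false) * K i + j))
      fun j => (coins i).getD (o i + (m i + j)) false) ?_ ?_
    (num_mul (num_const 2) h.hd) h.hm (fun i k hk => ?_)
  · refine (flatMap_range (fun i j => _root_.oneHot (n i) (_root_.litVar (enc i)
      (pickIndex (m i) (fun k => (coins i).getD (o i + k) false) * K i + j))
      ((coins i).getD (o i + (m i + j)) false)) h.hK ?_).cons true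
    intro J env' φ k _ lift hk
    exact oneHot (lift _ h.hn) (litVar (lift _ h.henc) (num_add (lift _ hpos) hk))
      (coin (lift _ h.hcoins) (lift _ ho) (num_add (lift _ h.hm) hk))
  · refine beq ht (parity (fun i j => _root_.litSign (enc i)
      (pickIndex (m i) (fun k => (coins i).getD (o i + k) false) * K i + j) ==
      (coins i).getD (o i + (m i + j)) false) h.hK ?_)
    intro J env' φ k _ lift hk
    exact beq (litSign (lift _ h.henc) (num_add (lift _ hpos) hk))
      (coin (lift _ h.hcoins) (lift _ ho) (num_add (lift _ h.hm) hk))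
  · rw [length_literalVector]
    exact width_pow_le (h.bound i) hk

theorem exampleBits (h : Params env n K m d enc coins) (ho : PolyFun env fun i => unary (o i)) :
    PolyFun env fun i => exampleBits (n i) (K i) (m i) (d i) (enc i)
      fun k => (coins i).getD (o i + k) false := by
  refine flatMap_range (fun i t => _root_.constraintBits (n i) (K i) (m i) (d i) (enc i)
    ((coins i).getD (o i + 0) false)
    fun k => (coins i).getD (o i + (1 + t * (m i + K i) + k)) false)
    (num_succ (num_mul (num_const 2) h.hd)) ?_
  intro J env' φ k _ lift hk
  have := constraintBits (h.lift lift) (coin (lift _ h.hcoins) (lift _ ho) num_zero)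
    (num_add (lift _ ho) (num_add (num_const 1) (num_mul hk (num_add (lift _ h.hm) (lift _ h.hK)))))
  simpa only [add_assoc] using this

theorem num_featureDim (h : Params env n K m d enc coins) :
    PolyFun env fun i => unary (featureDim (n i) (K i) (d i)) := by
  refine num_mul (num_succ (num_mul (num_const 2) h.hd)) (num_pow (B := m)
    (num_add (num_const 1) (num_mul h.hK (num_mul h.hn (num_const 2)))) (num_mul (num_const 2) h.hd)
    h.hm fun i k hk => width_pow_le (h.bound i) hk)

theorem num_blockLength (h : Params env n K m d enc coins) :
    PolyFun env fun i => unary (blockLength (m i) (K i) (d i)) :=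
  num_add (num_const 1) (num_mul (num_succ (num_mul (num_const 2) h.hd)) (num_add h.hm h.hK))

end PolyFun

/-! ## Running the learner on examples made from a formula -/

/-- The number of coins used by one run of the learner followed by its test. -/
noncomputable def roundLength (L : PolyTimeLearner) (a n K m d : ℕ) : ℕ :=
  (L.sampleSize.eval (featureDim n K d) + featureDim n K d ^ (2 * a + 1)) * blockLength m K d +
    L.coins.eval (featureDim n K d)

section

variable (L : PolyTimeLearner) (a : ℕ) {n K m : ℕ} (d : ℕ) (J : Formula n K m) (χ : ℕ → Bool)

/-- The sample given to the learner. -/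
noncomputable def roundSample :
    Fin (L.sampleSize.eval (featureDim n K d)) → Example (featureDim n K d) :=
  fun j => mkExample d J fun p => χ (j * blockLength m K d + p)

/-- The coins given to the learner. -/
noncomputable def roundCoins : Fin (L.coins.eval (featureDim n K d)) → Bool :=
  fun c => χ ((L.sampleSize.eval (featureDim n K d) + featureDim n K d ^ (2 * a + 1)) *
    blockLength m K d + c)

/-- The classifier returned by the learner. -/
noncomputable def roundHyp : Cube (featureDim n K d) → ℤˣ :=
  L.hyp _ (roundSample L d J χ) (roundCoins (n := n) (K := K) (m := m) L a d χ)

/-- The fresh examples on which the classifier is tested. -/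
noncomputable def roundTest (k : ℕ) : Example (featureDim n K d) :=
  mkExample d J fun p => χ ((L.sampleSize.eval (featureDim n K d) + k) * blockLength m K d + p)

/-- The number of fresh examples that are classified correctly. -/
noncomputable def roundMatches : ℕ :=
  (Finset.univ.filter fun k : Fin (featureDim n K d ^ (2 * a + 1)) =>
    roundHyp L a d J χ (roundTest L d J χ k).1 = (roundTest L d J χ k).2).card

/-- The classifier is noticeably better than random guessing on the fresh examples. -/
def RoundPasses : Prop :=
  featureDim n K d ^ (2 * a + 1) - roundMatches L a d J χ + featureDim n K d ^ (a + 1) ≤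
    roundMatches L a d J χ

end

theorem flatMap_ite_eq_unary {A : ℕ} (p : ℕ → Prop) [DecidablePred p] :
    (List.range A).flatMap (fun k => if decide (p k) then [true] else []) =
      unary (Finset.univ.filter fun k : Fin A => p k).card := by
  rw [Finset.card_filter, Fin.sum_univ_eq_sum_range (fun k => if p k then 1 else 0)]
  induction A with
  | zero => rfl
  | succ A ih =>
    rw [List.range_succ, List.flatMap_append, ih, Finset.sum_range_succ]
    by_cases h : p A <;> simp [h, unary, List.replicate_succ']

theorem signBit_beq (u : ℤˣ) (b : Bool) : (signBit u == b) = decide (u = toSign b) := by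
  rcases Int.units_eq_one_or u with rfl | rfl <;> cases b <;> decide

/-! ### Polynomial-time computability of a round. -/

namespace PolyFun

variable {I : Type u} {env : List (I → List Bool)} {coins : I → List Bool} {n K m d o : I → ℕ}

/-- A description is fixed for every sample and coin string. Time polynomial in `n` is time
polynomial in the input length, since `n` in unary is among the inputs. -/
theorem learner (L : PolyTimeLearner) :
    ∃ desc : (n : ℕ) → (Fin (L.sampleSize.eval n) → Example n) → (Fin (L.coins.eval n) → Bool) →
      List Bool,
    PolyFun (I := Σ n, (Fin (L.sampleSize.eval n) → Example n) × (Fin (L.coins.eval n) → Bool))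
      [fun x => unary x.1, fun x => encodeSample x.2.1, fun x => List.ofFn x.2.2]
      (fun x => desc x.1 x.2.1 x.2.2) ∧
    PolyFun (I := Σ n, ((Fin (L.sampleSize.eval n) → Example n) × (Fin (L.coins.eval n) → Bool)) ×
        Cube n)
      [fun x => unary x.1, fun x => desc x.1 x.2.1.1 x.2.1.2, fun x => encodeCube x.2.2]
      (fun x => [signBit (L.hyp x.1 x.2.1.1 x.2.1.2 x.2.2)]) := by
  obtain ⟨P, E, time, h⟩ := L.polyTime
  choose desc h1 h2 using h
  refine ⟨desc, ⟨P, time, fun x => ?_⟩, ⟨E, time, fun x => ?_⟩⟩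
  · obtain ⟨s, t, e, ho, ht⟩ := h1 x.1 x.2.1 x.2.2
    exact ⟨s, t, e, ho, ht.trans (time.eval_mono_nat (by simp [unary]))⟩
  · obtain ⟨s, t, e, ho, ht⟩ := h2 x.1 x.2.1.1 x.2.1.2 x.2.2
    exact ⟨s, t, e, ho, ht.trans (time.eval_mono_nat (by simp [unary]))⟩

open Classical in
theorem roundPasses (L : PolyTimeLearner) (a : ℕ) (J : ∀ i, Formula (n i) (K i) (m i))
    (h : Params env n K m d (fun i => encodeFormula (J i)) coins)
    (ho : PolyFun env fun i => unary (o i)) :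
    PolyFun env fun i =>
      [decide (RoundPasses L a (d i) (J i) fun p => (coins i).getD (o i + p) false)] := by
  obtain ⟨desc, hL, hE⟩ := learner L
  have hN := num_featureDim h
  have hB := num_blockLength h
  have hA := num_eval L.sampleSize hN
  have hT := num_pow_const hN (2 * a + 1)
  have hc := num_eval L.coins hN
  have hS : PolyFun env fun i => encodeSample (roundSample L (d i) (J i)
      fun p => (coins i).getD (o i + p) false) := by
    refine (flatMap_range (fun i j => _root_.exampleBits (n i) (K i) (m i) (d i)
      (encodeFormula (J i)) (fun p => (coins i).getD
        (o i + j * blockLength (m i) (K i) (d i) + p) false) ++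
        [(coins i).getD (o i + j * blockLength (m i) (K i) (d i) + 0) false]) hA ?_).congr
        fun i => ?_
    · intro J env' φ k _ lift hk
      have ho' := num_add (lift _ ho) (num_mul hk (lift _ hB))
      exact append (exampleBits (h.lift lift) ho') (coin (lift _ h.hcoins) ho' num_zero)
    · simp only [add_assoc]
      exact encodeSample_mkExample (d i) (J i)
        (fun j p => (coins i).getD (o i + (j * blockLength (m i) (K i) (d i) + p)) false)
  have hR : PolyFun env fun i => List.ofFn (roundCoins (n := n i) (K := K i) (m := m i) L a (d i)
      fun p => (coins i).getD (o i + p) false) := by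
    refine (flatMap_range (fun i c => [(coins i).getD (o i + ((L.sampleSize.eval
      (featureDim (n i) (K i) (d i)) + featureDim (n i) (K i) (d i) ^ (2 * a + 1)) *
      blockLength (m i) (K i) (d i) + c)) false]) hc ?_).congr fun i => ?_
    · intro J env' φ k _ lift hk
      exact coin (lift _ h.hcoins) (lift _ ho) (num_add (lift _ (num_mul (num_add hA hT) hB)) hk)
    · rw [← List.map_eq_flatMap, List.ofFn_eq_map, ← List.map_coe_finRange_eq_range, List.map_map]
      rfl
  have hdesc := comp hL (fun i => ⟨featureDim (n i) (K i) (d i), roundSample L (d i) (J i)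
      fun p => (coins i).getD (o i + p) false, roundCoins (m := m i) L a (d i)
      fun p => (coins i).getD (o i + p) false⟩) (env := env) (by
        intro f hf
        simp only [List.mem_cons, List.not_mem_nil, or_false] at hf
        rcases hf with rfl | rfl | rfl
        exacts [hN, hS, hR])
  have hM : PolyFun env fun i => unary (roundMatches L a (d i) (J i)
      fun p => (coins i).getD (o i + p) false) := by
    refine (flatMap_range (fun i k => if decide (roundHyp L a (d i) (J i)
      (fun p => (coins i).getD (o i + p) false) (roundTest L (d i) (J i)
      (fun p => (coins i).getD (o i + p) false) k).1 = (roundTest L (d i) (J i)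
      (fun p => (coins i).getD (o i + p) false) k).2) then [true] else []) hT ?_).congr
      fun i => ((flatMap_ite_eq_unary fun k => roundHyp L a (d i) (J i)
        (fun p => (coins i).getD (o i + p) false) (roundTest L (d i) (J i)
        (fun p => (coins i).getD (o i + p) false) k).1 = (roundTest L (d i) (J i)
        (fun p => (coins i).getD (o i + p) false) k).2).trans (by
          unfold roundMatches; congr)).symm
    intro I' env' φ k _ lift hk
    refine ite ?_ (nil.cons true) nil
    have ho' := num_add (lift _ ho) (num_mul (num_add (lift _ hA) hk) (lift _ hB))
    have hx : PolyFun env' fun j => encodeCube (roundTest L (d (φ j)) (J (φ j))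
        (fun p => (coins (φ j)).getD (o (φ j) + p) false) (k j)).1 := by
      refine (exampleBits (h.lift lift) ho').congr fun j => ?_
      simp only [roundTest, encodeCube_mkExample, add_assoc]
    have h1 := comp hE (fun j => ⟨featureDim (n (φ j)) (K (φ j)) (d (φ j)),
      (roundSample L (d (φ j)) (J (φ j))
      fun p => (coins (φ j)).getD (o (φ j) + p) false, roundCoins (m := m (φ j)) L a (d (φ j))
      fun p => (coins (φ j)).getD (o (φ j) + p) false), (roundTest L (d (φ j)) (J (φ j))
        (fun p => (coins (φ j)).getD (o (φ j) + p) false) (k j)).1⟩) (env := env') (by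
        intro f hf
        simp only [List.mem_cons, List.not_mem_nil, or_false] at hf
        rcases hf with rfl | rfl | rfl
        exacts [lift _ hN, lift _ hdesc, hx])
    have h2 := beq h1 (coin (lift _ h.hcoins) ho' num_zero)
    refine h2.congr fun j => ?_
    rw [signBit_beq]
    simp only [add_assoc]
    rfl
  exact (decide_le (num_add (num_sub hT hM) (num_pow_const hN (a + 1))) hM).congr fun i => by
    unfold RoundPasses; congr

end PolyFun

/-- `r` followed by infinitely many `false`. -/
def extendBits {C : ℕ} (r : Fin C → Bool) (k : ℕ) : Bool := if h : k < C then r ⟨k, h⟩ else false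

theorem getD_ofFn {C : ℕ} (r : Fin C → Bool) (k : ℕ) :
    (List.ofFn r).getD k false = extendBits r k := by
  unfold extendBits
  split_ifs with h
  · rw [List.getD_eq_getElem _ _ (by simpa using h)]; simp
  · rw [List.getD_eq_default _ _ (by simpa using h)]

theorem length_encodeFormula_le {n K m : ℕ} (J : Formula n K m) :
    (encodeFormula J).length ≤ m * (K * (n + 1)) := by
  have h1 : ∀ {k : ℕ} (f : Fin k → List Bool) (B : ℕ), (∀ i, (f i).length ≤ B) →
      (List.ofFn f).flatten.length ≤ k * B := by
    intro k f B h
    rw [List.length_flatten, List.map_ofFn, List.sum_ofFn]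
    refine (Finset.sum_le_card_nsmul _ _ B fun i _ => h i).trans ?_
    simp
  refine h1 _ _ fun j => h1 _ _ fun i => ?_
  simp [unary]

/-- Some of the first `R` rounds passes. -/
def SomeRoundPasses (L : PolyTimeLearner) (a R : ℕ) {n K m : ℕ} (d : ℕ) (J : Formula n K m)
    (χ : ℕ → Bool) : Prop :=
  ∃ ρ < R, RoundPasses L a d J fun p => χ (ρ * roundLength L a n K m d + p)

namespace PolyFun

variable {I : Type u} {env : List (I → List Bool)}

open Classical in
theorem decide_exists_lt (p : I → ℕ → Prop) (h : ∀ k, PolyFun env fun i => [decide (p i k)])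
    (R : ℕ) : PolyFun env fun i => [decide (∃ k < R, p i k)] := by
  induction R with
  | zero => exact (nil.cons false).congr fun i => by simp
  | succ R ih =>
    refine (ite ih (nil.cons true) (h R)).congr fun i => ?_
    have : (∃ k < R + 1, p i k) ↔ (∃ k < R, p i k) ∨ p i R := by
      constructor
      · rintro ⟨k, hk, hp⟩
        rcases Nat.lt_succ_iff_lt_or_eq.1 hk with h | rfl
        · exact Or.inl ⟨k, h, hp⟩
        · exact Or.inr hp
      · rintro (⟨k, hk, hp⟩ | hp)
        · exact ⟨k, by omega, hp⟩
        · exact ⟨R, by omega, hp⟩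
    simp only [this]
    by_cases h1 : ∃ k < R, p i k <;> simp [h1]

end PolyFun

open Classical in
theorem PolyFun.someRoundPasses {I : Type u} {env : List (I → List Bool)} {coins : I → List Bool}
    {n K m d : I → ℕ} (L : PolyTimeLearner) (a R : ℕ) (J : ∀ i, Formula (n i) (K i) (m i))
    (h : Params env n K m d (fun i => encodeFormula (J i)) coins) :
    PolyFun env fun i =>
      [decide (SomeRoundPasses L a R (d i) (J i) fun p => (coins i).getD p false)] := by
  have hN := num_featureDim h
  have hU : PolyFun env fun i => unary (roundLength L a (n i) (K i) (m i) (d i)) :=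
    num_add (num_mul (num_add (num_eval L.sampleSize hN)
      (num_pow_const hN (2 * a + 1))) (num_blockLength h)) (num_eval L.coins hN)
  refine (decide_exists_lt (fun i ρ => RoundPasses L a (d i) (J i) fun p =>
    (coins i).getD (ρ * roundLength L a (n i) (K i) (m i) (d i) + p) false)
    (fun ρ => roundPasses L a J h (num_mul (num_const ρ) hU)) R).congr fun i => ?_
  unfold SomeRoundPasses; congr

/-- A polynomial bound on the number of coins needed by `R` rounds. -/
noncomputable def coinsPoly (L : PolyTimeLearner) (a R : ℕ) : Polynomial ℕ :=
  .C R * ((L.sampleSize + .X ^ (2 * a + 1)) * (1 + .X * (.X + .X)) + L.coins)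

/-- Both the dimension and `2 * d + 1` are at most `m`, so every factor of the coin count is bounded
in terms of `n + K + m`. -/
theorem roundLength_le {L : PolyTimeLearner} {a n K m d R : ℕ} (h : featureDim n K d ≤ m) :
    R * roundLength L a n K m d ≤ (coinsPoly L a R).eval (n + K + m) := by
  have hN : featureDim n K d ≤ n + K + m := by omega
  have hd : 2 * d + 1 ≤ n + K + m := by
    refine le_trans ?_ hN
    exact Nat.le_mul_of_pos_right _ (Nat.pow_pos (by simp [width]))
  have h1 := L.sampleSize.eval_mono_nat hN
  have h2 := L.coins.eval_mono_nat hN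
  simp only [coinsPoly, roundLength, blockLength, Polynomial.eval_mul, Polynomial.eval_add,
    Polynomial.eval_C, Polynomial.eval_pow, Polynomial.eval_X, Polynomial.eval_one]
  gcongr <;> omega

-- The probabilistic conditions are isolated here from all questions of running time. Only `d` has
-- to be computed from `n`; the machine receives `K n` and `m n` as inputs, so nothing is assumed
-- about their computability.
open Classical in
theorem xorEasy_of_rounds {K m d : ℕ → ℕ} {η : ℝ} (L : PolyTimeLearner) (a R n₀ : ℕ)
    (hd : PolyFun (I := ℕ) [unary] fun n => unary (d n))
    (hm : ∀ n, n₀ ≤ n → 0 < m n ∧ featureDim n (K n) (d n) ≤ m n)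
    (hsat : ∀ n, n₀ ≤ n → ∀ J : Formula n (K n) (m n), 1 - η ≤ value J →
      3 / 4 ≤ uniformProb fun r : Fin ((coinsPoly L a R).eval (n + K n + m n)) → Bool =>
        SomeRoundPasses L a R (d n) J (extendBits r))
    (hrand : Tendsto (fun n => uniformProb fun J : Formula n (K n) (m n) =>
      3 / 4 ≤ uniformProb fun r : Fin ((coinsPoly L a R).eval (n + K n + m n)) → Bool =>
        ¬ SomeRoundPasses L a R (d n) J (extendBits r)) atTop (𝓝 1)) :
    XorEasy K m η := by
  set C := fun n => (coinsPoly L a R).eval (n + K n + m n) with hC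
  let I := Σ n, Formula n (K n) (m n) × (Fin (C n) → Bool)
  let env : List (I → List Bool) := [fun x => unary x.1, fun x => unary (K x.1),
    fun x => unary (m x.1), fun x => encodeFormula x.2.1, fun x => List.ofFn x.2.2]
  -- For small `n` the size conditions may fail. The answer there is "non-random", because formulas
  -- of high value must be recognised for every `n`, whereas random formulas matter only in the
  -- limit.
  let answer : I → Bool := fun x =>
    if n₀ ≤ x.1 then decide (SomeRoundPasses L a R (d x.1) x.2.1 (extendBits x.2.2)) else true
  have h0 : ∀ f ∈ env, PolyFun env f := fun f hf => PolyFun.var hf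
  have hn : PolyFun env fun x => unary x.1 := h0 _ (by simp [env])
  have hK : PolyFun env fun x => unary (K x.1) := h0 _ (by simp [env])
  have hm' : PolyFun env fun x => unary (m x.1) := h0 _ (by simp [env])
  have henc : PolyFun env fun x => encodeFormula x.2.1 := h0 _ (by simp [env])
  have hcoins : PolyFun env fun x => List.ofFn x.2.2 := h0 _ (by simp [env])
  have hd' : PolyFun env fun x => unary (d x.1) :=
    PolyFun.comp hd (fun x : I => x.1) (by simpa [Function.comp_def] using hn)
  have hans : PolyFun env fun x => [answer x] := by
    refine PolyFun.ite_dep (PolyFun.decide_le (PolyFun.num_const n₀) hn) ?_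
      ((PolyFun.nil.cons true).congr ?_)
    · have hp : PolyFun.Params (PolyFun.restrict env fun x => decide (n₀ ≤ x.1) = true)
          (fun x => x.1.1) (fun x => K x.1.1) (fun x => m x.1.1) (fun x => d x.1.1)
          (fun x => encodeFormula x.1.2.1) (fun x => List.ofFn x.1.2.2) :=
        ⟨hn.comp_val, hK.comp_val, hm'.comp_val, hd'.comp_val, henc.comp_val, hcoins.comp_val,
          fun x => (hm _ (by simpa using x.2)).1, fun x => (hm _ (by simpa using x.2)).2⟩
      refine (PolyFun.someRoundPasses L a R (fun x => x.1.2.1) hp).congr fun x => ?_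
      have hx : n₀ ≤ x.1.1 := by simpa using x.2
      simp only [answer, hx, if_true, getD_ofFn]
    · rintro ⟨x, hx⟩
      have hx : ¬ n₀ ≤ x.1 := by simpa using hx
      simp [answer, hx]
  obtain ⟨A, p, hA⟩ := hans
  refine ⟨A, coinsPoly L a R, p.comp (.X + .X * (.X * (.X + 1)) + coinsPoly L a R),
    fun n J r => answer ⟨n, J, r⟩, fun n J r => ?_, fun n J hJ => ?_, ?_⟩
  · obtain ⟨s, t, e, ho, ht⟩ := hA ⟨n, J, r⟩
    refine ⟨s, t, e, ho, ht.trans ?_⟩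
    rw [Polynomial.eval_comp]
    refine p.eval_mono_nat ?_
    have h1 := length_encodeFormula_le J
    have h2 : m n * (K n * (n + 1)) ≤ (n + K n + m n) * ((n + K n + m n) * (n + K n + m n + 1)) := by
      gcongr <;> omega
    simp only [envAt, env, List.map_cons, List.map_nil, total_cons, total_nil, List.length_ofFn,
      unary, List.length_replicate, Polynomial.eval_add, Polynomial.eval_mul, Polynomial.eval_X,
      Polynomial.eval_one, hC]
    omega
  · by_cases h : n₀ ≤ n
    · refine (hsat n h J hJ).trans (le_of_eq ?_)
      congr 1
      funext r
      simp [answer, h]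
    · simp only [answer, h, if_false, uniformProb]
      simp
      norm_num
  · refine hrand.congr' ?_
    filter_upwards [eventually_ge_atTop n₀] with n h
    congr 1
    funext J
    congr 2
    funext r
    simp [answer, h]

/-! ## Averages over finite types -/

/-- The average of a function on a finite type. -/
noncomputable def avg {α : Type*} [Fintype α] (f : α → ℝ) : ℝ := (∑ a, f a) / Fintype.card α

section

variable {α β : Type*} [Fintype α] [Fintype β]

open Classical in
theorem uniformProb_eq_avg (E : α → Prop) :
    uniformProb E = avg fun a => if E a then (1 : ℝ) else 0 := by
  simp [uniformProb, avg]

theorem avg_equiv (e : α ≃ β) (f : β → ℝ) : avg (fun a => f (e a)) = avg f := by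
  rw [avg, avg, e.sum_comp f, Fintype.card_congr e]

theorem uniformProb_equiv (e : α ≃ β) (E : β → Prop) :
    uniformProb (fun a => E (e a)) = uniformProb E := by
  classical
  rw [uniformProb_eq_avg, uniformProb_eq_avg]
  exact avg_equiv e fun b => if E b then (1 : ℝ) else 0

theorem avg_prod (f : α × β → ℝ) : avg f = avg fun a => avg fun b => f (a, b) := by
  simp only [avg, Fintype.sum_prod_type, Fintype.card_prod, Nat.cast_mul, ← Finset.sum_div]
  rw [div_div, mul_comm]

theorem avg_comm (f : α → β → ℝ) : avg (fun a => avg (f a)) = avg fun b => avg fun a => f a b := by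
  simp only [avg, ← Finset.sum_div]
  rw [Finset.sum_comm, div_right_comm]

theorem avg_mono {f g : α → ℝ} (h : ∀ a, f a ≤ g a) : avg f ≤ avg g := by
  unfold avg
  gcongr
  exact h _

theorem avg_nonneg {f : α → ℝ} (h : ∀ a, 0 ≤ f a) : 0 ≤ avg f :=
  div_nonneg (Finset.sum_nonneg fun a _ => h a) (by positivity)

theorem avg_const [Nonempty α] (c : ℝ) : avg (fun _ : α => c) = c := by
  simp [avg]

theorem avg_add (f g : α → ℝ) : avg (fun a => f a + g a) = avg f + avg g := by
  simp only [avg, Finset.sum_add_distrib, add_div]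

theorem avg_sub (f g : α → ℝ) : avg (fun a => f a - g a) = avg f - avg g := by
  simp only [avg, Finset.sum_sub_distrib, sub_div]

theorem avg_const_mul (c : ℝ) (f : α → ℝ) : avg (fun a => c * f a) = c * avg f := by
  simp only [avg, ← Finset.mul_sum, mul_div_assoc]

theorem avg_sum {ι : Type*} (s : Finset ι) (f : ι → α → ℝ) :
    avg (fun a => ∑ i ∈ s, f i a) = ∑ i ∈ s, avg (f i) := by
  simp only [avg, ← Finset.sum_div]
  rw [Finset.sum_comm]

theorem avg_le_const [Nonempty α] {f : α → ℝ} {c : ℝ} (h : ∀ a, f a ≤ c) : avg f ≤ c :=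
  (avg_mono h).trans (avg_const c).le

theorem uniformProb_nonneg (E : α → Prop) : 0 ≤ uniformProb E := by
  unfold uniformProb; positivity

theorem uniformProb_mono {E F : α → Prop} (h : ∀ a, E a → F a) : uniformProb E ≤ uniformProb F := by
  classical
  rw [uniformProb_eq_avg, uniformProb_eq_avg]
  refine avg_mono fun a => ?_
  by_cases hE : E a
  · simp [hE, h a hE]
  · simp only [hE, if_false]; split_ifs <;> norm_num

theorem uniformProb_le_one (E : α → Prop) : uniformProb E ≤ 1 := by
  unfold uniformProb
  refine div_le_one_of_le₀ ?_ (by positivity)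
  exact_mod_cast Finset.card_le_univ _

theorem uniformProb_not [Nonempty α] (E : α → Prop) :
    uniformProb (fun a => ¬ E a) = 1 - uniformProb E := by
  classical
  rw [uniformProb_eq_avg, uniformProb_eq_avg, eq_sub_iff_add_eq, ← avg_add]
  conv_rhs => rw [← avg_const (α := α) 1]
  congr 1; funext a; by_cases h : E a <;> simp [h]

theorem uniformProb_or_le (E F : α → Prop) :
    uniformProb (fun a => E a ∨ F a) ≤ uniformProb E + uniformProb F := by
  classical
  rw [uniformProb_eq_avg, uniformProb_eq_avg, uniformProb_eq_avg, ← avg_add]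
  refine avg_mono fun a => ?_
  by_cases h : E a <;> by_cases h' : F a <;> simp [h, h']

theorem uniformProb_exists_le {ι : Type*} [Fintype ι] (E : ι → α → Prop) :
    uniformProb (fun a => ∃ i, E i a) ≤ ∑ i, uniformProb (E i) := by
  classical
  simp only [uniformProb_eq_avg, ← avg_sum]
  refine avg_mono fun a => ?_
  have hnn : ∀ i ∈ Finset.univ, (0 : ℝ) ≤ if E i a then (1 : ℝ) else 0 := fun i _ => by
    split_ifs <;> norm_num
  split_ifs with h
  · obtain ⟨i, hi⟩ := h
    have := Finset.single_le_sum hnn (Finset.mem_univ i)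
    simpa [hi] using this
  · exact Finset.sum_nonneg hnn

theorem uniformProb_prod (E : α × β → Prop) :
    uniformProb E = avg fun a => uniformProb fun b => E (a, b) := by
  classical
  simp only [uniformProb_eq_avg]
  rw [avg_prod]

/-- Markov's inequality. -/
theorem uniformProb_le_avg_div {f : α → ℝ} (hf : ∀ a, 0 ≤ f a) {t : ℝ} (ht : 0 < t) :
    uniformProb (fun a => t ≤ f a) ≤ avg f / t := by
  classical
  rw [le_div_iff₀ ht, uniformProb_eq_avg, mul_comm, ← avg_const_mul]
  refine avg_mono fun a => ?_
  split_ifs with h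
  · simpa using h
  · simpa using hf a

theorem avg_fst [Nonempty β] (f : α → ℝ) : avg (fun p : α × β => f p.1) = avg f := by
  rw [avg_prod]; simp only [avg_const]

theorem avg_snd [Nonempty α] (f : β → ℝ) : avg (fun p : α × β => f p.2) = avg f := by
  rw [avg_prod]; simp only [avg_const]

theorem uniformProb_fst [Nonempty β] (E : α → Prop) :
    uniformProb (fun p : α × β => E p.1) = uniformProb E := by
  classical
  simp only [uniformProb_eq_avg]
  exact avg_fst fun a => if E a then (1 : ℝ) else 0

theorem uniformProb_snd [Nonempty α] (E : β → Prop) :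
    uniformProb (fun p : α × β => E p.2) = uniformProb E := by
  classical
  simp only [uniformProb_eq_avg]
  exact avg_snd fun b => if E b then (1 : ℝ) else 0

theorem avg_uniformProb_comm (E : α → β → Prop) :
    avg (fun a => uniformProb (E a)) = avg fun b => uniformProb fun a => E a b := by
  classical
  simp only [uniformProb_eq_avg]
  exact avg_comm _

/-- Independence of the coordinates is the expansion of a product of sums. All later uses of
independence go through this identity. -/
theorem avg_pi_prod {ι : Type*} [Fintype ι] [DecidableEq ι] (f : ι → α → ℝ) :
    avg (fun ω : ι → α => ∏ i, f i (ω i)) = ∏ i, avg (f i) := by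
  simp only [avg, Finset.prod_div_distrib, Finset.prod_univ_sum, Fintype.piFinset_univ]
  simp

theorem avg_pi_eval [Nonempty α] {ι : Type*} [Fintype ι] [DecidableEq ι] (f : α → ℝ) (i : ι) :
    avg (fun ω : ι → α => f (ω i)) = avg f := by
  have := avg_pi_prod (fun j a => if j = i then f a else 1 : ι → α → ℝ)
  simp only [Finset.prod_ite_eq', Finset.mem_univ, if_true] at this
  rw [this, Finset.prod_eq_single i]
  · simp
  · intro j _ hj; simp [hj, avg_const]
  · simp

theorem uniformProb_pi_eval [Nonempty α] {ι : Type*} [Fintype ι] [DecidableEq ι] (E : α → Prop)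
    (i : ι) : uniformProb (fun ω : ι → α => E (ω i)) = uniformProb E := by
  classical
  simp only [uniformProb_eq_avg]
  exact avg_pi_eval (fun a => if E a then (1 : ℝ) else 0) i

theorem avg_pi_eval_mul [Nonempty α] {ι : Type*} [Fintype ι] [DecidableEq ι] (f g : α → ℝ)
    {i j : ι} (hij : i ≠ j) :
    avg (fun ω : ι → α => f (ω i) * g (ω j)) = avg f * avg g := by
  have := avg_pi_prod (fun k a => (if k = i then f a else 1) * (if k = j then g a else 1) :
    ι → α → ℝ)
  simp only [Finset.prod_mul_distrib, Finset.prod_ite_eq', Finset.mem_univ, if_true] at this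
  rw [this, ← Finset.mul_prod_erase _ _ (Finset.mem_univ i),
    ← Finset.mul_prod_erase _ _ (Finset.mem_erase.2 ⟨hij.symm, Finset.mem_univ j⟩),
    Finset.prod_eq_one, mul_one]
  · simp [hij, hij.symm]
  · intro k hk
    simp only [Finset.mem_erase, Finset.mem_univ, and_true] at hk
    simp [hk.1, hk.2, avg_const]

/-- The variance of a sum of independent variables. -/
theorem avg_sum_sq_le [Nonempty α] {ι : Type*} [Fintype ι] [DecidableEq ι] (f : ι → α → ℝ)
    (h0 : ∀ i, avg (f i) = 0) (h1 : ∀ i, avg (fun a => f i a ^ 2) ≤ 1) :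
    avg (fun ω : ι → α => (∑ i, f i (ω i)) ^ 2) ≤ Fintype.card ι := by
  simp only [sq, Finset.sum_mul_sum, avg_sum]
  have : ∀ i j, avg (fun ω : ι → α => f i (ω i) * f j (ω j)) ≤ if i = j then 1 else 0 := by
    intro i j
    split_ifs with h
    · subst h
      rw [avg_pi_eval (fun a => f i a * f i a) i]
      simpa only [sq] using h1 i
    · rw [avg_pi_eval_mul _ _ h, h0, zero_mul]
  calc _ ≤ ∑ i : ι, ∑ j : ι, (if i = j then (1 : ℝ) else 0) :=
        Finset.sum_le_sum fun i _ => Finset.sum_le_sum fun j _ => this i j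
    _ = _ := by simp

theorem uniformProb_pi_forall {ι : Type*} [Fintype ι] [DecidableEq ι] (E : α → Prop) :
    uniformProb (fun ω : ι → α => ∀ i, E (ω i)) = uniformProb E ^ Fintype.card ι := by
  classical
  rw [uniformProb_eq_avg, uniformProb_eq_avg]
  have := avg_pi_prod (fun (_ : ι) a => if E a then (1 : ℝ) else 0)
  rw [Finset.prod_const, Finset.card_univ] at this
  rw [← this]
  congr 1; funext ω
  by_cases h : ∀ i, E (ω i)
  · simp [h]
  · rw [if_neg h]
    push Not at h
    obtain ⟨i, hi⟩ := h
    exact (Finset.prod_eq_zero (Finset.mem_univ i) (by simp [hi])).symm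

/-- Chebyshev's inequality for independent variables with values in `[-1, 1]`. -/
theorem uniformProb_sum_le [Nonempty α] {ι : Type*} [Fintype ι] [DecidableEq ι]
    (f : ι → α → ℝ) (hf : ∀ i a, |f i a| ≤ 1) {τ : ℝ} (hτ : 0 < τ) :
    uniformProb (fun ω : ι → α => τ ≤ |∑ i, f i (ω i) - ∑ i, avg (f i)|) ≤
      Fintype.card ι / τ ^ 2 := by
  have h0 : ∀ i, avg (fun a => f i a - avg (f i)) = 0 := fun i => by
    rw [avg_sub, avg_const, sub_self]
  have h1 : ∀ i, avg (fun a => (f i a - avg (f i)) ^ 2) ≤ 1 := fun i => by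
    have e : ∀ a, (f i a - avg (f i)) ^ 2 = f i a ^ 2 - 2 * avg (f i) * f i a + avg (f i) ^ 2 :=
      fun a => by ring
    simp only [e]
    rw [avg_add, avg_sub, avg_const_mul, avg_const]
    have : avg (fun a => f i a ^ 2) ≤ 1 := avg_le_const fun a => by
      rw [sq_le_one_iff_abs_le_one]; exact hf i a
    nlinarith [sq_nonneg (avg (f i))]
  have h2 := avg_sum_sq_le (fun i a => f i a - avg (f i)) h0 h1
  have h3 := uniformProb_le_avg_div (α := ι → α)
    (f := fun ω => (∑ i, (f i (ω i) - avg (f i))) ^ 2) (fun ω => sq_nonneg _)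
    (t := τ ^ 2) (by positivity)
  refine le_trans (uniformProb_mono fun ω h => ?_) (h3.trans (by gcongr))
  rw [Finset.sum_sub_distrib, ← sq_abs (_ - _)]
  exact pow_le_pow_left₀ hτ.le h 2

end

/-- Reading a uniformly random string at different positions yields a uniformly random string. -/
theorem avg_comp_injective {X Y : Type*} [Fintype X] [Fintype Y] [DecidableEq X] [DecidableEq Y]
    {φ : X → Y} (hφ : Function.Injective φ) (F : (X → Bool) → ℝ) :
    avg (fun r : Y → Bool => F (r ∘ φ)) = avg F := by
  classical
  -- The bits at positions that are not read form an independent factor and average out.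
  let e1 : (Y → Bool) ≃ ({y // y ∈ Set.range φ} → Bool) × ({y // y ∉ Set.range φ} → Bool) :=
    Equiv.piEquivPiSubtypeProd _ _
  let e2 : X ≃ {y // y ∈ Set.range φ} := Equiv.ofInjective φ hφ
  have h1 := avg_equiv e1 fun p => F (p.1 ∘ e2)
  have h2 := avg_equiv (e2.arrowCongr (Equiv.refl Bool)).symm F
  have h3 := avg_fst (β := {y // y ∉ Set.range φ} → Bool) fun g : {y // y ∈ Set.range φ} → Bool => F (g ∘ e2)
  refine Eq.trans ?_ (h1.trans (h3.trans ?_))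
  · rfl
  · exact h2

theorem uniformProb_comp_injective {X Y : Type*} [Fintype X] [Fintype Y] [DecidableEq X]
    [DecidableEq Y] {φ : X → Y} (hφ : Function.Injective φ) (E : (X → Bool) → Prop) :
    uniformProb (fun r : Y → Bool => E (r ∘ φ)) = uniformProb E := by
  classical
  simp only [uniformProb_eq_avg]
  exact avg_comp_injective hφ fun r => if E r then (1 : ℝ) else 0

/-! ## The features as tensors -/

/-- The bit `b` as a real number `±1`. -/
def bsign (b : Bool) : ℝ := if b then 1 else -1

theorem bsign_beq (a b : Bool) : bsign (a == b) = bsign a * bsign b := by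
  cases a <;> cases b <;> simp [bsign]

theorem bsign_mul_self (a : Bool) : bsign a * bsign a = 1 := by
  cases a <;> simp [bsign]

theorem cast_toSign (b : Bool) : (((toSign b : ℤˣ) : ℤ) : ℝ) = bsign b := by
  cases b <;> simp [bsign, toSign]

theorem bsign_parity (f : ℕ → Bool) (K : ℕ) :
    bsign (parity f K) = ∏ i ∈ Finset.range K, bsign (f i) := by
  induction K with
  | zero => simp [parity, bsign]
  | succ K ih => rw [parity, bsign_beq, ih, Finset.prod_range_succ]

/-- The scalar product of a weight vector and a sign vector. -/
def dot (w : List ℝ) (x : List Bool) : ℝ := (List.zipWith (fun a b => a * bsign b) w x).sum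

/-- The `ℓ¹` norm of a weight vector. -/
def l1 (w : List ℝ) : ℝ := (w.map abs).sum

@[simp] theorem dot_nil : dot [] [] = 0 := by simp [dot]

@[simp] theorem dot_cons (a : ℝ) (w : List ℝ) (b : Bool) (x : List Bool) :
    dot (a :: w) (b :: x) = a * bsign b + dot w x := by simp [dot]

theorem dot_append {w w' : List ℝ} {x x' : List Bool} (h : w.length = x.length) :
    dot (w ++ w') (x ++ x') = dot w x + dot w' x' := by
  rw [dot, List.zipWith_append h, List.sum_append]; rfl

@[simp] theorem l1_nil : l1 [] = 0 := rfl
@[simp] theorem l1_cons (a : ℝ) (w : List ℝ) : l1 (a :: w) = |a| + l1 w := by simp [l1]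
theorem l1_append (w w' : List ℝ) : l1 (w ++ w') = l1 w + l1 w' := by simp [l1]

theorem dot_map (c : ℝ) (b : Bool) (w : List ℝ) : ∀ x : List Bool,
    dot (w.map fun a => c * a) (x.map fun y => y == b) = c * bsign b * dot w x := by
  induction w with
  | nil => intro x; simp [dot]
  | cons a w ih =>
    intro x
    cases x with
    | nil => simp [dot]
    | cons y x => simp only [List.map_cons, dot_cons, ih, bsign_beq]; ring

theorem l1_map (c : ℝ) (w : List ℝ) : l1 (w.map fun a => c * a) = |c| * l1 w := by
  induction w with
  | nil => simp
  | cons a w ih => simp only [List.map_cons, l1_cons, ih, abs_mul]; ring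

theorem dot_flatMap_range (q : ℕ) (f : ℕ → List ℝ) (g : ℕ → List Bool)
    (h : ∀ t < q, (f t).length = (g t).length) :
    dot ((List.range q).flatMap f) ((List.range q).flatMap g) =
      ∑ t ∈ Finset.range q, dot (f t) (g t) := by
  induction q with
  | zero => simp
  | succ q ih =>
    rw [List.range_succ, List.flatMap_append, List.flatMap_append, dot_append,
      ih fun t ht => h t (by omega), Finset.sum_range_succ]
    · simp
    · rw [List.length_flatMap, List.length_flatMap]
      congr 1
      apply List.map_congr_left
      intro t ht
      have := List.mem_range.1 ht
      exact h t (by omega)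

theorem l1_flatMap_range (q : ℕ) (f : ℕ → List ℝ) :
    l1 ((List.range q).flatMap f) = ∑ t ∈ Finset.range q, l1 (f t) := by
  induction q with
  | zero => simp
  | succ q ih =>
    rw [List.range_succ, List.flatMap_append, l1_append, ih, Finset.sum_range_succ]
    simp

theorem dot_eq_sum (w : List ℝ) : ∀ x : List Bool, w.length = x.length →
    dot w x = ∑ p ∈ Finset.range x.length, w.getD p 0 * bsign (x.getD p false) := by
  induction w with
  | nil => intro x h; rw [List.eq_nil_of_length_eq_zero h.symm]; simp
  | cons a w ih =>
    intro x h
    cases x with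
    | nil => simp at h
    | cons b x =>
      rw [dot_cons, ih x (by simpa using h), List.length_cons, Finset.sum_range_succ']
      simp [add_comm]

theorem l1_eq_sum (w : List ℝ) : l1 w = ∑ p ∈ Finset.range w.length, |w.getD p 0| := by
  induction w with
  | nil => simp
  | cons a w ih =>
    rw [l1_cons, ih, List.length_cons, Finset.sum_range_succ']
    simp [add_comm]

/-! ### Products of linear forms as linear forms in tensor powers. -/

/-- The tensor product of weight vectors. -/
def tensorWeights : List (List ℝ) → List ℝ
  | [] => [1]
  | a :: as => a.flatMap fun c => (tensorWeights as).map fun x => c * x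

theorem length_tensorWeights {W : ℕ} (as : List (List ℝ)) (h : ∀ a ∈ as, a.length = W) :
    (tensorWeights as).length = W ^ as.length := by
  induction as with
  | nil => rfl
  | cons a as ih =>
    rw [tensorWeights, length_flatMap_const _ _ (W ^ as.length), h a (by simp), List.length_cons,
      pow_succ']
    intro c _
    rw [List.length_map, ih fun b hb => h b (by simp [hb])]

theorem l1_tensorWeights (as : List (List ℝ)) : l1 (tensorWeights as) = (as.map l1).prod := by
  induction as with
  | nil => simp [tensorWeights]
  | cons a as ih =>
    rw [tensorWeights, List.map_cons, List.prod_cons, ← ih]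
    induction a with
    | nil => simp
    | cons c a iha => rw [List.flatMap_cons, l1_append, l1_map, l1_cons, iha]; ring

/-- A product of linear forms in `u` is one linear form in the tensor power of `u`. On sign bits,
`==` plays the role of multiplication (`bsign_beq`). -/
theorem dot_tensorWeights (u : List Bool) (κ : Bool) (as : List (List ℝ))
    (h : ∀ a ∈ as, a.length = u.length) :
    dot (tensorWeights as) (tensorPower u κ as.length) =
      bsign κ * (as.map fun a => dot a u).prod := by
  induction as with
  | nil => simp [tensorWeights, tensorPower]
  | cons a as ih =>
    have ih := ih fun b hb => h b (by simp [hb])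
    have hl : (tensorWeights as).length = (tensorPower u κ as.length).length := by
      rw [length_tensorPower, length_tensorWeights as fun b hb => h b (by simp [hb])]
    have key : ∀ (a : List ℝ) (v : List Bool), a.length = v.length →
        dot (a.flatMap fun c => (tensorWeights as).map fun x => c * x)
          (v.flatMap fun b => (tensorPower u κ as.length).map fun x => x == b) =
        dot a v * dot (tensorWeights as) (tensorPower u κ as.length) := by
      intro a
      induction a with
      | nil => intro v hv; rw [List.eq_nil_of_length_eq_zero hv.symm]; simp
      | cons c a iha =>
        intro v hv
        cases v with
        | nil => simp at hv
        | cons b v =>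
          rw [List.flatMap_cons, List.flatMap_cons, dot_append (by simpa using hl), dot_map,
            iha v (by simpa using hv), dot_cons]
          ring
    rw [tensorWeights, List.length_cons, tensorPower, key a u (h a (by simp)), ih]
    simp only [List.map_cons, List.prod_cons]
    ring

/-- The linear form `c + ∑ᵢ zᵢ` in the literals `zᵢ`, as a weight vector. -/
noncomputable def literalForm (n K : ℕ) (ψ : ℕ → ℝ) (c : ℝ) : List ℝ :=
  c :: (List.range K).flatMap fun _ => (List.range n).flatMap fun u => [ψ u / 2, ψ u / 2]

theorem length_literalForm (n K : ℕ) (ψ : ℕ → ℝ) (c : ℝ) :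
    (literalForm n K ψ c).length = width n K := by
  rw [literalForm, List.length_cons, length_flatMap_const _ _ (n * 2), List.length_range, width,
    add_comm]
  intro u _
  rw [length_flatMap_const _ _ 2, List.length_range]
  intro _ _; rfl

theorem l1_literalForm (n K : ℕ) (ψ : ℕ → ℝ) (hψ : ∀ u, |ψ u| = 1) (c : ℝ) :
    l1 (literalForm n K ψ c) = |c| + K * n := by
  rw [literalForm, l1_cons, l1_flatMap_range]
  simp only [l1_flatMap_range, l1_cons, l1_nil, abs_div, hψ]
  simp only [Finset.sum_const, Finset.card_range, nsmul_eq_mul]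
  norm_num

/-- Features must be `±1` and cannot vanish. With two entries of equal weight per variable, the pair
cancels at every variable other than `v i`, and at `v i` the two halves add up. -/
theorem dot_literalForm (n K : ℕ) (ψ : ℕ → ℝ) (c : ℝ) (v : ℕ → ℕ) (ρ : ℕ → Bool)
    (hv : ∀ i < K, v i < n) :
    dot (literalForm n K ψ c) (literalVector n K v ρ) =
      c + ∑ i ∈ Finset.range K, bsign (ρ i) * ψ (v i) := by
  rw [literalForm, literalVector, dot_cons, dot_flatMap_range]
  · congr 1
    · simp [bsign]
    · refine Finset.sum_congr rfl fun i hi => ?_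
      rw [oneHot, dot_flatMap_range]
      · rw [Finset.sum_eq_single (v i)]
        · simp; ring
        · intro u _ hu
          simp [hu, bsign]
        · intro h
          exact absurd (Finset.mem_range.2 (hv i (Finset.mem_range.1 hi))) h
      · intro u _; by_cases h : u = v i <;> simp [h]
  · intro i _
    rw [length_oneHot, length_flatMap_const _ _ 2, List.length_range]
    intro _ _; rfl

/-! ## The parity as a polynomial of small degree -/

/-- If `T` of the signs are `-1`, their sum is `K - 2T` and their product is `(-1)^T`, so the sum
determines the product. -/
theorem exists_parity_function (K : ℕ) : ∃ y : ℤ → ℝ, (∀ x, |y x| ≤ 1) ∧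
    ∀ z : ℕ → ℤ, (∀ i, z i = 1 ∨ z i = -1) →
      ((∏ i ∈ Finset.range K, z i : ℤ) : ℝ) = y (∑ i ∈ Finset.range K, z i) := by
  refine ⟨fun x => (-1) ^ (((K - x) / 2).toNat), fun x => by simp [abs_pow], fun z hz => ?_⟩
  have : ∃ T : ℕ, ∑ i ∈ Finset.range K, z i = K - 2 * T ∧ ∏ i ∈ Finset.range K, z i = (-1) ^ T := by
    induction K with
    | zero => exact ⟨0, by simp⟩
    | succ K ih =>
      obtain ⟨T, h1, h2⟩ := ih
      rcases hz K with h | h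
      · exact ⟨T, by rw [Finset.sum_range_succ, h1, h]; push_cast; ring,
          by rw [Finset.prod_range_succ, h2, h, mul_one]⟩
      · exact ⟨T + 1, by rw [Finset.sum_range_succ, h1, h]; push_cast; ring,
          by rw [Finset.prod_range_succ, h2, h, pow_succ]⟩
  obtain ⟨T, h1, h2⟩ := this
  simp only [h2, h1, show ((K : ℤ) - (K - 2 * T)) / 2 = T by omega]
  simp

/-- Lagrange interpolation, evaluated at a node; no other value of the interpolating polynomial is
used. -/
theorem sum_lagrange (s : Finset ℤ) (y : ℤ → ℝ) {x : ℤ} (hx : x ∈ s) :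
    ∑ i ∈ s, y i / (∏ j ∈ s.erase i, ((i : ℝ) - j)) * ∏ j ∈ s.erase i, ((x : ℝ) - j) = y x := by
  rw [Finset.sum_eq_single x]
  · rw [div_mul_cancel₀]
    rw [Finset.prod_ne_zero_iff]
    intro j hj
    have := (Finset.mem_erase.1 hj).1
    rw [sub_ne_zero]
    exact_mod_cast this.symm
  · intro i hi hix
    have : ∏ j ∈ s.erase i, ((x : ℝ) - j) = 0 :=
      Finset.prod_eq_zero (Finset.mem_erase.2 ⟨hix.symm, hx⟩) (by simp)
    rw [this, mul_zero]
  · exact fun h => absurd hx h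

/-- The denominators of Lagrange interpolation at integer nodes are products of nonzero integers, so
the coefficients are bounded by the interpolated values. -/
theorem one_le_abs_prod_sub (s : Finset ℤ) (i : ℤ) :
    1 ≤ |∏ j ∈ s.erase i, ((i : ℝ) - j)| := by
  rw [Finset.abs_prod]
  rw [← Finset.prod_const_one (s := s.erase i)]
  refine Finset.prod_le_prod (fun _ _ => zero_le_one) fun j hj => ?_
  have h := (Finset.mem_erase.1 hj).1
  have : 1 ≤ |i - j| := Int.one_le_abs (sub_ne_zero.2 h.symm)
  exact_mod_cast this

/-- The product of `K` literals is a linear function of the features, as long as the sum of the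
literals is at most `d` in absolute value. -/
theorem exists_constraint_weights (n K d : ℕ) (hd : d ≤ n * K) (ψ : ℕ → ℤ)
    (hψ : ∀ u, ψ u = 1 ∨ ψ u = -1) :
    ∃ w : List ℝ, w.length = width n K ^ (2 * d) ∧
      l1 w ≤ (2 * d + 1) * (width n K : ℝ) ^ (2 * d) ∧
      ∀ (v : ℕ → ℕ) (ρ : ℕ → Bool) (κ : Bool), (∀ i < K, v i < n) →
        |∑ i ∈ Finset.range K, bsign (ρ i) * (ψ (v i) : ℝ)| ≤ d →
        dot w (tensorPower (literalVector n K v ρ) κ (2 * d)) =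
          bsign κ * ∏ i ∈ Finset.range K, (bsign (ρ i) * (ψ (v i) : ℝ)) := by
  obtain ⟨y, hy1, hy⟩ := exists_parity_function K
  -- There are `2 * d + 1` nodes, so every Lagrange basis polynomial is a product of exactly `2 * d`
  -- linear forms and matches the order of the tensor power.
  set s : Finset ℤ := Finset.Icc (-(d : ℤ)) d with hs
  have hcard : ∀ i ∈ s, (s.erase i).card = 2 * d := fun i hi => by
    rw [Finset.card_erase_of_mem hi, hs, Int.card_Icc]; omega
  let as : ℤ → List (List ℝ) := fun i =>
    (s.erase i).toList.map fun j : ℤ => literalForm n K (fun u => ψ u) (-j)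
  have has : ∀ i, ∀ a ∈ as i, a.length = width n K := fun i a ha => by
    obtain ⟨j, _, rfl⟩ := List.mem_map.1 ha
    exact length_literalForm ..
  have haslen : ∀ i ∈ s, (as i).length = 2 * d := fun i hi => by simp [as, hcard i hi]
  have hwlen : ∀ i ∈ s, (tensorWeights (as i)).length = width n K ^ (2 * d) := fun i hi => by
    rw [length_tensorWeights _ (has i), haslen i hi]
  let c : ℤ → ℝ := fun i => y i / ∏ j ∈ s.erase i, ((i : ℝ) - j)
  have hc : ∀ i, |c i| ≤ 1 := fun i => by
    rw [abs_div]
    exact div_le_one_of_le₀ ((hy1 i).trans (one_le_abs_prod_sub s i)) (abs_nonneg _)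
  -- Each factor `∑ zᵢ - j` has `ℓ¹` norm `|j| + K * n`. The assumption `d ≤ n * K` brings this
  -- below the length of the vector, so all norms are controlled by the dimension.
  have hW : ((d : ℝ) + K * n) ≤ width n K := by
    have : d + K * n ≤ width n K := by
      rw [width]
      nlinarith
    exact_mod_cast this
  refine ⟨(List.range (width n K ^ (2 * d))).map fun p =>
    ∑ i ∈ s, c i * (tensorWeights (as i)).getD p 0, by simp, ?_, ?_⟩
  · rw [l1_eq_sum]
    simp only [List.length_map, List.length_range]
    calc _ ≤ ∑ p ∈ Finset.range (width n K ^ (2 * d)), ∑ i ∈ s,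
          |(tensorWeights (as i)).getD p 0| := by
          refine Finset.sum_le_sum fun p hp => ?_
          have hp := Finset.mem_range.1 hp
          rw [List.getD_eq_getElem _ _ (by simpa using hp)]
          simp only [List.getElem_map, List.getElem_range]
          refine (Finset.abs_sum_le_sum_abs _ _).trans (Finset.sum_le_sum fun i _ => ?_)
          rw [abs_mul]
          exact mul_le_of_le_one_left (abs_nonneg _) (hc i)
      _ = ∑ i ∈ s, l1 (tensorWeights (as i)) := by
          rw [Finset.sum_comm]
          refine Finset.sum_congr rfl fun i hi => ?_
          rw [l1_eq_sum, hwlen i hi]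
      _ ≤ ∑ i ∈ s, (width n K : ℝ) ^ (2 * d) := by
          refine Finset.sum_le_sum fun i hi => ?_
          rw [l1_tensorWeights, List.map_map]
          have : (s.erase i).toList.map (l1 ∘ fun j : ℤ => literalForm n K (fun u => ψ u) (-j)) =
              (s.erase i).toList.map fun j : ℤ => |-(j : ℝ)| + K * n := by
            apply List.map_congr_left
            intro j _
            simp only [Function.comp_apply]
            rw [l1_literalForm]
            intro u
            rcases hψ u with h | h <;> simp [h]
          rw [this, Finset.prod_map_toList, ← hcard i hi, ← Finset.prod_const]
          refine Finset.prod_le_prod (fun j _ => by positivity) fun j hj => ?_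
          have hj := (Finset.mem_erase.1 hj).2
          rw [hs, Finset.mem_Icc] at hj
          have : |-(j : ℝ)| ≤ d := by
            rw [abs_neg, abs_le]
            exact ⟨by exact_mod_cast hj.1, by exact_mod_cast hj.2⟩
          linarith
      _ = _ := by
          rw [Finset.sum_const, hs, Int.card_Icc, nsmul_eq_mul]
          congr 1
          have : (d + 1 - -(d : ℤ)).toNat = 2 * d + 1 := by omega
          rw [this]; push_cast; ring
  · intro v ρ κ hv hsum
    set u := literalVector n K v ρ with hu
    have hul : u.length = width n K := length_literalVector ..
    have htl : (tensorPower u κ (2 * d)).length = width n K ^ (2 * d) := by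
      rw [length_tensorPower, hul]
    let z : ℕ → ℤ := fun i => ((toSign (ρ i) : ℤˣ) : ℤ) * ψ (v i)
    have hz : ∀ i, z i = 1 ∨ z i = -1 := fun i => by
      simp only [z]
      rcases hψ (v i) with h | h <;> cases ρ i <;> simp [h, toSign]
    have hzr : ∀ i, (z i : ℝ) = bsign (ρ i) * (ψ (v i) : ℝ) := fun i => by
      simp only [z]; push_cast; rw [cast_toSign]
    set X : ℤ := ∑ i ∈ Finset.range K, z i with hX
    have hXr : (X : ℝ) = ∑ i ∈ Finset.range K, bsign (ρ i) * (ψ (v i) : ℝ) := by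
      rw [hX]; push_cast; exact Finset.sum_congr rfl fun i _ => hzr i
    have hXs : X ∈ s := by
      rw [← hXr, abs_le] at hsum
      rw [hs, Finset.mem_Icc]
      exact ⟨by exact_mod_cast hsum.1, by exact_mod_cast hsum.2⟩
    rw [dot_eq_sum _ _ (by simp [htl]), htl]
    have e1 : ∀ p ∈ Finset.range (width n K ^ (2 * d)),
        ((List.range (width n K ^ (2 * d))).map fun p =>
          ∑ i ∈ s, c i * (tensorWeights (as i)).getD p 0).getD p 0 *
          bsign ((tensorPower u κ (2 * d)).getD p false) =
        ∑ i ∈ s, c i * ((tensorWeights (as i)).getD p 0 *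
          bsign ((tensorPower u κ (2 * d)).getD p false)) := by
      intro p hp
      have hp := Finset.mem_range.1 hp
      rw [List.getD_eq_getElem _ _ (by simpa using hp)]
      simp only [List.getElem_map, List.getElem_range]
      rw [Finset.sum_mul]
      exact Finset.sum_congr rfl fun i _ => by ring
    rw [Finset.sum_congr rfl e1, Finset.sum_comm]
    have e2 : ∀ i ∈ s, ∑ p ∈ Finset.range (width n K ^ (2 * d)),
        c i * ((tensorWeights (as i)).getD p 0 *
          bsign ((tensorPower u κ (2 * d)).getD p false)) =
        bsign κ * (c i * ∏ j ∈ s.erase i, ((X : ℝ) - j)) := by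
      intro i hi
      rw [← Finset.mul_sum]
      have h1 := dot_eq_sum (tensorWeights (as i)) (tensorPower u κ (2 * d))
        (by rw [htl, hwlen i hi])
      rw [htl] at h1
      have h2 := dot_tensorWeights u κ (as i) (fun a ha => by rw [hul, has i a ha])
      rw [haslen i hi] at h2
      rw [← h1, h2, List.map_map]
      have : (s.erase i).toList.map ((fun a => dot a u) ∘
          fun j : ℤ => literalForm n K (fun u => (ψ u : ℝ)) (-j)) =
          (s.erase i).toList.map fun j : ℤ => (X : ℝ) - j := by
        apply List.map_congr_left
        intro j _
        simp only [Function.comp_apply]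
        rw [hu, dot_literalForm n K _ _ v ρ hv, hXr]
        ring
      rw [this, Finset.prod_map_toList]
      ring
    rw [Finset.sum_congr rfl e2, ← Finset.mul_sum, sum_lagrange s y hXs, ← hy z hz]
    push_cast
    congr 1
    exact Finset.prod_congr rfl fun i _ => hzr i

/-! ## Decoding formulas -/

/-- The encoding of a list of literals. -/
def encodeLits (l : List (Bool × ℕ)) : List Bool :=
  l.flatMap fun p => p.1 :: (unary p.2 ++ [false])

theorem dropWhile_unary_append (v : ℕ) (l : List Bool) :
    (unary v ++ false :: l).dropWhile id = false :: l := by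
  induction v with
  | zero => simp [unary]
  | succ v ih => simp [unary, List.replicate_succ]

theorem dropLit_iterate_encodeLits (k : ℕ) : ∀ l : List (Bool × ℕ),
    dropLit^[k] (encodeLits l) = encodeLits (l.drop k) := by
  induction k with
  | zero => intro l; simp
  | succ k ih =>
    intro l
    rw [Function.iterate_succ_apply]
    cases l with
    | nil => simpa [encodeLits, dropLit] using ih []
    | cons p l =>
      rw [List.drop_succ_cons, ← ih]
      congr 1
      simp only [encodeLits, dropLit, List.flatMap_cons, List.cons_append, List.tail_cons,
        List.append_assoc, List.nil_append]
      rw [dropWhile_unary_append]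
      rfl

section

variable {n K m : ℕ} (J : Formula n K m)

theorem encodeFormula_eq_encodeLits : encodeFormula J = encodeLits
    (List.ofFn fun p : Fin (m * K) =>
      (signBit ((J p.divNat).2 p.modNat), ((J p.divNat).1 p.modNat : ℕ))) := by
  rw [List.ofFn_mul, encodeLits, List.flatMap_def, List.map_flatten, List.flatten_flatten,
    List.map_ofFn, List.map_ofFn, encodeFormula]
  congr 2
  funext j
  simp only [Function.comp_apply, List.map_ofFn]
  congr 2
  funext i
  have h1 : Fin.divNat (⟨j * K + i, by
      calc (j : ℕ) * K + i < (j + 1) * K := by rw [Nat.succ_mul]; exact Nat.add_lt_add_left i.2 _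
        _ ≤ m * K := Nat.mul_le_mul_right _ j.2⟩ : Fin (m * K)) = j := by
    ext
    have := i.2
    simp only [Fin.divNat]
    rw [Nat.add_comm, Nat.add_mul_div_right _ _ (by omega), Nat.div_eq_of_lt this, Nat.zero_add]
  have h2 : Fin.modNat (⟨j * K + i, by
      calc (j : ℕ) * K + i < (j + 1) * K := by rw [Nat.succ_mul]; exact Nat.add_lt_add_left i.2 _
        _ ≤ m * K := Nat.mul_le_mul_right _ j.2⟩ : Fin (m * K)) = i := by
    ext
    simp only [Fin.modNat]
    rw [Nat.add_comm, Nat.add_mul_mod_self_right, Nat.mod_eq_of_lt i.2]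
  simp only [Function.comp_apply]
  rw [h1, h2]

/-- All tuples have exactly `K` literals, so the flat encoding needs no separators between them:
literal `i` of constraint `j` is number `j * K + i`. -/
theorem iterate_dropLit_encodeFormula (j : Fin m) (i : Fin K) : ∃ l,
    dropLit^[(j : ℕ) * K + i] (encodeFormula J) =
      signBit ((J j).2 i) :: (unary ((J j).1 i) ++ false :: l) := by
  have hlt : (j : ℕ) * K + i < m * K := by
    calc (j : ℕ) * K + i < (j + 1) * K := by rw [Nat.succ_mul]; exact Nat.add_lt_add_left i.2 _
      _ ≤ m * K := Nat.mul_le_mul_right _ j.2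
  have h1 : Fin.divNat (⟨j * K + i, hlt⟩ : Fin (m * K)) = j := by
    ext
    have := i.2
    simp only [Fin.divNat]
    rw [Nat.add_comm, Nat.add_mul_div_right _ _ (by omega), Nat.div_eq_of_lt this, Nat.zero_add]
  have h2 : Fin.modNat (⟨j * K + i, hlt⟩ : Fin (m * K)) = i := by
    ext
    simp only [Fin.modNat]
    rw [Nat.add_comm, Nat.add_mul_mod_self_right, Nat.mod_eq_of_lt i.2]
  rw [encodeFormula_eq_encodeLits, dropLit_iterate_encodeLits,
    List.drop_eq_getElem_cons (by simpa using hlt)]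
  simp only [List.getElem_ofFn, h1, h2]
  exact ⟨_, by simp [encodeLits]; rfl⟩

theorem litSign_encodeFormula (j : Fin m) (i : Fin K) :
    litSign (encodeFormula J) ((j : ℕ) * K + i) = signBit ((J j).2 i) := by
  obtain ⟨l, h⟩ := iterate_dropLit_encodeFormula J j i
  rw [litSign, h]; rfl

theorem litVar_encodeFormula (j : Fin m) (i : Fin K) :
    litVar (encodeFormula J) ((j : ℕ) * K + i) = (J j).1 i := by
  obtain ⟨l, h⟩ := iterate_dropLit_encodeFormula J j i
  rw [litVar, h, List.tail_cons, dropWhile_unary_append]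
  simp [unary]

end

/-! ## The margin of the examples -/

theorem bsign_signBit (u : ℤˣ) : bsign (signBit u) = ((u : ℤ) : ℝ) := by
  rcases Int.units_eq_one_or u with rfl | rfl <;> simp [bsign, signBit]

/-- The coins for constraint number `t` of an example. -/
def chunk (m K : ℕ) (χ : ℕ → Bool) (t : ℕ) (k : ℕ) : Bool := χ (1 + t * (m + K) + k)

/-- `pickIndex` as the index of a constraint. -/
def pick {m : ℕ} (hm : 0 < m) (χ : ℕ → Bool) : Fin m := ⟨pickIndex m χ, Nat.mod_lt _ hm⟩

/-- The sum of the literals of a constraint, with random signs given by the coins. -/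
noncomputable def literalSum {n K m : ℕ} (hm : 0 < m) (J : Formula n K m) (ψ : Cube n)
    (χ : ℕ → Bool) : ℝ :=
  ∑ i : Fin K, bsign (χ (m + i)) * (((ψ ((J (pick hm χ)).1 i) : ℤˣ) : ℤ) : ℝ)

theorem cast_xorSign_apply {n K : ℕ} (C : KTuple n K) (ψ : Cube n) :
    ((xorSign (C.apply ψ) : ℤˣ) : ℤ) = ∏ i : Fin K, ((C.2 i : ℤˣ) : ℤ) * ((ψ (C.1 i) : ℤˣ) : ℤ) := by
  simp [xorSign, KTuple.apply, Units.coe_prod]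

-- The weights depend on `ψ` only and are the same in all `2 * d + 1` blocks. Label times scalar
-- product of a block is, up to scale, the XOR of its constraint at `ψ`; the label and the random
-- signs occur twice and cancel. With at most `d` violated constraints the sum of these signs is at
-- least `1`.
open Classical in
theorem exists_weights {n K m d : ℕ} (hm : 0 < m) (hd : d ≤ n * K) (J : Formula n K m)
    (ψ : Cube n) :
    ∃ w : Fin (featureDim n K d) → ℝ,
      ∑ i, |w i| ≤ 2 * (2 * d + 1) * (featureDim n K d : ℝ) ∧
      ∀ χ : ℕ → Bool,
        (∀ t < 2 * d + 1, |literalSum hm J ψ (chunk m K χ t)| ≤ d) →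
        ((Finset.range (2 * d + 1)).filter fun t =>
          xorSign ((J (pick hm (chunk m K χ t))).apply ψ) ≠ 1).card ≤ d →
        1 < (((mkExample d J χ).2 : ℤ) : ℝ) *
          ∑ i, w i * ((((mkExample d J χ).1 i : ℤˣ) : ℤ) : ℝ) := by
  let ψ' : ℕ → ℤ := fun u => if h : u < n then ((ψ ⟨u, h⟩ : ℤˣ) : ℤ) else 1
  have hψ' : ∀ u, ψ' u = 1 ∨ ψ' u = -1 := fun u => by
    simp only [ψ']
    split_ifs with h
    · rcases Int.units_eq_one_or (ψ ⟨u, h⟩) with h | h <;> simp [h]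
    · simp
  obtain ⟨w, hwl, hw1, hw⟩ := exists_constraint_weights n K d hd ψ' hψ'
  set W := width n K ^ (2 * d) with hW
  -- Doubling turns a signed sum that is at least `1` into a margin strictly larger than `1`.
  let w2 : List ℝ := (List.range (2 * d + 1)).flatMap fun _ => w.map fun a => 2 * a
  have hw2l : w2.length = featureDim n K d := by
    rw [length_flatMap_const _ _ W, List.length_range, featureDim]
    intro _ _; simp [hwl]
  refine ⟨fun i => w2.getD i 0, ?_, fun χ hsum hbad => ?_⟩
  · rw [Fin.sum_univ_eq_sum_range (fun i => |w2.getD i 0|), ← hw2l, ← l1_eq_sum]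
    simp only [w2, l1_flatMap_range, l1_map, Finset.sum_const, Finset.card_range, nsmul_eq_mul]
    rw [show ((List.range (2 * d + 1)).flatMap fun _ => w.map fun a => 2 * a).length =
      featureDim n K d from hw2l, featureDim, ← hW]
    rw [show |(2 : ℝ)| = 2 by norm_num]
    push_cast
    rw [hW] at *
    push_cast
    have : (0 : ℝ) ≤ 2 * d + 1 := by positivity
    nlinarith
  · set enc := encodeFormula J with henc
    have hterm : ∀ t ∈ Finset.range (2 * d + 1),
        bsign (χ 0) * dot (w.map fun a => 2 * a)
          (constraintBits n K m d enc (χ 0) (chunk m K χ t)) =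
        2 * (((xorSign ((J (pick hm (chunk m K χ t))).apply ψ) : ℤˣ) : ℤ) : ℝ) := by
      intro t ht
      set χt := chunk m K χ t with hχt
      have hs := hsum t (Finset.mem_range.1 ht)
      set j := pick hm χt with hj
      have hjv : pickIndex m χt = (j : ℕ) := rfl
      have hvar : ∀ i : Fin K, ψ' (litVar enc ((j : ℕ) * K + i)) = ((ψ ((J j).1 i) : ℤˣ) : ℤ) := by
        intro i
        rw [henc, litVar_encodeFormula]
        simp [ψ']
      have h1 := hw (fun i => litVar enc ((j : ℕ) * K + i)) (fun i => χt (m + i))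
        (χ 0 == parity (fun i => litSign enc ((j : ℕ) * K + i) == χt (m + i)) K)
        (fun i hi => by
          have := litVar_encodeFormula J j ⟨i, hi⟩
          simp only at this
          rw [henc, this]; exact Fin.is_lt _)
        (by
          rw [← Fin.sum_univ_eq_sum_range
            (fun i => bsign (χt (m + i)) * (ψ' (litVar enc ((j : ℕ) * K + i)) : ℝ))]
          simp only [hvar]
          exact hs)
      have h2 := dot_map 2 true w (tensorPower (literalVector n K
        (fun i => litVar enc ((j : ℕ) * K + i)) fun i => χt (m + i))
        (χ 0 == parity (fun i => litSign enc ((j : ℕ) * K + i) == χt (m + i)) K) (2 * d))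
      simp only [beq_true, List.map_id'] at h2
      rw [constraintBits, hjv, h2, h1, bsign_beq, bsign_parity, cast_xorSign_apply]
      simp only [bsign_beq, Finset.prod_mul_distrib]
      rw [← Fin.prod_univ_eq_prod_range (fun i => bsign (litSign enc ((j : ℕ) * K + i))),
        ← Fin.prod_univ_eq_prod_range (fun i => (ψ' (litVar enc ((j : ℕ) * K + i)) : ℝ))]
      have h3 : (∏ i ∈ Finset.range K, bsign (χt (m + i))) *
          (∏ i ∈ Finset.range K, bsign (χt (m + i))) = 1 := by
        rw [← Finset.prod_mul_distrib]
        exact Finset.prod_eq_one fun i _ => bsign_mul_self _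
      simp only [hvar]
      simp only [henc, litSign_encodeFormula, bsign_signBit]
      push_cast
      have h4 := bsign_mul_self (χ 0)
      have h5 : bsign true = 1 := rfl
      rw [h5]
      -- Only two facts enter: the square of the label is `1`, and so is the square of the product
      -- of the random signs.
      linear_combination (2 * (∏ i : Fin K, (((J j).2 i : ℤ) : ℝ)) *
        ∏ i : Fin K, ((ψ ((J j).1 i) : ℤ) : ℝ)) * ((bsign (χ 0) * bsign (χ 0)) * h3 + h4)
    have hxl := length_exampleBits n K m d enc χ
    have hx : ∀ i, (((mkExample d J χ).1 i : ℤˣ) : ℤ) =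
      ((toSign ((exampleBits n K m d enc χ).getD i false) : ℤˣ) : ℤ) := fun i => rfl
    have hy : (((mkExample d J χ).2 : ℤˣ) : ℤ) = ((toSign (χ 0) : ℤˣ) : ℤ) := rfl
    simp only [hx, hy, cast_toSign]
    rw [Fin.sum_univ_eq_sum_range
      (fun i => w2.getD i 0 * bsign ((exampleBits n K m d enc χ).getD i false))]
    have hdot := dot_eq_sum w2 (exampleBits n K m d enc χ) (by rw [hw2l, hxl])
    rw [hxl] at hdot
    rw [← hdot]
    have hdot2 : dot w2 (exampleBits n K m d enc χ) = ∑ t ∈ Finset.range (2 * d + 1),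
        dot (w.map fun a => 2 * a) (constraintBits n K m d enc (χ 0) (chunk m K χ t)) :=
      dot_flatMap_range (2 * d + 1) _ _ fun t _ => by
        rw [List.length_map, hwl, length_constraintBits]
    rw [hdot2, Finset.mul_sum, Finset.sum_congr rfl hterm, ← Finset.mul_sum]
    set E : ℕ → ℤˣ := fun t => xorSign ((J (pick hm (chunk m K χ t))).apply ψ) with hE
    have hcount : ∑ t ∈ Finset.range (2 * d + 1), (((E t : ℤˣ) : ℤ) : ℝ) =
        (2 * d + 1 : ℝ) - 2 * ((Finset.range (2 * d + 1)).filter fun t => E t ≠ 1).card := by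
      have : ∀ t, (((E t : ℤˣ) : ℤ) : ℝ) = 1 - 2 * (if E t ≠ 1 then 1 else 0) := fun t => by
        rcases Int.units_eq_one_or (E t) with h | h
        · simp [h]
        · rw [h]; norm_num
      simp only [this, Finset.sum_sub_distrib, ← Finset.mul_sum]
      rw [Finset.card_filter]
      simp
    rw [hcount]
    have : (((Finset.range (2 * d + 1)).filter fun t => E t ≠ 1).card : ℝ) ≤ d := by
      exact_mod_cast hbad
    linarith

/-! ## Rounds with structured coins -/

theorem bitsVal_congr {f g : ℕ → Bool} {k : ℕ} (h : ∀ i < k, f i = g i) :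
    bitsVal f k = bitsVal g k := by
  induction k with
  | zero => rfl
  | succ k ih => rw [bitsVal, bitsVal, ih fun i hi => h i (by omega), h k (by omega)]

theorem parity_congr {f g : ℕ → Bool} {k : ℕ} (h : ∀ i < k, f i = g i) :
    parity f k = parity g k := by
  induction k with
  | zero => rfl
  | succ k ih => rw [parity, parity, ih fun i hi => h i (by omega), h k (by omega)]

theorem flatMap_range_congr {α : Type*} {k : ℕ} {f g : ℕ → List α} (h : ∀ i < k, f i = g i) :
    (List.range k).flatMap f = (List.range k).flatMap g := by
  rw [List.flatMap_def, List.flatMap_def]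
  congr 1
  exact List.map_congr_left fun i hi => h i (List.mem_range.1 hi)

theorem constraintBits_congr {n K m d : ℕ} {enc : List Bool} {b : Bool} {χ χ' : ℕ → Bool}
    (h : ∀ k < m + K, χ k = χ' k) :
    constraintBits n K m d enc b χ = constraintBits n K m d enc b χ' := by
  have h1 : pickIndex m χ = pickIndex m χ' := by
    rw [pickIndex, pickIndex, bitsVal_congr fun i hi => h i (by omega)]
  rw [constraintBits, constraintBits, h1]
  congr 1
  · rw [literalVector, literalVector]
    congr 1
    exact flatMap_range_congr fun i hi => by rw [h (m + i) (by omega)]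
  · congr 1
    exact parity_congr fun i hi => by rw [h (m + i) (by omega)]

theorem chunk_lt {m K d t k : ℕ} (ht : t < 2 * d + 1) (hk : k < m + K) :
    1 + t * (m + K) + k < blockLength m K d := by
  have : (t + 1) * (m + K) ≤ (2 * d + 1) * (m + K) := Nat.mul_le_mul_right _ ht
  rw [Nat.succ_mul] at this
  rw [blockLength]; omega

theorem mkExample_congr {n K m d : ℕ} {J : Formula n K m} {χ χ' : ℕ → Bool}
    (h : ∀ k < blockLength m K d, χ k = χ' k) : mkExample d J χ = mkExample d J χ' := by
  have h0 : χ 0 = χ' 0 := h 0 (by rw [blockLength]; omega)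
  have h1 : exampleBits n K m d (encodeFormula J) χ = exampleBits n K m d (encodeFormula J) χ' := by
    rw [exampleBits, exampleBits, h0]
    exact flatMap_range_congr fun t ht => constraintBits_congr fun k hk => h _ (chunk_lt ht hk)
  rw [mkExample, mkExample, h0, h1]

/-- The coins for one example. -/
abbrev Block (m K d : ℕ) : Type := Fin (blockLength m K d) → Bool

/-- The example made from the formula `J` with the coins `β`. -/
def blockExample {n K m d : ℕ} (J : Formula n K m) (β : Block m K d) :
    Example (featureDim n K d) := mkExample d J (extendBits β)

/-- The coins of one round: those for the sample, those of the learner, and those for the test. -/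
abbrev RoundCoins (L : PolyTimeLearner) (a n K m d : ℕ) : Type :=
  ((Fin (L.sampleSize.eval (featureDim n K d)) → Block m K d) ×
    (Fin (L.coins.eval (featureDim n K d)) → Bool)) ×
    (Fin (featureDim n K d ^ (2 * a + 1)) → Block m K d)

/-- The number of examples in `T` on which `h` is correct. -/
noncomputable def matchCount {n K m d A : ℕ} (J : Formula n K m)
    (h : Cube (featureDim n K d) → ℤˣ) (T : Fin A → Block m K d) : ℕ :=
  (Finset.univ.filter fun k => h (blockExample J (T k)).1 = (blockExample J (T k)).2).card

/-- The round with coins `ω` passes. -/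
def PassesWith (L : PolyTimeLearner) (a : ℕ) {n K m d : ℕ} (J : Formula n K m)
    (ω : RoundCoins L a n K m d) : Prop :=
  featureDim n K d ^ (2 * a + 1) -
      matchCount J (L.hyp _ (fun j => blockExample J (ω.1.1 j)) ω.1.2) ω.2 +
      featureDim n K d ^ (a + 1) ≤
    matchCount J (L.hyp _ (fun j => blockExample J (ω.1.1 j)) ω.1.2) ω.2

/-- Coins indexed by round and purpose. -/
abbrev CoinIndex (L : PolyTimeLearner) (a R n K m d : ℕ) : Type :=
  Fin R × (((Fin (L.sampleSize.eval (featureDim n K d)) ⊕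
    Fin (featureDim n K d ^ (2 * a + 1))) × Fin (blockLength m K d)) ⊕
    Fin (L.coins.eval (featureDim n K d)))

/-- Grouping the coins of all rounds. -/
noncomputable def coinEquiv (L : PolyTimeLearner) (a R n K m d : ℕ) :
    (CoinIndex L a R n K m d → Bool) ≃ (Fin R → RoundCoins L a n K m d) where
  toFun g ρ := ((fun j p => g (ρ, .inl (.inl j, p)), fun c => g (ρ, .inr c)),
    fun k p => g (ρ, .inl (.inr k, p)))
  invFun ω x := Sum.elim (fun y => Sum.elim (fun j => (ω x.1).1.1 j y.2)
    (fun k => (ω x.1).2 k y.2) y.1) (fun c => (ω x.1).1.2 c) x.2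
  left_inv g := by
    funext x
    obtain ⟨ρ, ⟨j | k, p⟩ | c⟩ := x <;> rfl
  right_inv ω := rfl

/-- The position of a coin in the string of all coins. -/
noncomputable def coinPosition (L : PolyTimeLearner) (a R n K m d : ℕ) {C : ℕ}
    (h : R * roundLength L a n K m d ≤ C) (x : CoinIndex L a R n K m d) : Fin C :=
  Fin.castLE h (finProdFinEquiv (Prod.map id (finSumFinEquiv ∘
    Sum.map (finProdFinEquiv ∘ Prod.map finSumFinEquiv id) id) x))

theorem coinPosition_injective (L : PolyTimeLearner) (a R n K m d : ℕ) {C : ℕ}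
    (h : R * roundLength L a n K m d ≤ C) :
    Function.Injective (coinPosition L a R n K m d h) := by
  refine (Fin.castLE_injective h).comp (finProdFinEquiv.injective.comp
    (Function.Injective.prodMap Function.injective_id (finSumFinEquiv.injective.comp
    (Function.Injective.sumMap (finProdFinEquiv.injective.comp
    (Function.Injective.prodMap finSumFinEquiv.injective Function.injective_id))
    Function.injective_id))))

theorem roundPasses_iff (L : PolyTimeLearner) (a : ℕ) {n K m d : ℕ} (J : Formula n K m)
    (χ : ℕ → Bool) (ω : RoundCoins L a n K m d)
    (hS : ∀ (j : Fin (L.sampleSize.eval (featureDim n K d))) (p : Fin (blockLength m K d)),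
      χ (j * blockLength m K d + p) = ω.1.1 j p)
    (hT : ∀ (k : Fin (featureDim n K d ^ (2 * a + 1))) (p : Fin (blockLength m K d)),
      χ ((L.sampleSize.eval (featureDim n K d) + k) * blockLength m K d + p) = ω.2 k p)
    (hr : ∀ c : Fin (L.coins.eval (featureDim n K d)),
      χ ((L.sampleSize.eval (featureDim n K d) + featureDim n K d ^ (2 * a + 1)) *
      blockLength m K d + c) = ω.1.2 c) :
    RoundPasses L a d J χ ↔ PassesWith L a J ω := by
  have h1 : roundSample L d J χ = fun j => blockExample J (ω.1.1 j) := by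
    funext j
    refine mkExample_congr fun p hp => ?_
    rw [extendBits, dif_pos hp]
    exact hS j ⟨p, hp⟩
  have h2 : ∀ k, roundTest L d J χ (k : Fin (featureDim n K d ^ (2 * a + 1))) =
      blockExample J (ω.2 k) := by
    intro k
    refine mkExample_congr fun p hp => ?_
    rw [extendBits, dif_pos hp]
    exact hT k ⟨p, hp⟩
  have h3 : roundCoins (n := n) (K := K) (m := m) L a d χ = ω.1.2 := funext fun c => hr c
  simp only [RoundPasses, PassesWith, roundMatches, matchCount, roundHyp, h1, h2, h3]

/-- Different rounds and purposes read disjoint positions of the coin string, so the coins read are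
independent and uniform; surplus coins are irrelevant. -/
theorem uniformProb_someRoundPasses (L : PolyTimeLearner) (a R : ℕ) {n K m d : ℕ}
    (J : Formula n K m) {C : ℕ} (h : R * roundLength L a n K m d ≤ C) :
    uniformProb (fun r : Fin C → Bool => SomeRoundPasses L a R d J (extendBits r)) =
      uniformProb fun ω : Fin R → RoundCoins L a n K m d => ∃ ρ, PassesWith L a J (ω ρ) := by
  rw [← uniformProb_equiv (coinEquiv L a R n K m d),
    ← uniformProb_comp_injective (coinPosition_injective L a R n K m d h)]
  congr 1
  funext r
  have hlt : ∀ x : CoinIndex L a R n K m d, extendBits r (coinPosition L a R n K m d h x) =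
      (r ∘ coinPosition L a R n K m d h) x := fun x => by
    rw [extendBits, dif_pos (Fin.is_lt _)]; rfl
  have key : ∀ ρ : Fin R, RoundPasses L a d J
      (fun p => extendBits r (ρ * roundLength L a n K m d + p)) ↔
      PassesWith L a J (coinEquiv L a R n K m d (r ∘ coinPosition L a R n K m d h) ρ) := by
    intro ρ
    apply roundPasses_iff
    · intro j p
      refine Eq.trans ?_ (hlt (ρ, .inl (.inl j, p)))
      congr 1
      change _ = (p + blockLength m K d * j) + roundLength L a n K m d * ρ
      ring
    · intro k p
      refine Eq.trans ?_ (hlt (ρ, .inl (.inr k, p)))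
      congr 1
      change _ = (p + blockLength m K d * (L.sampleSize.eval (featureDim n K d) + k)) +
        roundLength L a n K m d * ρ
      ring
    · intro c
      refine Eq.trans ?_ (hlt (ρ, .inr c))
      congr 1
      change _ = ((L.sampleSize.eval (featureDim n K d) + featureDim n K d ^ (2 * a + 1)) *
          blockLength m K d + c) + roundLength L a n K m d * ρ
      ring
  apply propext
  constructor
  · rintro ⟨ρ, hρ, hp⟩
    exact ⟨⟨ρ, hρ⟩, (key ⟨ρ, hρ⟩).1 hp⟩
  · rintro ⟨ρ, hp⟩
    exact ⟨ρ, ρ.2, (key ρ).2 hp⟩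

/-! ## The coins of one example -/

/-- The coins for the constraints of an example: for each of them, those choosing the constraint
and the random signs. -/
abbrev ChunkData (m K d : ℕ) : Type := Fin (2 * d + 1) → (Fin m → Bool) × (Fin K → Bool)

/-- The coins of an example: its label and the coins for its constraints. -/
abbrev BlockData (m K d : ℕ) : Type := Bool × ChunkData m K d

/-- The position of the coins in a block. -/
def blockPosition (m K d : ℕ) :
    Fin 1 ⊕ (Fin (2 * d + 1) × (Fin m ⊕ Fin K)) ≃ Fin (blockLength m K d) :=
  (Equiv.sumCongr (Equiv.refl _) ((Equiv.prodCongr (Equiv.refl _) finSumFinEquiv).trans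
    finProdFinEquiv)).trans finSumFinEquiv

/-- Grouping the coins of a block. -/
def blockEquiv (m K d : ℕ) : BlockData m K d ≃ Block m K d where
  toFun x p := Sum.elim (fun _ => x.1)
    (fun y => Sum.elim (x.2 y.1).1 (x.2 y.1).2 y.2) ((blockPosition m K d).symm p)
  invFun β := (β (blockPosition m K d (.inl 0)), fun t =>
    (fun i => β (blockPosition m K d (.inr (t, .inl i))),
      fun i => β (blockPosition m K d (.inr (t, .inr i)))))
  left_inv x := by simp
  right_inv β := by
    funext p
    obtain ⟨x, rfl⟩ := (blockPosition m K d).surjective p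
    obtain i | ⟨t, i | i⟩ := x
    · rw [Subsingleton.elim i 0]; simp
    · simp
    · simp

section

variable {m K d : ℕ} (x : BlockData m K d)

theorem extendBits_blockEquiv (z : Fin 1 ⊕ (Fin (2 * d + 1) × (Fin m ⊕ Fin K))) {p : ℕ}
    (hp : p = blockPosition m K d z) : extendBits (blockEquiv m K d x) p =
      Sum.elim (fun _ => x.1) (fun y => Sum.elim (x.2 y.1).1 (x.2 y.1).2 y.2) z := by
  subst hp
  rw [extendBits, dif_pos (Fin.is_lt _)]
  simp [blockEquiv]

theorem extendBits_blockEquiv_zero : extendBits (blockEquiv m K d x) 0 = x.1 :=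
  extendBits_blockEquiv x (.inl 0) rfl

theorem chunk_blockEquiv_left (t : Fin (2 * d + 1)) (i : Fin m) :
    chunk m K (extendBits (blockEquiv m K d x)) t i = (x.2 t).1 i :=
  extendBits_blockEquiv x (.inr (t, .inl i)) (by
    change _ = 1 + ((i : ℕ) + (m + K) * t); ring)

theorem chunk_blockEquiv_right (t : Fin (2 * d + 1)) (i : Fin K) :
    chunk m K (extendBits (blockEquiv m K d x)) t (m + i) = (x.2 t).2 i :=
  extendBits_blockEquiv x (.inr (t, .inr i)) (by
    change _ = 1 + ((m + i : ℕ) + (m + K) * t); ring)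

theorem pick_congr (hm : 0 < m) {χ χ' : ℕ → Bool} (h : ∀ i < m, χ i = χ' i) :
    pick hm χ = pick hm χ' := by
  ext; simp only [pick, pickIndex, bitsVal_congr h]

theorem pick_chunk_blockEquiv (hm : 0 < m) (t : Fin (2 * d + 1)) :
    pick hm (chunk m K (extendBits (blockEquiv m K d x)) t) = pick hm (extendBits (x.2 t).1) :=
  pick_congr hm fun i hi => by
    rw [chunk_blockEquiv_left x t ⟨i, hi⟩, extendBits, dif_pos hi]

end

/-! ### The law of the chosen constraint -/

theorem bitsVal_lt (f : ℕ → Bool) (k : ℕ) : bitsVal f k < 2 ^ k := by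
  induction k with
  | zero => simp [bitsVal]
  | succ k ih =>
    rw [bitsVal, pow_succ]
    have := Bool.toNat_lt (f k)
    omega

theorem bitsVal_inj {f g : ℕ → Bool} {k : ℕ} (h : bitsVal f k = bitsVal g k) :
    ∀ i < k, f i = g i := by
  induction k with
  | zero => intro i hi; omega
  | succ k ih =>
    rw [bitsVal, bitsVal] at h
    have h1 := Bool.toNat_lt (f k)
    have h2 := Bool.toNat_lt (g k)
    intro i hi
    rcases Nat.lt_succ_iff_lt_or_eq.1 hi with hi | rfl
    · exact ih (by omega) i hi
    · have : (f i).toNat = (g i).toNat := by omega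
      cases hf : f i <;> cases hg : g i <;> simp_all

/-- A residue class modulo `m` contains at most `2 ^ m / m + 1` of the numbers below `2 ^ m`.
Spending `m` coins on one index makes the bias exponentially small. -/
theorem uniformProb_pick_eq_le {m : ℕ} (hm : 0 < m) (j : Fin m) :
    uniformProb (fun g : Fin m → Bool => pick hm (extendBits g) = j) ≤
      (1 + (m : ℝ) / 2 ^ m) / m := by
  classical
  have hcard : (Finset.univ.filter fun g : Fin m → Bool => pick hm (extendBits g) = j).card ≤
      2 ^ m / m + 1 := by
    rw [← Finset.card_range (2 ^ m / m + 1)]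
    -- Within one residue class the quotient by `m` determines the number, and the number determines
    -- its binary digits.
    refine Finset.card_le_card_of_injOn (fun g => bitsVal (extendBits g) m / m) ?_ ?_
    · intro g _
      simp only [Finset.coe_range, Set.mem_Iio]
      exact Nat.lt_succ_of_le (Nat.div_le_div_right (bitsVal_lt _ _).le)
    · intro g hg g' hg' h
      simp only [Finset.coe_filter, Finset.mem_univ, true_and, Set.mem_ofPred_eq] at hg hg'
      have h1 : bitsVal (extendBits g) m % m = bitsVal (extendBits g') m % m := by
        have := congrArg Fin.val (hg.trans hg'.symm)
        exact this
      have h2 : bitsVal (extendBits g) m = bitsVal (extendBits g') m := by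
        rw [← Nat.div_add_mod (bitsVal (extendBits g) m) m,
          ← Nat.div_add_mod (bitsVal (extendBits g') m) m, h1]
        simp only at h
        rw [h]
      funext i
      have := bitsVal_inj h2 i i.2
      simpa [extendBits] using this
  have hm' : (0 : ℝ) < m := by exact_mod_cast hm
  rw [uniformProb]
  rw [show (Fintype.card (Fin m → Bool) : ℝ) = 2 ^ m by simp]
  rw [div_le_iff₀ (by positivity)]
  have h3 : ((2 ^ m / m : ℕ) : ℝ) ≤ 2 ^ m / m := by
    have := @Nat.cast_div_le ℝ _ _ _ (2 ^ m) m
    push_cast at this ⊢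
    exact this
  have h4 : (1 + (m : ℝ) / 2 ^ m) / m * 2 ^ m = 2 ^ m / m + 1 := by
    field_simp
  rw [h4]
  have h5 : ((Finset.univ.filter fun g : Fin m → Bool => pick hm (extendBits g) = j).card : ℝ) ≤
      ((2 ^ m / m + 1 : ℕ) : ℝ) := by exact_mod_cast hcard
  push_cast at h5 h3
  refine le_trans (le_of_eq ?_) (h5.trans (add_le_add_left h3 1))
  congr!

theorem uniformProb_pick_mem_le {m : ℕ} (hm : 0 < m) (S : Finset (Fin m)) :
    uniformProb (fun g : Fin m → Bool => pick hm (extendBits g) ∈ S) ≤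
      S.card / m * (1 + (m : ℝ) / 2 ^ m) := by
  have h := uniformProb_exists_le
    (fun (j : S) (g : Fin m → Bool) => pick hm (extendBits g) = j)
  refine (uniformProb_mono fun g hg => ⟨⟨_, hg⟩, rfl⟩).trans (h.trans ?_)
  refine (Finset.sum_le_sum fun (j : S) _ => uniformProb_pick_eq_le hm j).trans (le_of_eq ?_)
  simp; ring

/-! ### Exponential moments -/

theorem avg_bool (f : Bool → ℝ) : avg f = (f true + f false) / 2 := by
  simp [avg]

theorem uniformProb_le_avg {α : Type*} [Fintype α] {E : α → Prop} {f : α → ℝ}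
    (hf : ∀ a, 0 ≤ f a) (h : ∀ a, E a → 1 ≤ f a) : uniformProb E ≤ avg f := by
  classical
  rw [uniformProb_eq_avg]
  refine avg_mono fun a => ?_
  split_ifs with hE
  · exact h a hE
  · exact hf a

/-- A Rademacher sum rarely exceeds `d`. -/
theorem uniformProb_rademacher_le {K : ℕ} (hK : 0 < K) (ε : Fin K → ℝ)
    (hε : ∀ i, ε i = 1 ∨ ε i = -1) (d : ℕ) :
    uniformProb (fun ρ : Fin K → Bool => (d : ℝ) ≤ ∑ i, bsign (ρ i) * ε i) ≤
      Real.exp (-((d : ℝ) ^ 2 / (2 * K))) := by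
  have hK' : (0 : ℝ) < K := by exact_mod_cast hK
  -- This minimises the exponent `K * l ^ 2 / 2 - l * d` of the exponential moment bound.
  set l : ℝ := d / K with hl
  have h1 : uniformProb (fun ρ : Fin K → Bool => (d : ℝ) ≤ ∑ i, bsign (ρ i) * ε i) ≤
      avg fun ρ : Fin K → Bool => Real.exp (-(l * d)) * ∏ i, Real.exp (l * (bsign (ρ i) * ε i)) := by
    refine uniformProb_le_avg (fun ρ => by positivity) fun ρ h => ?_
    rw [← Real.exp_sum, ← Real.exp_add, ← Finset.mul_sum]
    apply Real.one_le_exp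
    have : 0 ≤ l := by positivity
    nlinarith
  refine h1.trans ?_
  rw [avg_const_mul, avg_pi_prod (fun i b => Real.exp (l * (bsign b * ε i)))]
  have h2 : ∀ i, avg (fun b => Real.exp (l * (bsign b * ε i))) ≤ Real.exp (l ^ 2 / 2) := by
    intro i
    refine le_trans (le_of_eq ?_) (Real.cosh_le_exp_half_sq l)
    rw [avg_bool, Real.cosh_eq]
    rcases hε i with h | h <;> simp [h, bsign]
    ring
  calc _ ≤ Real.exp (-(l * d)) * ∏ i : Fin K, Real.exp (l ^ 2 / 2) := by
        gcongr with i
        · exact fun i _ => avg_nonneg fun b => by positivity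
        · exact h2 i
    _ = _ := by
        rw [Finset.prod_const, Finset.card_univ, Fintype.card_fin, ← Real.exp_nat_mul,
          ← Real.exp_add, hl]
        congr 1
        field_simp
        ring

theorem uniformProb_abs_rademacher_le {K : ℕ} (hK : 0 < K) (ε : Fin K → ℝ)
    (hε : ∀ i, ε i = 1 ∨ ε i = -1) (d : ℕ) :
    uniformProb (fun ρ : Fin K → Bool => ¬ |∑ i, bsign (ρ i) * ε i| ≤ d) ≤
      2 * Real.exp (-((d : ℝ) ^ 2 / (2 * K))) := by
  have h1 := uniformProb_rademacher_le hK ε hε d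
  have h2 := uniformProb_rademacher_le hK (fun i => -ε i)
    (fun i => by rcases hε i with h | h <;> simp [h]) d
  rw [two_mul]
  refine le_trans (uniformProb_mono fun ρ h => ?_) ((uniformProb_or_le _ _).trans (add_le_add h1 h2))
  simp only [mul_neg, Finset.sum_neg_distrib]
  push Not at h
  rcases lt_abs.1 h with h | h
  · exact Or.inl h.le
  · exact Or.inr h.le

open Classical in
/-- A Chernoff bound for more than half of `2 d + 1` independent events. -/
theorem uniformProb_majority_le {α : Type*} [Fintype α] [Nonempty α] (E : α → Prop) {θ : ℝ}
    (hθ : 0 < θ) (hθ2 : θ < 1 / 2) (hE : uniformProb E ≤ θ) (d : ℕ) :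
    uniformProb (fun ω : Fin (2 * d + 1) → α =>
      ¬ (Finset.univ.filter fun t => E (ω t)).card ≤ d) ≤
      (1 / 2 + 2 * θ * (1 - θ)) ^ (2 * d + 1) := by
  -- Each event contributes a factor `y`, its failure `y⁻¹`, so a majority of events makes the
  -- product at least `1`. With this `y` the mean of one factor is at most `1 / 2 + 2 * θ * (1 -
  -- θ)`, which is less than `1` for `θ < 1 / 2`.
  set y : ℝ := 1 / (2 * θ) with hy
  have hy1 : 1 < y := by rw [hy, lt_div_iff₀ (by positivity)]; linarith
  have hy0 : 0 < y := by linarith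
  have h1 : uniformProb (fun ω : Fin (2 * d + 1) → α =>
      ¬ (Finset.univ.filter fun t => E (ω t)).card ≤ d) ≤
      avg fun ω : Fin (2 * d + 1) → α => ∏ t, if E (ω t) then y else y⁻¹ := by
    refine uniformProb_le_avg (fun ω => Finset.prod_nonneg fun t _ => by
      split_ifs <;> positivity) fun ω h => ?_
    rw [Finset.prod_ite, Finset.prod_const, Finset.prod_const]
    have hsum := Finset.card_filter_add_card_filter_not (s := Finset.univ) fun t => E (ω t)
    rw [Finset.card_univ, Fintype.card_fin] at hsum
    set A := (Finset.univ.filter fun t => E (ω t)).card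
    set B := (Finset.univ.filter fun t => ¬ E (ω t)).card
    rw [inv_pow, ← div_eq_mul_inv, one_le_div (by positivity)]
    exact pow_le_pow_right₀ hy1.le (by omega)
  refine h1.trans ?_
  rw [avg_pi_prod (fun _ a => if E a then y else y⁻¹), Finset.prod_const, Finset.card_univ,
    Fintype.card_fin]
  refine pow_le_pow_left₀ (avg_nonneg fun a => by split_ifs <;> positivity) ?_ _
  have h2 : avg (fun a => if E a then y else y⁻¹) = (y - y⁻¹) * uniformProb E + y⁻¹ := by
    have h := avg_add (fun a => (y - y⁻¹) * if E a then 1 else 0) fun _ : α => y⁻¹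
    rw [avg_const, avg_const_mul, ← uniformProb_eq_avg] at h
    rw [← h]
    congr 1; funext a; split_ifs <;> ring
  rw [h2]
  have h3 : 0 ≤ y - y⁻¹ := by
    have := inv_le_one_of_one_le₀ hy1.le
    linarith
  calc _ ≤ (y - y⁻¹) * θ + y⁻¹ := by gcongr
    _ = _ := by rw [hy]; field_simp; ring

/-! ## Formulas of high value yield learnable distributions -/

section

variable {α β : Type*} [Fintype α] [Nonempty α]

open Classical in
theorem map_uniformOfFintype_toReal (f : α → β) (b : β) :
    (((PMF.uniformOfFintype α).map f) b).toReal = avg fun a => if f a = b then (1 : ℝ) else 0 := by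
  rw [PMF.map_apply, tsum_fintype, ENNReal.toReal_sum, avg, Finset.sum_div]
  · refine Finset.sum_congr rfl fun a _ => ?_
    by_cases h : f a = b
    · simp [h]
    · simp [h, Ne.symm h]
  · intro a _
    split_ifs <;> simp

variable [Fintype β]

theorem prob_map_uniformOfFintype (f : α → β) (E : β → Prop) :
    prob ((PMF.uniformOfFintype α).map f) E = uniformProb fun a => E (f a) := by
  classical
  simp only [prob, map_uniformOfFintype_toReal]
  rw [uniformProb_eq_avg, ← avg_sum]
  congr 1; funext a
  rw [Finset.sum_ite_eq]
  simp

/-- Independent samples from an image of the uniform distribution come from independent uniform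
coins; this links the success probability of the learner to the coins of the reduction. -/
theorem sum_prod_map_uniformOfFintype {ι : Type*} [Fintype ι] [DecidableEq ι] (f : α → β)
    (F : (ι → β) → ℝ) :
    ∑ S : ι → β, (∏ j, (((PMF.uniformOfFintype α).map f) (S j)).toReal) * F S =
      avg fun ω : ι → α => F fun j => f (ω j) := by
  classical
  simp only [map_uniformOfFintype_toReal]
  have h : ∀ S : ι → β, (∏ j, avg fun a => if f a = S j then (1 : ℝ) else 0) * F S =
      avg fun ω : ι → α => F S * ∏ j, if f (ω j) = S j then (1 : ℝ) else 0 := by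
    intro S
    rw [avg_const_mul, avg_pi_prod (fun j a => if f a = S j then (1 : ℝ) else 0), mul_comm]
  simp only [h, ← avg_sum]
  congr 1; funext ω
  rw [Finset.sum_eq_single fun j => f (ω j)]
  · simp
  · intro S _ hS
    obtain ⟨j, hj⟩ := Function.ne_iff.1 hS
    rw [Finset.prod_eq_zero (Finset.mem_univ j), mul_zero]
    rw [if_neg (Ne.symm hj)]
  · simp

end

/-- The distribution of the examples made from `J`. -/
noncomputable def exampleDist {n K m : ℕ} (d : ℕ) (J : Formula n K m) :
    PMF (Example (featureDim n K d)) :=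
  (PMF.uniformOfFintype (Block m K d)).map (blockExample J)

/-- A bound for the probability that an example violates the margin. -/
noncomputable def marginError (K d : ℕ) (θ : ℝ) : ℝ :=
  (2 * d + 1) * (2 * Real.exp (-((d : ℝ) ^ 2 / (2 * K)))) +
    (1 / 2 + 2 * θ * (1 - θ)) ^ (2 * d + 1)

theorem exists_valueAt_eq {n K m : ℕ} (J : Formula n K m) : ∃ ψ, valueAt J ψ = value J :=
  exists_eq_ciSup_of_finite

/-- The randomly signed literals of the chosen constraints rarely have a large sum. -/
theorem uniformProb_exists_literalSum_le {n K m : ℕ} (hm : 0 < m) (hK : 0 < K) (d : ℕ)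
    (J : Formula n K m) (ψ : Cube n) :
    uniformProb (fun x : BlockData m K d => ∃ t : Fin (2 * d + 1),
      ¬ |∑ i : Fin K, bsign ((x.2 t).2 i) *
        (((ψ ((J (pick hm (extendBits (x.2 t).1))).1 i) : ℤˣ) : ℤ) : ℝ)| ≤ d) ≤
      (2 * d + 1) * (2 * Real.exp (-((d : ℝ) ^ 2 / (2 * K)))) := by
  classical
  let bad : ((Fin m → Bool) × (Fin K → Bool)) → Prop := fun c =>
    ¬ |∑ i : Fin K, bsign (c.2 i) *
      (((ψ ((J (pick hm (extendBits c.1))).1 i) : ℤˣ) : ℤ) : ℝ)| ≤ d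
  change uniformProb (fun x : BlockData m K d => ∃ t : Fin (2 * d + 1), bad (x.2 t)) ≤ _
  have hb : uniformProb bad ≤ 2 * Real.exp (-((d : ℝ) ^ 2 / (2 * K))) := by
    rw [uniformProb_prod]
    -- Given the coins that choose the constraint, its variables are fixed and the remaining coins
    -- are Rademacher signs.
    refine avg_le_const fun g => ?_
    exact uniformProb_abs_rademacher_le hK
      (fun i => (((ψ ((J (pick hm (extendBits g))).1 i) : ℤˣ) : ℤ) : ℝ)) (fun i => by
        rcases Int.units_eq_one_or (ψ ((J (pick hm (extendBits g))).1 i)) with h | h <;>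
          simp [h]) d
  clear_value bad
  refine (uniformProb_exists_le (fun t (x : BlockData m K d) => bad (x.2 t))).trans ?_
  have h1 : ∀ t : Fin (2 * d + 1), uniformProb (fun x : BlockData m K d => bad (x.2 t)) =
      uniformProb bad := fun t => by
    rw [uniformProb_snd (α := Bool) fun y : ChunkData m K d => bad (y t)]
    exact uniformProb_pi_eval bad t
  simp only [h1, Finset.sum_const, Finset.card_univ, Fintype.card_fin, nsmul_eq_mul]
  push_cast
  gcongr

/-- A randomly chosen constraint is rarely violated. -/
theorem uniformProb_xorSign_pick_le {n K m : ℕ} {η : ℝ} (hm : 0 < m) (J : Formula n K m)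
    (ψ : Cube n) (hJ : 1 - η ≤ valueAt J ψ) :
    uniformProb (fun c : (Fin m → Bool) × (Fin K → Bool) =>
      xorSign ((J (pick hm (extendBits c.1))).apply ψ) ≠ 1) ≤ η * (1 + (m : ℝ) / 2 ^ m) := by
  classical
  have e := uniformProb_fst (α := Fin m → Bool) (β := Fin K → Bool)
    fun g => xorSign ((J (pick hm (extendBits g))).apply ψ) ≠ 1
  rw [e]
  have h := uniformProb_pick_mem_le hm
    (Finset.univ.filter fun j => xorSign ((J j).apply ψ) ≠ 1)
  simp only [Finset.mem_filter, Finset.mem_univ, true_and] at h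
  refine h.trans (mul_le_mul_of_nonneg_right ?_ (by positivity))
  have hc := Finset.card_filter_add_card_filter_not (s := Finset.univ)
    fun j => xorSign ((J j).apply ψ) = 1
  rw [Finset.card_univ, Fintype.card_fin] at hc
  rw [valueAt] at hJ
  have hm' : (0 : ℝ) < m := by exact_mod_cast hm
  rw [div_le_iff₀ hm']
  rw [le_div_iff₀ hm'] at hJ
  have hc' : (((Finset.univ.filter fun j => xorSign ((J j).apply ψ) = 1).card : ℕ) : ℝ) +
      ((Finset.univ.filter fun j => ¬ xorSign ((J j).apply ψ) = 1).card : ℕ) = m := by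
    exact_mod_cast hc
  have : ((Finset.univ.filter fun j => xorSign ((J j).apply ψ) ≠ 1).card : ℝ) ≤ η * m := by
    have e : ∀ (p : DecidablePred fun j => xorSign ((J j).apply ψ) = 1),
      (@Finset.filter _ (fun j => xorSign ((J j).apply ψ) = 1) p Finset.univ).card =
      (Finset.univ.filter fun j => xorSign ((J j).apply ψ) = 1).card := fun p => by congr!
    rw [e] at hJ
    linarith
  exact this

/-- For an optimal assignment the margin can fail only if some literal sum leaves `[-d, d]` or more
than `d` of the chosen constraints are violated. The two summands of `marginError` bound these
events. The gap between `η` and `θ` absorbs the bias of choosing an index modulo `m`. -/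
theorem almostRealizable_exampleDist {n K m d : ℕ} {η θ : ℝ} (hm : 0 < m) (hK : 0 < K)
    (hd : d ≤ n * K) (hθ : 0 < θ) (hθ2 : θ < 1 / 2) (hηθ : η * (1 + (m : ℝ) / 2 ^ m) ≤ θ)
    (J : Formula n K m) (hJ : 1 - η ≤ value J) :
    AlmostRealizableWithMargin (2 * (2 * d + 1) * (featureDim n K d : ℝ)) (marginError K d θ)
      (exampleDist d J) := by
  classical
  obtain ⟨ψ, hψ⟩ := exists_valueAt_eq J
  obtain ⟨w, hw, hmargin⟩ := exists_weights hm hd J ψ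
  refine ⟨w, hw, ?_⟩
  rw [exampleDist, prob_map_uniformOfFintype, ← uniformProb_equiv (blockEquiv m K d)]
  let unsat : ((Fin m → Bool) × (Fin K → Bool)) → Prop := fun c =>
    xorSign ((J (pick hm (extendBits c.1))).apply ψ) ≠ 1
  have hmono := uniformProb_mono (α := BlockData m K d)
    (E := fun x => (((blockExample J (blockEquiv m K d x)).2 : ℤ) : ℝ) *
      ∑ i, w i * ((((blockExample J (blockEquiv m K d x)).1 i : ℤˣ) : ℤ) : ℝ) ≤ 1)
    (F := fun x => (∃ t : Fin (2 * d + 1), ¬ |∑ i : Fin K, bsign ((x.2 t).2 i) *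
      (((ψ ((J (pick hm (extendBits (x.2 t).1))).1 i) : ℤˣ) : ℤ) : ℝ)| ≤ d) ∨
      ¬ (Finset.univ.filter fun t => unsat (x.2 t)).card ≤ d)
    (fun x hx => by
      by_contra hcon
      push Not at hcon
      obtain ⟨h1, h2⟩ := hcon
      refine absurd hx (not_le.2 (hmargin (extendBits (blockEquiv m K d x)) ?_ ?_))
      · intro t ht
        have := h1 ⟨t, ht⟩
        have e := pick_chunk_blockEquiv x hm ⟨t, ht⟩
        have e2 := chunk_blockEquiv_right x ⟨t, ht⟩
        simp only at e e2
        rw [literalSum, e]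
        simp only [e2]
        exact this
      · rw [Finset.card_filter, ← Fin.sum_univ_eq_sum_range (fun t =>
          if xorSign ((J (pick hm (chunk m K (extendBits (blockEquiv m K d x)) t))).apply ψ) ≠ 1
          then 1 else 0), ← Finset.card_filter]
        simp only [pick_chunk_blockEquiv]
        exact h2)
  refine hmono.trans ((uniformProb_or_le _ _).trans (add_le_add
    (uniformProb_exists_literalSum_le hm hK d J ψ) ?_))
  have hu : uniformProb unsat ≤ θ :=
    (uniformProb_xorSign_pick_le hm J ψ (hψ ▸ hJ)).trans hηθ
  clear hmono
  have := uniformProb_majority_le unsat hθ hθ2 hu d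
  rw [← uniformProb_snd (α := Bool)] at this
  refine le_trans (le_of_eq ?_) this
  congr!

/-! ## Rounds on formulas of high value -/

open Classical in
/-- An event of probability more than one half happens often. -/
theorem half_le_uniformProb_count {α : Type*} [Fintype α] [Nonempty α] (E : α → Prop) {N a : ℕ}
    (hN : 8 ≤ N) (hE : 1 / 2 + 1 / (N : ℝ) ^ a ≤ uniformProb E) :
    1 / 2 ≤ uniformProb fun T : Fin (N ^ (2 * a + 1)) → α =>
      N ^ (2 * a + 1) - (Finset.univ.filter fun k => E (T k)).card + N ^ (a + 1) ≤
        (Finset.univ.filter fun k => E (T k)).card := by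
  have hN' : (8 : ℝ) ≤ N := by exact_mod_cast hN
  let f : α → ℝ := fun β => if E β then 1 else 0
  have hf : 1 / 2 + 1 / (N : ℝ) ^ a ≤ avg f := by
    rwa [uniformProb_eq_avg] at hE
  -- Among `N ^ (2 * a + 1)` trials the mean exceeds one half by at least `N ^ (a + 1)`, twice what
  -- the test asks for. Failing the test is thus a deviation of at least `N ^ (a + 1) / 2`, of
  -- probability at most `4 / N`; this is where `8 ≤ N` is needed.
  have hch := uniformProb_sum_le (ι := Fin (N ^ (2 * a + 1))) (fun _ => f) (fun _ β => by
    simp only [f]; split_ifs <;> simp) (τ := N ^ (a + 1) / 2) (by positivity)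
  have hsum : ∀ T : Fin (N ^ (2 * a + 1)) → α, ∑ k, f (T k) =
      ((Finset.univ.filter fun k => E (T k)).card : ℝ) :=
    fun T => by simp [f]
  simp only [hsum, Finset.sum_const, Finset.card_univ, Fintype.card_fin, nsmul_eq_mul] at hch
  have hle : uniformProb (fun T : Fin (N ^ (2 * a + 1)) → α =>
      ¬ (N ^ (2 * a + 1) - (Finset.univ.filter fun k => E (T k)).card + N ^ (a + 1) ≤
        (Finset.univ.filter fun k => E (T k)).card)) ≤ 1 / 2 := by
    refine (uniformProb_mono fun T hT => ?_).trans (hch.trans ?_)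
    · have hcard : (Finset.univ.filter fun k => E (T k)).card ≤ N ^ (2 * a + 1) := by
        have := Finset.card_le_univ (Finset.univ.filter fun k => E (T k))
        rwa [Fintype.card_fin] at this
      set M := (Finset.univ.filter fun k => E (T k)).card
      have h1 : 2 * M < N ^ (2 * a + 1) + N ^ (a + 1) := by omega
      have h2 : 2 * (M : ℝ) < N ^ (2 * a + 1) + N ^ (a + 1) := by exact_mod_cast h1
      have h3 : ((N ^ (2 * a + 1) : ℕ) : ℝ) * (1 / 2 + 1 / (N : ℝ) ^ a) ≤
          ((N ^ (2 * a + 1) : ℕ) : ℝ) * avg f := by gcongr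
      have h4 : ((N ^ (2 * a + 1) : ℕ) : ℝ) * (1 / 2 + 1 / (N : ℝ) ^ a) =
          (N : ℝ) ^ (2 * a + 1) / 2 + N ^ (a + 1) := by
        push_cast
        field_simp
        ring
      rw [abs_sub_comm]
      refine le_trans ?_ (le_abs_self _)
      linarith
    · rw [div_le_iff₀ (by positivity)]
      push_cast
      have : ((N : ℝ) ^ (a + 1) / 2) ^ 2 = N * N ^ (2 * a + 1) / 4 := by ring
      rw [this]
      have h0 : (0 : ℝ) < (N : ℝ) ^ (2 * a + 1) := by positivity
      nlinarith
  rw [uniformProb_not] at hle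
  linarith

/-- A good classifier passes the test. -/
theorem half_le_uniformProb_matchCount {n K m d a : ℕ} (J : Formula n K m)
    (h : Cube (featureDim n K d) → ℤˣ) (hN : 8 ≤ featureDim n K d)
    (herr : err (exampleDist d J) h ≤ 1 / 2 - 1 / (featureDim n K d : ℝ) ^ a) :
    1 / 2 ≤ uniformProb fun T : Fin (featureDim n K d ^ (2 * a + 1)) → Block m K d =>
      featureDim n K d ^ (2 * a + 1) - matchCount J h T + featureDim n K d ^ (a + 1) ≤
        matchCount J h T := by
  rw [err, exampleDist, prob_map_uniformOfFintype, uniformProb_not] at herr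
  have := half_le_uniformProb_count (a := a)
    (fun β : Block m K d => h (blockExample J β).1 = (blockExample J β).2) hN (by linarith)
  convert this using 9 <;> (simp only [matchCount]; congr!)

theorem successProb_exampleDist (L : PolyTimeLearner) {n K m : ℕ} (d : ℕ) (J : Formula n K m)
    (ε : ℝ) : L.successProb (exampleDist d J) ε =
      uniformProb fun ω : (Fin (L.sampleSize.eval (featureDim n K d)) → Block m K d) ×
          (Fin (L.coins.eval (featureDim n K d)) → Bool) =>
        err (exampleDist d J) (L.hyp _ (fun j => blockExample J (ω.1 j)) ω.2) ≤ ε := by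
  rw [uniformProb_prod]
  exact sum_prod_map_uniformOfFintype (blockExample (d := d) J) fun S =>
    uniformProb fun r : Fin (L.coins.eval (featureDim n K d)) → Bool =>
      err (exampleDist d J) (L.hyp _ S r) ≤ ε

/-- The test coins are independent of the sample and of the coins of the learner, so for every good
classifier the test still passes with probability at least one half. -/
theorem half_successProb_le (L : PolyTimeLearner) {n K m d a : ℕ} (J : Formula n K m)
    (hN : 8 ≤ featureDim n K d) :
    L.successProb (exampleDist d J) (1 / 2 - 1 / (featureDim n K d : ℝ) ^ a) / 2 ≤
      uniformProb fun ω : RoundCoins L a n K m d => PassesWith L a J ω := by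
  classical
  rw [successProb_exampleDist, uniformProb_prod (fun ω => PassesWith L a J ω), uniformProb_eq_avg,
    div_eq_mul_inv, mul_comm, ← avg_const_mul]
  refine avg_mono fun ω => ?_
  split_ifs with h
  · simpa [PassesWith] using half_le_uniformProb_matchCount J _ hN h
  · simpa using uniformProb_nonneg _

/-- By independence, all `R` attempts fail with probability at most `(1 - p) ^ R`. -/
theorem le_uniformProb_exists_pi {α : Type*} [Fintype α] [Nonempty α] (E : α → Prop) {p : ℝ}
    (hp : p ≤ uniformProb E) {R : ℕ} (hR : (1 - p) ^ R ≤ 1 / 4) :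
    3 / 4 ≤ uniformProb fun ω : Fin R → α => ∃ ρ, E (ω ρ) := by
  have h1 := uniformProb_pi_forall (ι := Fin R) fun a => ¬ E a
  have h2 : uniformProb (fun ω : Fin R → α => ∀ ρ, ¬ E (ω ρ)) ≤ 1 / 4 := by
    rw [h1, uniformProb_not, Fintype.card_fin]
    refine le_trans ?_ hR
    refine pow_le_pow_left₀ ?_ (by linarith) _
    linarith [uniformProb_le_one E]
  have h3 : (fun ω : Fin R → α => ∃ ρ, E (ω ρ)) = fun ω => ¬ ∀ ρ, ¬ E (ω ρ) := by
    funext ω; simp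
  rw [h3, uniformProb_not]
  linarith

/-! ## Random formulas yield random labels -/

open Classical in
/-- Random labels cannot be guessed. -/
theorem uniformProb_guess_le {N a : ℕ} (hN : 0 < N) (H : Fin (N ^ (2 * a + 1)) → ℤˣ) :
    uniformProb (fun y : Fin (N ^ (2 * a + 1)) → Bool =>
      N ^ (2 * a + 1) - (Finset.univ.filter fun k => H k = toSign (y k)).card + N ^ (a + 1) ≤
        (Finset.univ.filter fun k => H k = toSign (y k)).card) ≤ 4 / N := by
  have hN' : (0 : ℝ) < N := by exact_mod_cast hN
  -- Whatever the guesses `H`, the mean number of matches is exactly half the number of trials, so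
  -- passing requires a deviation of `N ^ (a + 1) / 2`.
  have hch := uniformProb_sum_le (ι := Fin (N ^ (2 * a + 1)))
    (fun k b => if H k = toSign b then (1 : ℝ) else 0) (fun _ β => by
    split_ifs <;> simp) (τ := N ^ (a + 1) / 2) (by positivity)
  have havg : ∀ k, avg (fun b => if H k = toSign b then (1 : ℝ) else 0) = 1 / 2 := fun k => by
    rw [avg_bool]
    rcases Int.units_eq_one_or (H k) with h | h <;> simp [h, toSign]
  have hsum : ∀ y : Fin (N ^ (2 * a + 1)) → Bool,
      ∑ k, (if H k = toSign (y k) then (1 : ℝ) else 0) =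
      ((Finset.univ.filter fun k => H k = toSign (y k)).card : ℝ) :=
    fun y => by simp
  simp only [hsum, havg, Finset.sum_const, Finset.card_univ, Fintype.card_fin, nsmul_eq_mul] at hch
  refine (uniformProb_mono fun y hy => ?_).trans (hch.trans (le_of_eq ?_))
  · have hcard : (Finset.univ.filter fun k => H k = toSign (y k)).card ≤ N ^ (2 * a + 1) := by
      have := Finset.card_le_univ (Finset.univ.filter fun k => H k = toSign (y k))
      rwa [Fintype.card_fin] at this
    set M := (Finset.univ.filter fun k => H k = toSign (y k)).card
    have h1 : N ^ (2 * a + 1) + N ^ (a + 1) ≤ 2 * M := by omega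
    have h2 : (N : ℝ) ^ (2 * a + 1) + N ^ (a + 1) ≤ 2 * M := by exact_mod_cast h1
    refine le_trans ?_ (le_abs_self _)
    push_cast
    linarith
  · push_cast
    field_simp
    ring

/-- Multiply the first literal of a tuple by the sign given by `b`. -/
def signFirst {n K : ℕ} (hK : 0 < K) (b : Bool) (C : KTuple n K) : KTuple n K :=
  (C.1, Function.update C.2 ⟨0, hK⟩ (toSign b * C.2 ⟨0, hK⟩))

theorem toSign_mul_self (b : Bool) : toSign b * toSign b = 1 := by cases b <;> decide

theorem signFirst_signFirst {n K : ℕ} (hK : 0 < K) (b : Bool) (C : KTuple n K) :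
    signFirst hK b (signFirst hK b C) = C := by
  simp only [signFirst, Function.update_self, Function.update_idem, ← mul_assoc, toSign_mul_self,
    one_mul, Function.update_eq_self]

theorem signBit_toSign_mul (b : Bool) (u : ℤˣ) : signBit (toSign b * u) = (b == signBit u) := by
  rcases Int.units_eq_one_or u with rfl | rfl <;> cases b <;> decide

theorem parity_beq_first {f g : ℕ → Bool} {b : Bool} {k : ℕ} (hk : 0 < k)
    (h0 : g 0 = (b == f 0)) (h : ∀ i < k, 0 < i → g i = f i) :
    parity g k = (b == parity f k) := by
  induction k with
  | zero => omega
  | succ k ih =>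
    rcases Nat.eq_zero_or_pos k with rfl | hk'
    · simp [parity, h0]
    · rw [parity, parity, ih hk' fun i hi => h i (by omega), h k (by omega) hk']
      cases b <;> cases parity f k <;> cases f k <;> rfl

/-- The label enters the features only through their common sign, where it multiplies the product of
the literal signs. It can therefore be absorbed into the sign of the first literal. -/
theorem constraintBits_signFirst {n K m d : ℕ} (hm : 0 < m) (hK : 0 < K) (J J' : Formula n K m)
    (b : Bool) (χ : ℕ → Bool) (h : J' (pick hm χ) = signFirst hK b (J (pick hm χ))) :
    constraintBits n K m d (encodeFormula J) b χ =
      constraintBits n K m d (encodeFormula J') true χ := by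
  set j := pick hm χ with hj
  have hjv : pickIndex m χ = (j : ℕ) := rfl
  rw [constraintBits, constraintBits, hjv]
  congr 1
  · rw [literalVector, literalVector]
    congr 1
    refine flatMap_range_congr fun i hi => ?_
    have h1 := litVar_encodeFormula J j ⟨i, hi⟩
    have h2 := litVar_encodeFormula J' j ⟨i, hi⟩
    simp only at h1 h2
    rw [h1, h2, h]; rfl
  · have hpar := parity_beq_first (b := b) (k := K)
      (f := fun i => litSign (encodeFormula J) ((j : ℕ) * K + i) == χ (m + i))
      (g := fun i => litSign (encodeFormula J') ((j : ℕ) * K + i) == χ (m + i)) hK ?_ ?_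
    · rw [hpar]; simp
    · have h1 := litSign_encodeFormula J j ⟨0, hK⟩
      have h2 := litSign_encodeFormula J' j ⟨0, hK⟩
      simp only at h1 h2
      simp only [h1, h2, h, signFirst, Function.update_self, signBit_toSign_mul]
      cases b <;> cases signBit ((J j).2 ⟨0, hK⟩) <;> cases χ (m + 0) <;> rfl
    · intro i hi hi0
      have h1 := litSign_encodeFormula J j ⟨i, hi⟩
      have h2 := litSign_encodeFormula J' j ⟨i, hi⟩
      simp only at h1 h2
      simp only [h1, h2, h, signFirst]
      rw [Function.update_of_ne]
      intro he
      have := congrArg Fin.val he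
      simp only at this
      omega

theorem blockExample_snd {n K m d : ℕ} (J : Formula n K m) (b : Bool) (c : ChunkData m K d) :
    (blockExample J (blockEquiv m K d (b, c))).2 = toSign b := by
  change toSign _ = _
  rw [extendBits_blockEquiv_zero]

theorem blockExample_fst_signFirst {n K m d : ℕ} (hm : 0 < m) (hK : 0 < K) (J J' : Formula n K m)
    (b : Bool) (c : ChunkData m K d)
    (h : ∀ t, J' (pick hm (extendBits (c t).1)) =
      signFirst hK b (J (pick hm (extendBits (c t).1)))) :
    (blockExample J (blockEquiv m K d (b, c))).1 =
      (blockExample J' (blockEquiv m K d (true, c))).1 := by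
  have key : exampleBits n K m d (encodeFormula J) (extendBits (blockEquiv m K d (b, c))) =
      exampleBits n K m d (encodeFormula J') (extendBits (blockEquiv m K d (true, c))) := by
    rw [exampleBits, exampleBits, extendBits_blockEquiv_zero, extendBits_blockEquiv_zero]
    refine flatMap_range_congr fun t ht => ?_
    have e : ∀ k < m + K, chunk m K (extendBits (blockEquiv m K d (true, c))) t k =
        chunk m K (extendBits (blockEquiv m K d (b, c))) t k := by
      intro k hk
      rcases lt_or_ge k m with hkm | hkm
      · have h1 := chunk_blockEquiv_left (true, c) ⟨t, ht⟩ ⟨k, hkm⟩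
        have h2 := chunk_blockEquiv_left (b, c) ⟨t, ht⟩ ⟨k, hkm⟩
        exact h1.trans h2.symm
      · obtain ⟨i, rfl⟩ := Nat.exists_eq_add_of_le hkm
        have h1 := chunk_blockEquiv_right (true, c) ⟨t, ht⟩ ⟨i, by omega⟩
        have h2 := chunk_blockEquiv_right (b, c) ⟨t, ht⟩ ⟨i, by omega⟩
        exact h1.trans h2.symm
    refine Eq.trans ?_ (constraintBits_congr e).symm
    refine constraintBits_signFirst hm hK J J' b _ ?_
    have hp := pick_chunk_blockEquiv (b, c) hm ⟨t, ht⟩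
    simp only at hp
    change J' (pick hm (chunk m K (extendBits (blockEquiv m K d (b, c))) t)) =
      signFirst hK b (J (pick hm (chunk m K (extendBits (blockEquiv m K d (b, c))) t)))
    rw [hp]
    exact h ⟨t, ht⟩
  funext p
  change toSign _ = toSign _
  rw [key]

/-! ### Collisions -/

section

variable {ι : Type*} {m K d : ℕ} (hm : 0 < m)

/-- Two different examples use the same constraint. -/
def Collision (c : ι → ChunkData m K d) : Prop :=
  ∃ e e' t t', e ≠ e' ∧ pick hm (extendBits (c e t).1) = pick hm (extendBits (c e' t').1)

theorem uniformProb_pick_eq_le_two_div (j : Fin m) :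
    uniformProb (fun g : Fin m → Bool => pick hm (extendBits g) = j) ≤ 2 / m := by
  have h : (m : ℝ) / 2 ^ m ≤ 1 := by
    rw [div_le_one (by positivity)]
    exact_mod_cast Nat.lt_two_pow_self.le
  refine (uniformProb_pick_eq_le hm j).trans ?_
  gcongr
  linarith

theorem uniformProb_chunk_pick_eq (j : Fin m) (t : Fin (2 * d + 1)) :
    uniformProb (fun c : ChunkData m K d => pick hm (extendBits (c t).1) = j) =
      uniformProb fun g : Fin m → Bool => pick hm (extendBits g) = j := by
  rw [← uniformProb_fst (α := Fin m → Bool) (β := Fin K → Bool)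
    fun g => pick hm (extendBits g) = j]
  exact uniformProb_pi_eval (fun c : (Fin m → Bool) × (Fin K → Bool) =>
    pick hm (extendBits c.1) = j) t

/-- Union bound over pairs of choices. Choices of different examples are independent and none takes
a given value with probability above `2 / m`, so two of them agree with probability at most `2 / m`.
-/
theorem uniformProb_collision_le [Fintype ι] [DecidableEq ι] :
    uniformProb (fun c : ι → ChunkData m K d => Collision hm c) ≤
      (Fintype.card ι * (2 * d + 1)) ^ 2 * (2 / m) := by
  classical
  have hmono := uniformProb_mono (α := ι → ChunkData m K d) (E := fun c => Collision hm c)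
    (F := fun c => ∃ z : (ι × ι) × (Fin (2 * d + 1) × Fin (2 * d + 1)), z.1.1 ≠ z.1.2 ∧
      pick hm (extendBits (c z.1.1 z.2.1).1) = pick hm (extendBits (c z.1.2 z.2.2).1))
    (fun c ⟨e, e', t, t', h⟩ => ⟨((e, e'), (t, t')), h⟩)
  refine hmono.trans ((uniformProb_exists_le _).trans ?_)
  refine (Finset.sum_le_card_nsmul _ _ (2 / (m : ℝ)) fun z _ => ?_).trans (le_of_eq ?_)
  · obtain ⟨⟨e, e'⟩, t, t'⟩ := z
    by_cases hee : e = e'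
    · simp only [hee, ne_eq, not_true_eq_false, false_and]
      rw [uniformProb]
      simp only [Finset.filter_false, Finset.card_empty, Nat.cast_zero, zero_div]
      positivity
    · have h1 : uniformProb (fun c : ι → ChunkData m K d => e ≠ e' ∧
          pick hm (extendBits (c e t).1) = pick hm (extendBits (c e' t').1)) ≤
          ∑ j : Fin m, avg fun c : ι → ChunkData m K d =>
            (if pick hm (extendBits (c e t).1) = j then (1 : ℝ) else 0) *
            (if pick hm (extendBits (c e' t').1) = j then (1 : ℝ) else 0) := by
        rw [← avg_sum]
        refine uniformProb_le_avg (fun c => Finset.sum_nonneg fun j _ => by positivity) ?_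
        rintro c ⟨-, h⟩
        simp [h]
      refine h1.trans ?_
      have h2 : ∀ j : Fin m, (avg fun c : ι → ChunkData m K d =>
            (if pick hm (extendBits (c e t).1) = j then (1 : ℝ) else 0) *
            (if pick hm (extendBits (c e' t').1) = j then (1 : ℝ) else 0)) ≤
          2 / m * avg fun c : ChunkData m K d =>
            if pick hm (extendBits (c t').1) = j then (1 : ℝ) else 0 := by
        intro j
        rw [avg_pi_eval_mul
          (fun c : ChunkData m K d => if pick hm (extendBits (c t).1) = j then (1 : ℝ) else 0)
          (fun c : ChunkData m K d => if pick hm (extendBits (c t').1) = j then (1 : ℝ) else 0) hee]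
        refine mul_le_mul_of_nonneg_right ?_ (avg_nonneg fun c => by positivity)
        refine le_trans (le_of_eq ?_)
          ((uniformProb_chunk_pick_eq (K := K) hm j t).le.trans (uniformProb_pick_eq_le_two_div hm j))
        rw [uniformProb_eq_avg]
        congr!
      refine (Finset.sum_le_sum fun j _ => h2 j).trans ?_
      rw [← Finset.mul_sum, ← avg_sum]
      simp [avg_const]
  · simp only [Finset.card_univ, Fintype.card_prod, Fintype.card_fin, nsmul_eq_mul]
    push_cast
    ring

open Classical in
/-- Multiply the first literal of every constraint used by an example by the label of that
example. -/
noncomputable def signFormula {n : ℕ} (hK : 0 < K) (c : ι → ChunkData m K d) (y : ι → Bool)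
    (J : Formula n K m) : Formula n K m := fun j =>
  if h : ∃ e t, pick hm (extendBits (c e t).1) = j then signFirst hK (y h.choose) (J j) else J j

/-- The example assigned to a constraint depends on `c` but not on `J`, so the same sign is applied
twice. This holds even with collisions. -/
theorem signFormula_signFormula {n : ℕ} (hK : 0 < K) (c : ι → ChunkData m K d) (y : ι → Bool)
    (J : Formula n K m) : signFormula hm hK c y (signFormula hm hK c y J) = J := by
  funext j
  simp only [signFormula]
  split_ifs with h
  · exact signFirst_signFirst hK _ _
  · rfl

/-- Without collisions only one example uses the constraint, so the arbitrary choice in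
`signFormula` must return it. -/
theorem signFormula_pick {n : ℕ} (hK : 0 < K) {c : ι → ChunkData m K d} (hc : ¬ Collision hm c)
    (y : ι → Bool) (J : Formula n K m) (e : ι) (t : Fin (2 * d + 1)) :
    signFormula hm hK c y J (pick hm (extendBits (c e t).1)) =
      signFirst hK (y e) (J (pick hm (extendBits (c e t).1))) := by
  have h : ∃ e' t', pick hm (extendBits (c e' t').1) = pick hm (extendBits (c e t).1) := ⟨e, t, rfl⟩
  rw [signFormula, dif_pos h]
  congr 2
  by_contra hne
  obtain ⟨t', ht'⟩ := h.choose_spec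
  exact hc ⟨_, _, _, _, hne, ht'⟩

end

/-! ### Rounds on random formulas -/

/-- The examples of one round. -/
abbrev RoundExample (L : PolyTimeLearner) (a n K d : ℕ) : Type :=
  Fin (L.sampleSize.eval (featureDim n K d)) ⊕ Fin (featureDim n K d ^ (2 * a + 1))

/-- The coins of a round, separated into the coins of the learner, the coins for the constraints,
and the labels. -/
noncomputable def roundEquiv (L : PolyTimeLearner) (a n K m d : ℕ) :
    (((Fin (L.coins.eval (featureDim n K d)) → Bool) ×
      (RoundExample L a n K d → ChunkData m K d)) ×
      ((Fin (L.sampleSize.eval (featureDim n K d)) → Bool) ×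
        (Fin (featureDim n K d ^ (2 * a + 1)) → Bool))) ≃ RoundCoins L a n K m d where
  toFun z := ((fun j => blockEquiv m K d (z.2.1 j, z.1.2 (.inl j)), z.1.1),
    fun k => blockEquiv m K d (z.2.2 k, z.1.2 (.inr k)))
  invFun ω := ((ω.1.2, Sum.elim (fun j => ((blockEquiv m K d).symm (ω.1.1 j)).2)
    (fun k => ((blockEquiv m K d).symm (ω.2 k)).2)),
    (fun j => ((blockEquiv m K d).symm (ω.1.1 j)).1),
    fun k => ((blockEquiv m K d).symm (ω.2 k)).1)
  left_inv z := by
    obtain ⟨⟨r, c⟩, y, y'⟩ := z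
    simp only [Equiv.symm_apply_apply, Prod.mk.injEq, true_and, and_true]
    funext e
    cases e <;> rfl
  right_inv ω := by simp

/-- For fixed labels `y`, `signFormula` permutes the formulas, so in the average over `J` the signed
formula may be replaced by `J` itself. The features are then those of label `true`, whatever `y` is.
Given `J` and the training labels, classifier and test points are fixed, and the test labels are
fair coins. -/
theorem avg_uniformProb_labels_le (L : PolyTimeLearner) {a n K m d : ℕ} (hm : 0 < m) (hK : 0 < K)
    (hN : 0 < featureDim n K d) [Nonempty (Formula n K m)]
    (r : Fin (L.coins.eval (featureDim n K d)) → Bool)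
    (c : RoundExample L a n K d → ChunkData m K d) (hc : ¬ Collision hm c) :
    (avg fun J : Formula n K m => uniformProb fun y => PassesWith L a J
      (roundEquiv L a n K m d ((r, c), y))) ≤ 4 / (featureDim n K d : ℝ) := by
  classical
  let X : Formula n K m → RoundExample L a n K d → Cube (featureDim n K d) := fun J e =>
    (blockExample J (blockEquiv m K d (true, c e))).1
  let hyp : Formula n K m → (Fin (L.sampleSize.eval (featureDim n K d)) → Bool) →
      Cube (featureDim n K d) → ℤˣ := fun J y =>
    L.hyp _ (fun j => (X J (.inl j), toSign (y j))) r
  let G : Formula n K m → (Fin (L.sampleSize.eval (featureDim n K d)) → Bool) ×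
      (Fin (featureDim n K d ^ (2 * a + 1)) → Bool) → Prop := fun J y =>
    featureDim n K d ^ (2 * a + 1) -
        (Finset.univ.filter fun k => hyp J y.1 (X J (.inr k)) = toSign (y.2 k)).card +
        featureDim n K d ^ (a + 1) ≤
      (Finset.univ.filter fun k => hyp J y.1 (X J (.inr k)) = toSign (y.2 k)).card
  let Φ : ((Fin (L.sampleSize.eval (featureDim n K d)) → Bool) ×
      (Fin (featureDim n K d ^ (2 * a + 1)) → Bool)) → Formula n K m ≃ Formula n K m := fun y =>
    Function.Involutive.toPerm (signFormula hm hK c (Sum.elim y.1 y.2))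
      (signFormula_signFormula hm hK c _)
  have hX : ∀ J y e, (blockExample J (blockEquiv m K d (Sum.elim y.1 y.2 e, c e))).1 =
      X (Φ y J) e := fun J y e =>
    blockExample_fst_signFirst hm hK J _ _ _ fun t => signFormula_pick hm hK hc _ J e t
  have hS : ∀ J y j, blockExample J (blockEquiv m K d (y.1 j, c (.inl j))) =
      (X (Φ y J) (.inl j), toSign (y.1 j)) := fun J y j =>
    Prod.ext (hX J y (.inl j)) (blockExample_snd J _ _)
  have hT : ∀ J y k, blockExample J (blockEquiv m K d (y.2 k, c (.inr k))) =
      (X (Φ y J) (.inr k), toSign (y.2 k)) := fun J y k =>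
    Prod.ext (hX J y (.inr k)) (blockExample_snd J _ _)
  have hpass : ∀ J y, PassesWith L a J (roundEquiv L a n K m d ((r, c), y)) = G (Φ y J) y := by
    intro J y
    simp only [PassesWith, matchCount, roundEquiv, Equiv.coe_fn_mk, hS, hT, G, hyp]
  simp only [hpass]
  -- The labels are fixed before averaging over `J`, since the permutation `Φ y` depends on them.
  -- After the substitution the order is exchanged back.
  rw [avg_uniformProb_comm]
  have hΦ : ∀ y, (uniformProb fun J => G (Φ y J) y) = uniformProb fun J => G J y := fun y =>
    uniformProb_equiv (Φ y) fun J => G J y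
  simp only [hΦ]
  rw [avg_uniformProb_comm]
  refine avg_le_const fun J => ?_
  rw [uniformProb_prod]
  exact avg_le_const fun y => uniformProb_guess_le hN fun k => hyp J y (X J (.inr k))

/-- The probability that a round passes on a random formula. -/
noncomputable def roundError (L : PolyTimeLearner) (a n K m d : ℕ) : ℝ :=
  (((L.sampleSize.eval (featureDim n K d) + featureDim n K d ^ (2 * a + 1) : ℕ) : ℝ) *
    (2 * d + 1)) ^ 2 * (2 / m) + 4 / (featureDim n K d : ℝ)

/-- Whether a collision occurs depends on the coins alone and not on the formula, so one can split
on it before averaging over formulas. -/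
theorem avg_uniformProb_passesWith_le (L : PolyTimeLearner) {a n K m d : ℕ} (hm : 0 < m)
    (hK : 0 < K) (hN : 0 < featureDim n K d) [Nonempty (Formula n K m)] :
    (avg fun J : Formula n K m => uniformProb fun ω : RoundCoins L a n K m d => PassesWith L a J ω) ≤
      roundError L a n K m d := by
  classical
  have h1 : ∀ J : Formula n K m, (uniformProb fun ω : RoundCoins L a n K m d => PassesWith L a J ω) ≤
      avg fun z : (Fin (L.coins.eval (featureDim n K d)) → Bool) ×
        (RoundExample L a n K d → ChunkData m K d) => (if Collision hm z.2 then (1 : ℝ) else 0) +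
          if Collision hm z.2 then 0 else
            uniformProb fun y => PassesWith L a J (roundEquiv L a n K m d (z, y)) := by
    intro J
    rw [← uniformProb_equiv (roundEquiv L a n K m d), uniformProb_prod]
    refine avg_mono fun z => ?_
    split_ifs with h
    · simpa using uniformProb_le_one _
    · simp
  refine (avg_mono h1).trans ?_
  rw [avg_comm]
  simp only [avg_add, avg_const]
  refine add_le_add ?_ (avg_le_const fun z => ?_)
  · have := uniformProb_collision_le (ι := RoundExample L a n K d) (K := K) (d := d) hm
    rw [Fintype.card_sum, Fintype.card_fin, Fintype.card_fin, uniformProb_eq_avg] at this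
    rw [avg_snd (fun c : RoundExample L a n K d → ChunkData m K d =>
      if Collision hm c then (1 : ℝ) else 0)]
    exact this
  · split_ifs with h
    · rw [avg_const]; positivity
    · exact avg_uniformProb_labels_le L hm hK hN z.1 z.2 h

theorem uniformProb_exists_pi_le {α : Type*} [Fintype α] [Nonempty α] (E : α → Prop) (R : ℕ) :
    (uniformProb fun ω : Fin R → α => ∃ ρ, E (ω ρ)) ≤ R * uniformProb E := by
  classical
  refine (uniformProb_exists_le fun ρ (ω : Fin R → α) => E (ω ρ)).trans (le_of_eq ?_)
  simp [uniformProb_pi_eval]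

/-- On most formulas, no round passes with probability at least `3/4`. -/
theorem le_uniformProb_formula (L : PolyTimeLearner) {a n K m d : ℕ} (R : ℕ) (hm : 0 < m)
    (hK : 0 < K) (hN : 0 < featureDim n K d) [Nonempty (Formula n K m)] :
    1 - 4 * (R * roundError L a n K m d) ≤ uniformProb fun J : Formula n K m =>
      3 / 4 ≤ 1 - uniformProb fun ω : Fin R → RoundCoins L a n K m d =>
        ∃ ρ, PassesWith L a J (ω ρ) := by
  have h1 := uniformProb_le_avg_div (t := 1 / 4)
    (f := fun J : Formula n K m => uniformProb fun ω : Fin R → RoundCoins L a n K m d =>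
        ∃ ρ, PassesWith L a J (ω ρ)) (fun J => uniformProb_nonneg _) (by norm_num)
  have h2 := avg_mono fun J : Formula n K m =>
    uniformProb_exists_pi_le (fun ω : RoundCoins L a n K m d => PassesWith L a J ω) R
  rw [avg_const_mul] at h2
  have h3 := avg_uniformProb_passesWith_le L (a := a) hm hK hN
  have h4 := h2.trans (mul_le_mul_of_nonneg_left h3 (Nat.cast_nonneg R))
  set Q : Formula n K m → ℝ := fun J => uniformProb fun ω : Fin R → RoundCoins L a n K m d =>
        ∃ ρ, PassesWith L a J (ω ρ)
  have h5 : uniformProb (fun J => ¬ 1 / 4 ≤ Q J) ≤ uniformProb fun J => 3 / 4 ≤ 1 - Q J :=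
    uniformProb_mono fun J h => by push Not at h; linarith
  rw [uniformProb_not] at h5
  have h6 : avg Q / (1 / 4) ≤ 4 * (R * roundError L a n K m d) := by
    rw [div_le_iff₀ (by norm_num)]; linarith
  linarith

/-! ## From learning to refutation -/

theorem Polynomial.eventually_eval_le_pow (p : Polynomial ℕ) :
    ∃ k, ∀ᶠ N : ℕ in atTop, p.eval N ≤ N ^ k := by
  refine ⟨p.natDegree + 1, ?_⟩
  filter_upwards [eventually_ge_atTop (max 1 (p.eval 1))] with N hN
  have h1 : 1 ≤ N := (le_max_left _ _).trans hN
  rw [Polynomial.eval_eq_sum_range] at hN ⊢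
  simp only [one_pow, mul_one] at hN
  calc ∑ i ∈ Finset.range (p.natDegree + 1), p.coeff i * N ^ i
      ≤ ∑ i ∈ Finset.range (p.natDegree + 1), p.coeff i * N ^ p.natDegree := by
        gcongr with i hi
        exact Nat.lt_succ_iff.1 (Finset.mem_range.1 hi)
    _ = (∑ i ∈ Finset.range (p.natDegree + 1), p.coeff i) * N ^ p.natDegree := by
        rw [Finset.sum_mul]
    _ ≤ N * N ^ p.natDegree := by gcongr; exact (le_max_right _ _).trans hN
    _ = _ := (pow_succ' _ _).symm

theorem AlmostRealizableWithMargin.mono {n : ℕ} {B B' ε ε' : ℝ} {D : PMF (Example n)}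
    (h : AlmostRealizableWithMargin B ε D) (hB : B ≤ B') (hε : ε ≤ ε') :
    AlmostRealizableWithMargin B' ε' D := by
  obtain ⟨w, hw, hp⟩ := h
  exact ⟨w, hw.trans hB, hp.trans hε⟩

theorem two_mul_add_one_le_featureDim (n K d : ℕ) : 2 * d + 1 ≤ featureDim n K d := by
  rw [featureDim]
  exact Nat.le_mul_of_pos_right _ (pow_pos (by rw [width]; omega) _)

theorem le_featureDim {n K d : ℕ} (hK : 0 < K) (hd : 0 < d) : n ≤ featureDim n K d := by
  have h1 : n ≤ width n K := by
    rw [width]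
    nlinarith
  have h2 : width n K ≤ width n K ^ (2 * d) := Nat.le_self_pow (by omega) _
  rw [featureDim]
  calc n ≤ width n K ^ (2 * d) := h1.trans h2
    _ ≤ _ := Nat.le_mul_of_pos_left _ (by omega)

theorem almostRealizable_two_mul_sq {n K m d : ℕ} {η θ : ℝ} (hm : 0 < m) (hK : 0 < K)
    (hd : d ≤ n * K) (hθ : 0 < θ) (hθ2 : θ < 1 / 2) (hηθ : η * (1 + (m : ℝ) / 2 ^ m) ≤ θ)
    (J : Formula n K m) (hJ : 1 - η ≤ value J) :
    AlmostRealizableWithMargin (2 * (featureDim n K d : ℝ) ^ 2) (marginError K d θ)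
      (exampleDist d J) := by
  refine (almostRealizable_exampleDist hm hK hd hθ hθ2 hηθ J hJ).mono ?_ le_rfl
  have : (2 * d + 1 : ℝ) ≤ featureDim n K d := by
    exact_mod_cast two_mul_add_one_le_featureDim n K d
  have h0 : (0 : ℝ) ≤ featureDim n K d := Nat.cast_nonneg _
  nlinarith

instance {n K m : ℕ} [h : Fact (K ≤ n)] : Nonempty (Formula n K m) :=
  ⟨fun _ => (Fin.castLEEmb h.out, fun _ => 1)⟩

/-- Sample and test together contain at most `N ^ (k + (2 * a + 1) + 1)` examples, each choosing `2
* d + 1 ≤ N` constraints. The exponent required of `m` is twice the resulting one plus `2`, so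
collisions have probability at most `2 / N ^ 2 ≤ 1 / N`. -/
theorem roundError_le (L : PolyTimeLearner) (a k : ℕ) {n K m d : ℕ}
    (hN : 8 ≤ featureDim n K d)
    (hk : L.sampleSize.eval (featureDim n K d) ≤ featureDim n K d ^ k)
    (hm : featureDim n K d ^ (2 * (k + (2 * a + 1) + 2) + 2) ≤ m) :
    roundError L a n K m d ≤ 5 / (featureDim n K d : ℝ) := by
  set N := featureDim n K d with hNdef
  have hN1 : 1 ≤ N := by omega
  have hA : L.sampleSize.eval N + N ^ (2 * a + 1) ≤ N ^ (k + (2 * a + 1) + 1) := by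
    have h1 : N ^ k ≤ N ^ (k + (2 * a + 1)) := Nat.pow_le_pow_right hN1 (by omega)
    have h2 : N ^ (2 * a + 1) ≤ N ^ (k + (2 * a + 1)) := Nat.pow_le_pow_right hN1 (by omega)
    calc _ ≤ 2 * N ^ (k + (2 * a + 1)) := by omega
      _ ≤ N * N ^ (k + (2 * a + 1)) := Nat.mul_le_mul_right _ (by omega)
      _ = _ := (pow_succ' _ _).symm
  have hB : (L.sampleSize.eval N + N ^ (2 * a + 1)) * (2 * d + 1) ≤
      N ^ (k + (2 * a + 1) + 2) := by
    calc _ ≤ N ^ (k + (2 * a + 1) + 1) * N :=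
          Nat.mul_le_mul hA (two_mul_add_one_le_featureDim n K d)
      _ = _ := (pow_succ _ _).symm
  have hB' : ((L.sampleSize.eval N + N ^ (2 * a + 1) : ℕ) : ℝ) * (2 * d + 1) ≤
      (N : ℝ) ^ (k + (2 * a + 1) + 2) := by exact_mod_cast hB
  have hm' : (N : ℝ) ^ (2 * (k + (2 * a + 1) + 2) + 2) ≤ m := by exact_mod_cast hm
  have hN' : (8 : ℝ) ≤ N := by exact_mod_cast hN
  have hmpos : (0 : ℝ) < m := lt_of_lt_of_le (by positivity) hm'
  rw [roundError]
  have h3 : (((L.sampleSize.eval N + N ^ (2 * a + 1) : ℕ) : ℝ) * (2 * d + 1)) ^ 2 * (2 / m) ≤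
      1 / N := by
    calc _ ≤ ((N : ℝ) ^ (k + (2 * a + 1) + 2)) ^ 2 *
          (2 / (N : ℝ) ^ (2 * (k + (2 * a + 1) + 2) + 2)) := by gcongr
      _ = 2 / N ^ 2 := by
          rw [pow_add _ (2 * _) 2, pow_mul']
          field_simp
      _ ≤ 1 / N := by
          rw [div_le_div_iff₀ (by positivity) (by positivity)]
          nlinarith
  have h4 : (5 : ℝ) / N = 1 / N + 4 / N := by ring
  rw [h4]
  linarith

/-- A learner yields a refutation algorithm for parameters `K`, `m` if there is a computable `d`
for which the examples made from satisfiable formulas belong to the family, and `m` is a large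
power of the dimension of these examples. -/
theorem xorEasy_of_nonTrivialOn (L : PolyTimeLearner) {F : (n : ℕ) → PMF (Example n) → Prop}
    (hL : L.NonTrivialOn F) : ∃ C : ℕ, ∀ (K m d : ℕ → ℕ) (η θ : ℝ), 0 < η → η < θ → θ < 1 / 2 →
      PolyFun (I := ℕ) [unary] (fun n => unary (d n)) →
      (∀ᶠ n in atTop, 0 < K n ∧ K n ≤ n ∧ 0 < d n ∧ d n ≤ n * K n ∧
        featureDim n (K n) (d n) ^ C ≤ m n) →
      (∀ᶠ n in atTop, ∀ D : PMF (Example (featureDim n (K n) (d n))),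
        AlmostRealizableWithMargin (2 * (featureDim n (K n) (d n) : ℝ) ^ 2)
          (marginError (K n) (d n) θ) D → F _ D) →
      XorEasy K m η := by
  obtain ⟨c, δ, hc, hδ, hL⟩ := hL
  obtain ⟨a, ha⟩ := exists_nat_ge c
  obtain ⟨k, hk⟩ := L.sampleSize.eventually_eval_le_pow
  set δ' := min δ 1 with hδ'
  have hδ'0 : 0 < δ' := by positivity
  have hδ'1 : δ' ≤ 1 := min_le_right _ _
  -- One round succeeds on formulas of high value with probability at least `δ' / 2`: the learner
  -- succeeds, then the test passes. A constant number of rounds suffices.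
  obtain ⟨R, hR⟩ := exists_pow_lt_of_lt_one (show (0 : ℝ) < 1 / 4 by norm_num)
    (show 1 - δ' / 2 < 1 by linarith)
  -- The exponent is the one demanded by `roundError_le`. It depends only on the learner, so `K`,
  -- `m` and `d` can be chosen afterwards.
  refine ⟨2 * (k + (2 * a + 1) + 2) + 2, fun K m d η θ hη hηθ hθ hd hev hF => ?_⟩
  have hNtop : Tendsto (fun n => featureDim n (K n) (d n)) atTop atTop := by
    refine tendsto_atTop_mono' _ ?_ tendsto_id
    filter_upwards [hev] with n ⟨hK, _, hd0, _⟩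
    exact le_featureDim hK hd0
  have hNm : ∀ᶠ n in atTop, featureDim n (K n) (d n) ≤ m n := by
    filter_upwards [hev] with n ⟨_, _, _, _, h⟩
    exact (Nat.le_self_pow (by omega) _).trans h
  have hmtop : Tendsto m atTop atTop := tendsto_atTop_mono' _ hNm hNtop
  -- The bias of choosing constraints modulo `m` vanishes in the limit and fits into the gap between
  -- `η` and `θ`.
  have hsmall : ∀ᶠ n in atTop, η * (1 + (m n : ℝ) / 2 ^ m n) ≤ θ := by
    have h1 : Tendsto (fun k : ℕ => (k : ℝ) ^ 1 / 2 ^ k) atTop (𝓝 0) :=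
      tendsto_pow_const_div_const_pow_of_one_lt 1 (by norm_num)
    have h2 : Tendsto (fun n => η * (1 + (m n : ℝ) ^ 1 / 2 ^ m n)) atTop (𝓝 (η * (1 + 0))) :=
      ((h1.comp hmtop).const_add 1).const_mul η
    rw [add_zero, mul_one] at h2
    filter_upwards [h2.eventually (eventually_lt_nhds hηθ)] with n hn
    simpa using hn.le
  have hall : ∀ᶠ n in atTop, (0 < K n ∧ K n ≤ n ∧ 0 < d n ∧ d n ≤ n * K n ∧
        featureDim n (K n) (d n) ^ (2 * (k + (2 * a + 1) + 2) + 2) ≤ m n) ∧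
      8 ≤ featureDim n (K n) (d n) ∧ featureDim n (K n) (d n) ≤ m n ∧
      L.sampleSize.eval (featureDim n (K n) (d n)) ≤ featureDim n (K n) (d n) ^ k ∧
      (∀ J : Formula n (K n) (m n), 1 - η ≤ value J →
        δ ≤ L.successProb (exampleDist (d n) J)
          (1 / 2 - 1 / (featureDim n (K n) (d n) : ℝ) ^ c)) := by
    filter_upwards [hev, hNtop.eventually_ge_atTop 8, hNm, hNtop.eventually hk, hsmall, hF,
      hNtop.eventually hL] with n h1 h2 h3 h4 h5 h6 h7
    refine ⟨h1, h2, h3, h4, fun J hJ => h7 _ (h6 _ ?_)⟩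
    exact almostRealizable_two_mul_sq (by omega) h1.1 h1.2.2.2.1 (hη.trans hηθ) hθ h5 J hJ
  obtain ⟨n₀, hn₀⟩ := eventually_atTop.1 hall
  refine xorEasy_of_rounds L a R n₀ hd (fun n hn => ?_) (fun n hn J hJ => ?_) ?_
  · obtain ⟨_, h2, h3, _⟩ := hn₀ n hn
    exact ⟨by omega, h3⟩
  · obtain ⟨h1, h2, h3, h4, h5⟩ := hn₀ n hn
    rw [uniformProb_someRoundPasses L a R J (roundLength_le h3)]
    have hN' : (1 : ℝ) ≤ featureDim n (K n) (d n) := by exact_mod_cast (by omega : 1 ≤ _)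
    have h6 : L.successProb (exampleDist (d n) J)
          (1 / 2 - 1 / (featureDim n (K n) (d n) : ℝ) ^ c) ≤
        L.successProb (exampleDist (d n) J)
          (1 / 2 - 1 / (featureDim n (K n) (d n) : ℝ) ^ a) := by
      rw [successProb_exampleDist, successProb_exampleDist]
      refine uniformProb_mono fun ω hω => hω.trans ?_
      have : (featureDim n (K n) (d n) : ℝ) ^ c ≤ (featureDim n (K n) (d n) : ℝ) ^ a := by
        rw [← Real.rpow_natCast]
        exact Real.rpow_le_rpow_of_exponent_le hN' ha
      gcongr
    have h7 := half_successProb_le L (a := a) J h2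
    refine le_uniformProb_exists_pi (fun ω => PassesWith L a J ω) (p := δ' / 2) ?_ hR.le
    have h8 := h5 J hJ
    have h9 : δ' ≤ δ := min_le_left _ _
    linarith
  · have hlim : Tendsto (fun n => 1 - 4 * ((R : ℝ) * (5 / (featureDim n (K n) (d n) : ℝ)))) atTop
        (𝓝 1) := by
      have h1 : Tendsto (fun n => 5 / (featureDim n (K n) (d n) : ℝ)) atTop (𝓝 0) :=
        Tendsto.div_atTop tendsto_const_nhds (tendsto_natCast_atTop_atTop.comp hNtop)
      have h2 := ((h1.const_mul (R : ℝ)).const_mul 4).const_sub 1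
      simpa using h2
    refine tendsto_of_tendsto_of_tendsto_of_le_of_le' hlim tendsto_const_nhds ?_
      (Eventually.of_forall fun n => uniformProb_le_one _)
    filter_upwards [hall] with n ⟨h1, h2, h3, h4, h5⟩
    have : Fact (K n ≤ n) := ⟨h1.2.1⟩
    have h6 := le_uniformProb_formula L (a := a) (d := d n) R (by omega : 0 < m n) h1.1
      (by omega : 0 < featureDim n (K n) (d n))
    have h7 := roundError_le L a k h2 h4 h1.2.2.2.2
    have h8 : (R : ℝ) * roundError L a n (K n) (m n) (d n) ≤
        R * (5 / (featureDim n (K n) (d n) : ℝ)) := by gcongr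
    refine le_trans (by linarith) (h6.trans (le_of_eq ?_))
    congr 1
    funext J
    rw [uniformProb_not, uniformProb_someRoundPasses L a R J (roundLength_le h3)]

/-! ## Choice of the parameters -/

theorem width_le {n K : ℕ} (hn : 0 < n) (hK : 0 < K) : width n K ≤ 3 * K * n := by
  have : 0 < K * n := Nat.mul_pos hK hn
  rw [width]
  nlinarith

theorem eventually_mul_rpow_le_rpow {α β : ℝ} (h : α < β) (C : ℝ) :
    ∀ᶠ x : ℝ in atTop, C * x ^ α ≤ x ^ β := by
  filter_upwards [(tendsto_rpow_atTop (sub_pos.2 h)).eventually_ge_atTop C,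
    eventually_gt_atTop 0] with x hx hx0
  calc C * x ^ α ≤ x ^ (β - α) * x ^ α := by gcongr
    _ = x ^ β := by rw [← Real.rpow_add hx0]; congr 1; ring

/-- The base of the exponentially small term of `marginError`. -/
theorem majority_base_mem {θ : ℝ} (hθ : 0 < θ) (hθ2 : θ < 1 / 2) :
    0 < 1 / 2 + 2 * θ * (1 - θ) ∧ 1 / 2 + 2 * θ * (1 - θ) < 1 := by
  constructor
  · nlinarith
  · nlinarith [sq_nonneg (θ - 1 / 2), mul_pos (sub_pos.2 hθ2) (sub_pos.2 hθ2)]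

/-! ### Constant `K` -/

/-- Here `√K = 2 ^ s ^ 2` and `d = 2 s √K`, so `d² / 2K = 2s²`. The prefactor of order `s * 2 ^ s ^
2` is beaten by `exp (-2s²)`. -/
theorem tendsto_marginError {θ : ℝ} (hθ : 0 < θ) (hθ2 : θ < 1 / 2) :
    Tendsto (fun s : ℕ => marginError (4 ^ s ^ 2) (2 * s * 2 ^ s ^ 2) θ) atTop (𝓝 0) := by
  obtain ⟨hr0, hr1⟩ := majority_base_mem hθ hθ2
  set r := 1 / 2 + 2 * θ * (1 - θ) with hr
  have h1 : Tendsto (fun s : ℕ => 10 * ((s : ℝ) ^ 1 * Real.exp (-s)) + r ^ s) atTop (𝓝 0) := by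
    have h2 := ((Real.tendsto_pow_mul_exp_neg_atTop_nhds_zero 1).comp
      tendsto_natCast_atTop_atTop).const_mul 10
    have h3 := h2.add (tendsto_pow_atTop_nhds_zero_of_lt_one hr0.le hr1)
    simpa using h3
  refine tendsto_of_tendsto_of_tendsto_of_le_of_le' tendsto_const_nhds h1 ?_ ?_
  · refine Eventually.of_forall fun s => ?_
    rw [marginError, ← hr]
    positivity
  · filter_upwards [eventually_ge_atTop 1] with s hs
    have hs' : (1 : ℝ) ≤ s := by exact_mod_cast hs
    rw [marginError, ← hr]
    refine add_le_add ?_ (pow_le_pow_of_le_one hr0.le hr1.le ?_)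
    · have h2 : (2 : ℝ) ^ s ^ 2 ≤ Real.exp ((s : ℝ) ^ 2) := by
        have : (2 : ℝ) ≤ Real.exp 1 := by linarith [Real.add_one_le_exp (1 : ℝ)]
        calc (2 : ℝ) ^ s ^ 2 ≤ Real.exp 1 ^ s ^ 2 := by gcongr
          _ = _ := by rw [← Real.exp_nat_mul]; push_cast; ring_nf
      have h3 : ((2 * s * 2 ^ s ^ 2 : ℕ) : ℝ) ^ 2 / (2 * ((4 ^ s ^ 2 : ℕ) : ℝ)) = 2 * (s : ℝ) ^ 2 := by
        push_cast
        rw [show (4 : ℝ) ^ s ^ 2 = 2 ^ s ^ 2 * 2 ^ s ^ 2 by rw [← mul_pow]; norm_num]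
        field_simp
      rw [h3]
      push_cast
      have h4 : (1 : ℝ) ≤ 2 ^ s ^ 2 := one_le_pow₀ (by norm_num)
      have h5 : (2 * (2 * s * 2 ^ s ^ 2) + 1 : ℝ) ≤ 5 * s * 2 ^ s ^ 2 := by nlinarith
      calc (2 * (2 * s * 2 ^ s ^ 2) + 1 : ℝ) * (2 * Real.exp (-(2 * (s : ℝ) ^ 2)))
          ≤ (5 * s * Real.exp ((s : ℝ) ^ 2)) * (2 * Real.exp (-(2 * (s : ℝ) ^ 2))) := by
            gcongr
            exact h5.trans (by gcongr)
        _ = 10 * (s * Real.exp (-((s : ℝ) ^ 2))) := by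
            rw [show -((s : ℝ) ^ 2) = (s : ℝ) ^ 2 + -(2 * (s : ℝ) ^ 2) by ring, Real.exp_add]
            ring
        _ ≤ 10 * ((s : ℝ) ^ 1 * Real.exp (-s)) := by
            rw [pow_one]
            gcongr
            nlinarith
    · have : 1 ≤ 2 ^ s ^ 2 := Nat.one_le_two_pow
      nlinarith

/-- With `K = 4 ^ s ^ 2` and `d = 2 s √K`, a power `N ^ C` of the dimension is of order `n ^ (4 s C
√K)`, while `m` is at least `n ^ (2 c s² log 2 √K)`. The factor `log K`, of order `s²`, beats the
factor `s` in `d` once `s` is large compared with `C`. -/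
theorem not_nonTrivialOn_of_xorAssumption (h : XorAssumption) {ε : ℝ} (hε : 0 < ε)
    (L : PolyTimeLearner) : ¬ L.NonTrivialOn fun n D =>
      AlmostRealizableWithMargin (2 * (n : ℝ) ^ 2) ε D := by
  intro hL
  obtain ⟨c, η, hc, hη, hη2, hard⟩ := h
  obtain ⟨C, hC⟩ := xorEasy_of_nonTrivialOn L hL
  -- Any value strictly between `η` and `1 / 2` would do.
  set θ := (η + 1 / 2) / 2 with hθ
  have hθ0 : 0 < θ := by linarith
  have hθ2 : θ < 1 / 2 := by linarith
  have hlog2 : 0 < Real.log 2 := Real.log_pos (by norm_num)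
  obtain ⟨s, hs1, hs2, hs3⟩ : ∃ s : ℕ, 1 ≤ s ∧
      marginError (4 ^ s ^ 2) (2 * s * 2 ^ s ^ 2) θ ≤ ε ∧ 2 * (C : ℝ) < c * Real.log 2 * s := by
    have h1 := (tendsto_marginError hθ0 hθ2).eventually (eventually_le_nhds hε)
    have h2 := ((tendsto_natCast_atTop_atTop (R := ℝ)).const_mul_atTop
      (mul_pos hc hlog2)).eventually_gt_atTop (2 * (C : ℝ))
    exact ((eventually_ge_atTop 1).and (h1.and h2)).exists
  set K := 4 ^ s ^ 2 with hK
  set d := 2 * s * 2 ^ s ^ 2 with hd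
  have hKpos : 0 < K := by positivity
  have hdpos : 0 < d := by positivity
  refine hard K hKpos (hC (fun _ => K) _ (fun _ => d) η θ hη (by linarith) hθ2
    (PolyFun.num_const d) ?_ (Eventually.of_forall fun n D hD => hD.mono le_rfl hs2))
  have hsqrt : √(K : ℝ) = 2 ^ s ^ 2 := by
    rw [hK, show ((4 ^ s ^ 2 : ℕ) : ℝ) = (2 ^ s ^ 2) ^ 2 by
      push_cast; rw [← pow_mul, mul_comm, pow_mul]; norm_num]
    exact Real.sqrt_sq (by positivity)
  have hlogK : Real.log K = 2 * s ^ 2 * Real.log 2 := by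
    rw [hK]
    push_cast
    rw [Real.log_pow, show (4 : ℝ) = 2 ^ 2 by norm_num, Real.log_pow]
    push_cast
    ring
  set e := c * Real.log K * √(K : ℝ) with he
  have hexp : ((2 * d * C : ℕ) : ℝ) < e := by
    rw [he, hsqrt, hlogK, hd]
    push_cast
    have hs' : (0 : ℝ) < s := by exact_mod_cast hs1
    have : (0 : ℝ) < 2 * s * 2 ^ s ^ 2 := by positivity
    nlinarith [mul_lt_mul_of_pos_left hs3 this]
  have hev := (eventually_mul_rpow_le_rpow hexp
    ((((2 * d + 1) * (3 * K) ^ (2 * d)) ^ C : ℕ) : ℝ)).natCast_atTop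
  filter_upwards [hev, eventually_ge_atTop K, eventually_ge_atTop d] with n hn hnK hnd
  have hn0 : 0 < n := by omega
  refine ⟨hKpos, hnK, hdpos, hnd.trans (Nat.le_mul_of_pos_right _ hKpos), ?_⟩
  have h1 : featureDim n K d ^ C ≤ ((2 * d + 1) * (3 * K) ^ (2 * d)) ^ C * n ^ (2 * d * C) := by
    rw [pow_mul n, ← mul_pow, featureDim, mul_assoc (2 * d + 1), ← mul_pow (3 * K)]
    gcongr
    exact width_le hn0 hKpos
  rw [Real.rpow_natCast] at hn
  have h2 : ((featureDim n K d ^ C : ℕ) : ℝ) ≤ (n : ℝ) ^ e := by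
    refine le_trans ?_ hn
    exact_mod_cast h1
  exact_mod_cast h2.trans (Nat.le_ceil _)

/-! ### Poly-logarithmic `K` -/

/-- The degree `d` is defined by the integer logarithm, which the machine can compute, while the
assumption speaks of the natural logarithm. -/
theorem log_bounds {n : ℕ} (hn : 3 ≤ Real.log n) :
    Real.log n ≤ Nat.log 2 n ∧ (Nat.log 2 n : ℝ) ≤ 2 * Real.log n := by
  have hn0 : n ≠ 0 := by rintro rfl; norm_num at hn
  have hn' : (0 : ℝ) < n := by exact_mod_cast Nat.pos_of_ne_zero hn0
  have h1 : ((2 ^ Nat.log 2 n : ℕ) : ℝ) ≤ n := by exact_mod_cast Nat.pow_log_le_self 2 hn0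
  have h2 : (n : ℝ) < ((2 ^ (Nat.log 2 n + 1) : ℕ) : ℝ) := by
    exact_mod_cast Nat.lt_pow_succ_log_self (by norm_num) n
  have h3 := Real.log_le_log (by positivity) h1
  have h4 := Real.log_lt_log hn' h2
  push_cast at h3 h4
  rw [Real.log_pow] at h3 h4
  push_cast at h4
  have h5 := Real.log_two_gt_d9
  have h6 := Real.log_two_lt_d9
  have h7 : (0 : ℝ) ≤ Nat.log 2 n := Nat.cast_nonneg _
  constructor <;> nlinarith

theorem featureDim_le_pow {n K d : ℕ} (hK : 0 < K) (hd : 0 < d) (h1 : 2 * d + 1 ≤ n)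
    (h2 : 3 * K ≤ n) : featureDim n K d ≤ n ^ (5 * d) := by
  have hn : 0 < n := by omega
  calc featureDim n K d ≤ n * (n * n) ^ (2 * d) := by
        rw [featureDim]
        gcongr
        exact (width_le hn hK).trans (Nat.mul_le_mul_right _ h2)
    _ = n ^ (4 * d + 1) := by rw [← pow_two, ← pow_mul]; ring
    _ ≤ n ^ (5 * d) := Nat.pow_le_pow_right hn (by omega)

/-- The size of the parameters for poly-logarithmic `K`, in terms of `log n`. -/
theorem parameter_bounds {n s : ℕ} (hn : 3 ≤ Real.log n)
    (hbig : 12 * 2 ^ s * Real.log n ^ (s + 1) ≤ n) :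
    0 < polylog (s + 1) n ∧ polylog (s + 1) n ≤ n ∧ 0 < Nat.log 2 n ^ s ∧
      4 * (2 * Nat.log 2 n ^ s + 1) ≤ n ∧
      Real.log n ^ s ≤ (Nat.log 2 n ^ s : ℕ) ∧
      ((Nat.log 2 n ^ s : ℕ) : ℝ) ≤ 2 ^ s * Real.log n ^ s ∧
      Real.log n ^ (s + 1) ≤ polylog (s + 1) n ∧
      (polylog (s + 1) n : ℝ) ≤ 2 * Real.log n ^ (s + 1) ∧
      featureDim n (polylog (s + 1) n) (Nat.log 2 n ^ s) ≤ n ^ (5 * Nat.log 2 n ^ s) := by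
  obtain ⟨hl1, hl2⟩ := log_bounds hn
  set x := Real.log n with hx
  have hpow : 1 ≤ x ^ s := one_le_pow₀ (by linarith)
  have hpow2 : 3 * x ^ s ≤ x ^ (s + 1) := by rw [pow_succ]; nlinarith
  have hd1 : x ^ s ≤ (Nat.log 2 n ^ s : ℕ) := by
    push_cast; exact pow_le_pow_left₀ (by linarith) hl1 _
  have hd2 : ((Nat.log 2 n ^ s : ℕ) : ℝ) ≤ 2 ^ s * x ^ s := by
    push_cast; rw [← mul_pow]; exact pow_le_pow_left₀ (by positivity) hl2 _
  have hK1 : x ^ (s + 1) ≤ polylog (s + 1) n := Nat.le_ceil _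
  have hK2 : (polylog (s + 1) n : ℝ) ≤ 2 * x ^ (s + 1) := by
    have : (polylog (s + 1) n : ℝ) < x ^ (s + 1) + 1 := Nat.ceil_lt_add_one (by positivity)
    linarith
  have h2s : (1 : ℝ) ≤ 2 ^ s := one_le_pow₀ (by norm_num)
  have hK0 : 0 < polylog (s + 1) n := by
    have : (0 : ℝ) < polylog (s + 1) n := by linarith
    exact_mod_cast this
  have hd0 : 0 < Nat.log 2 n ^ s := by
    have : (0 : ℝ) < (Nat.log 2 n ^ s : ℕ) := by linarith
    exact_mod_cast this
  have h3K : 3 * polylog (s + 1) n ≤ n := by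
    have : (3 * polylog (s + 1) n : ℝ) ≤ n := by nlinarith
    exact_mod_cast this
  have h4d : 4 * (2 * Nat.log 2 n ^ s + 1) ≤ n := by
    have h5 : 2 ^ s * (3 * x ^ s) ≤ 2 ^ s * x ^ (s + 1) := by gcongr
    have h6 : 1 ≤ 2 ^ s * x ^ s := by nlinarith
    have : (4 * (2 * (Nat.log 2 n ^ s : ℕ) + 1) : ℝ) ≤ n := by linarith
    exact_mod_cast this
  exact ⟨hK0, by omega, hd0, h4d, hd1, hd2, hK1, hK2,
    featureDim_le_pow hK0 hd0 (by omega) h3K⟩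

/-- From `d ≥ log^(s+1) n` and `K ≤ 2 log^(s+2) n` one gets `d² / 2K ≥ log^s n / 4`. Of this, `log
n` pays for the prefactor `2d + 1 ≤ n / 4`, and `Y` remains. The exponent of the majority term is
linear in `d` and therefore larger still. Each term contributes at most half of `exp (-Y)`. -/
theorem marginError_le {n s : ℕ} {θ Y : ℝ} (hθ : 0 < θ) (hθ2 : θ < 1 / 2)
    (hn : 3 ≤ Real.log n) (hbig : 12 * 2 ^ (s + 1) * Real.log n ^ (s + 1 + 1) ≤ n)
    (hg : 1 ≤ -Real.log (1 / 2 + 2 * θ * (1 - θ)) * Real.log n) (hY : 0 ≤ Y)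
    (hY2 : Y + Real.log n ≤ Real.log n ^ s / 4) :
    marginError (polylog (s + 1 + 1) n) (Nat.log 2 n ^ (s + 1)) θ ≤ (2 : ℝ) ^ (-Y) := by
  obtain ⟨hK0, -, hd0, h4d, hd1, hd2, hK1, hK2, -⟩ := parameter_bounds hn hbig
  obtain ⟨hr0, hr1⟩ := majority_base_mem hθ hθ2
  rw [marginError]
  set r := 1 / 2 + 2 * θ * (1 - θ) with hr
  set x := Real.log n with hx
  set d := Nat.log 2 n ^ (s + 1) with hd
  set K := polylog (s + 1 + 1) n
  have hK0' : (0 : ℝ) < K := by exact_mod_cast hK0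
  have hx0 : 0 < x := by linarith
  have hn0 : (0 : ℝ) < n := by
    have : 0 < n := by omega
    exact_mod_cast this
  have hdn : (4 * (2 * d + 1) : ℝ) ≤ Real.exp x := by
    rw [hx, Real.exp_log hn0]; exact_mod_cast h4d
  have hquot : x ^ s / 4 ≤ (d : ℝ) ^ 2 / (2 * K) := by
    rw [div_le_div_iff₀ (by norm_num) (by positivity)]
    calc x ^ s * (2 * K) ≤ x ^ s * (2 * (2 * x ^ (s + 1 + 1))) := by gcongr
      _ = (x ^ (s + 1)) ^ 2 * 4 := by ring
      _ ≤ _ := by gcongr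
  have hterm1 : (2 * d + 1 : ℝ) * (2 * Real.exp (-((d : ℝ) ^ 2 / (2 * K)))) ≤
      1 / 2 * Real.exp (-Y) := by
    calc (2 * d + 1 : ℝ) * (2 * Real.exp (-((d : ℝ) ^ 2 / (2 * K))))
        ≤ (Real.exp x / 4) * (2 * Real.exp (-(Y + x))) := by
          gcongr
          · linarith
          · linarith
      _ = 1 / 2 * Real.exp (-Y) := by
          rw [show -Y = x + -(Y + x) by ring, Real.exp_add]; ring
  have hterm2 : r ^ (2 * d + 1) ≤ 1 / 2 * Real.exp (-Y) := by
    have hexp : r ^ (2 * d + 1) = Real.exp (-((2 * d + 1 : ℕ) * -Real.log r)) := by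
      rw [mul_neg, neg_neg, Real.exp_nat_mul, Real.exp_log hr0]
    have hmain : Y + 1 ≤ (2 * d + 1 : ℕ) * -Real.log r := by
      have hg0 : 0 < -Real.log r := by
        have := Real.log_neg hr0 hr1; linarith
      have h1 : x ^ s ≤ x ^ (s + 1) * -Real.log r := by
        rw [pow_succ]
        have : 0 < x ^ s := by positivity
        nlinarith
      have h2 : x ^ (s + 1) * -Real.log r ≤ (2 * d + 1 : ℕ) * -Real.log r := by
        gcongr
        push_cast
        linarith [(Nat.cast_nonneg d : (0 : ℝ) ≤ d)]
      linarith
    have he : 2 ≤ Real.exp 1 := by linarith [Real.add_one_le_exp (1 : ℝ)]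
    have h3 : Real.exp (-Y) = Real.exp 1 * Real.exp (-(Y + 1)) := by
      rw [← Real.exp_add]; congr 1; ring
    rw [hexp, h3]
    calc Real.exp (-((2 * d + 1 : ℕ) * -Real.log r)) ≤ Real.exp (-(Y + 1)) := by gcongr
      _ ≤ _ := by nlinarith [Real.exp_pos (-(Y + 1))]
  have hfin : Real.exp (-Y) ≤ (2 : ℝ) ^ (-Y) := by
    rw [Real.rpow_def_of_pos (by norm_num)]
    apply Real.exp_le_exp.2
    have := Real.log_two_lt_d9
    nlinarith
  linarith

/-- Applied to `x = log n`. The logarithm of the dimension is at most `A * x ^ (s + 2)`, so the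
desired error exponent has order `x ^ ((s + 2) * μ)`, against the `x ^ s / 4` that is available. -/
theorem eventually_exponent_le {A μ : ℝ} {s : ℕ} (hA : 0 < A) (hs : 2 ≤ s)
    (h : (s + 2 : ℝ) * μ < s) :
    ∀ᶠ x : ℝ in atTop, (A * x ^ (s + 2)) ^ μ + x ≤ x ^ s / 4 := by
  have h1 := eventually_mul_rpow_le_rpow h (8 * A ^ μ)
  filter_upwards [h1, eventually_ge_atTop 8] with x hx hx8
  have hx0 : 0 < x := by linarith
  have e1 : (A * x ^ (s + 2)) ^ μ = A ^ μ * x ^ ((s + 2 : ℝ) * μ) := by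
    rw [Real.mul_rpow hA.le (by positivity), Real.rpow_mul hx0.le]
    congr 2
    rw [← Real.rpow_natCast]
    push_cast
    rfl
  rw [Real.rpow_natCast] at hx
  have h2 : 8 * x ≤ x ^ s := by
    calc 8 * x ≤ x ^ 2 := by nlinarith
      _ ≤ x ^ s := pow_le_pow_right₀ (by linarith) hs
  rw [e1]
  linarith

/-- Take `K` of order `log^(s+2) n` and `d` of order `log^(s+1) n`. Then `N ^ C ≤ n ^ (5 d C)` is
below `n ^ (c K)` for large `n`, as `d` is smaller than `K` by a logarithmic factor. The error
exponent has order `log^s n`, while `log N` is `O(log^(s+2) n)`; it exceeds `(log N)^μ` as soon as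
`s / (s + 2) > μ`. -/
theorem not_nonTrivialOn_of_strongXorAssumption (h : StrongXorAssumption) {ν : ℝ} (hν : 0 < ν)
    (L : PolyTimeLearner) : ¬ L.NonTrivialOn fun n D =>
      AlmostRealizableWithMargin (2 * (n : ℝ) ^ 2) ((2 : ℝ) ^ (-(Real.log n ^ (1 - ν)))) D := by
  intro hL
  obtain ⟨c, η, hc, hη, hη2, hard⟩ := h
  obtain ⟨C, hC⟩ := xorEasy_of_nonTrivialOn L hL
  set θ := (η + 1 / 2) / 2 with hθ
  have hθ0 : 0 < θ := by linarith
  have hθ2 : θ < 1 / 2 := by linarith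
  -- Capping `ν` keeps `μ` nonnegative, so that the real power is monotone in its base. As `1 - ν ≤
  -- μ`, the error bound obtained for `μ` is the stronger one.
  set μ := 1 - min ν (1 / 2) with hμ
  have hμ0 : 0 ≤ μ := by have := min_le_right ν (1 / 2); linarith
  have hμν : 1 - ν ≤ μ := by have := min_le_left ν (1 / 2); linarith
  have hμ1 : 0 < 1 - μ := by rw [hμ]; simpa using hν
  obtain ⟨s, hs1, hs2⟩ : ∃ s : ℕ, 2 ≤ s ∧ (s + 2 : ℝ) * μ < s := by
    have h1 := ((tendsto_natCast_atTop_atTop (R := ℝ)).const_mul_atTop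
      hμ1).eventually_gt_atTop (2 * μ)
    obtain ⟨s, hs, hs'⟩ := ((eventually_ge_atTop 2).and h1).exists
    exact ⟨s, hs, by linarith⟩
  have hg : 0 < -Real.log (1 / 2 + 2 * θ * (1 - θ)) := by
    obtain ⟨hr0, hr1⟩ := majority_base_mem hθ0 hθ2
    have := Real.log_neg hr0 hr1
    linarith
  have hlog : Tendsto (fun n : ℕ => Real.log n) atTop atTop :=
    Real.tendsto_log_atTop.comp tendsto_natCast_atTop_atTop
  have hbig : ∀ᶠ n : ℕ in atTop, 12 * 2 ^ (s + 1) * Real.log n ^ (s + 1 + 1) ≤ n := by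
    have h1 := (Real.isLittleO_pow_log_id_atTop (n := s + 1 + 1)).bound
      (show (0 : ℝ) < (12 * 2 ^ (s + 1))⁻¹ by positivity)
    filter_upwards [h1.natCast_atTop] with n hn
    rw [id, Real.norm_of_nonneg (Nat.cast_nonneg n)] at hn
    have := (le_abs_self _).trans hn
    rwa [← div_eq_inv_mul, le_div_iff₀' (by positivity)] at this
  have hA : (0 : ℝ) < 5 * 2 ^ (s + 1) := by positivity
  have hexp := hlog.eventually (eventually_exponent_le hA hs1 hs2)
  refine hard (s + 1 + 1) (by omega) (hC _ _ (fun n => Nat.log 2 n ^ (s + 1)) η θ hη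
    (by linarith) hθ2 (PolyFun.num_pow_const (PolyFun.num_log (PolyFun.var (by simp))) _) ?_ ?_)
  · filter_upwards [hbig, hlog.eventually_ge_atTop 3,
      (hlog.const_mul_atTop hc).eventually_ge_atTop (5 * 2 ^ (s + 1) * C)] with n hn hn3 hnC
    obtain ⟨hK0, hKn, hd0, h4d, hd1, hd2, hK1, hK2, hN⟩ := parameter_bounds hn3 hn
    refine ⟨hK0, hKn, hd0, le_trans (by omega) (Nat.le_mul_of_pos_right n hK0), ?_⟩
    have hn1 : (1 : ℝ) ≤ n := by
      have : 1 ≤ n := by omega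
      exact_mod_cast this
    have h1 : ((featureDim n (polylog (s + 1 + 1) n) (Nat.log 2 n ^ (s + 1)) ^ C : ℕ) : ℝ) ≤
        (n : ℝ) ^ (c * (polylog (s + 1 + 1) n : ℝ)) := by
      calc _ ≤ (((n ^ (5 * Nat.log 2 n ^ (s + 1))) ^ C : ℕ) : ℝ) := by
            exact_mod_cast Nat.pow_le_pow_left hN C
        _ = (n : ℝ) ^ ((5 * (Nat.log 2 n ^ (s + 1) : ℕ) * C : ℝ)) := by
            rw [← pow_mul, Nat.cast_pow, ← Real.rpow_natCast, Nat.cast_mul, Nat.cast_mul,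
              Nat.cast_ofNat]
        _ ≤ _ := by
            apply Real.rpow_le_rpow_of_exponent_le hn1
            calc (5 * (Nat.log 2 n ^ (s + 1) : ℕ) * C : ℝ)
                ≤ 5 * (2 ^ (s + 1) * Real.log n ^ (s + 1)) * C := by gcongr
              _ = (5 * 2 ^ (s + 1) * C) * Real.log n ^ (s + 1) := by ring
              _ ≤ (c * Real.log n) * Real.log n ^ (s + 1) := by gcongr
              _ = c * Real.log n ^ (s + 1 + 1) := by ring
              _ ≤ _ := by gcongr
    exact_mod_cast h1.trans (Nat.le_ceil _)
  · filter_upwards [hbig, hlog.eventually_ge_atTop 3, hexp,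
      (hlog.const_mul_atTop hg).eventually_ge_atTop 1] with n hn hn3 hY hg1 D hD
    obtain ⟨hK0, hKn, hd0, h4d, hd1, hd2, hK1, hK2, hN⟩ := parameter_bounds hn3 hn
    set N := featureDim n (polylog (s + 1 + 1) n) (Nat.log 2 n ^ (s + 1)) with hNdef
    have hnN : n ≤ N := le_featureDim hK0 hd0
    have hn0 : (0 : ℝ) < n := by
      have : 0 < n := by omega
      exact_mod_cast this
    have hlogN : Real.log n ≤ Real.log N := Real.log_le_log hn0 (by exact_mod_cast hnN)
    have hN0 : (0 : ℝ) < N := lt_of_lt_of_le hn0 (by exact_mod_cast hnN)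
    have hlogN2 : Real.log N ≤ 5 * 2 ^ (s + 1) * Real.log n ^ (s + 2) := by
      have h1 : Real.log N ≤ Real.log ((n : ℝ) ^ (5 * Nat.log 2 n ^ (s + 1))) :=
        Real.log_le_log hN0 (by exact_mod_cast hN)
      rw [Real.log_pow] at h1
      calc Real.log N ≤ ((5 * Nat.log 2 n ^ (s + 1) : ℕ) : ℝ) * Real.log n := h1
        _ = 5 * ((Nat.log 2 n ^ (s + 1) : ℕ) : ℝ) * Real.log n := by push_cast; ring
        _ ≤ 5 * (2 ^ (s + 1) * Real.log n ^ (s + 1)) * Real.log n := by gcongr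
        _ = _ := by ring
    refine hD.mono le_rfl ((marginError_le (Y := Real.log N ^ μ) hθ0 hθ2 hn3 hn hg1
      (Real.rpow_nonneg (by linarith) _) ?_).trans ?_)
    · exact le_trans (by gcongr) hY
    · apply Real.rpow_le_rpow_of_exponent_le (by norm_num)
      exact neg_le_neg (Real.rpow_le_rpow_of_exponent_le (by linarith) hμν)

theorem theorem2 :
    ∃ p : Polynomial ℕ,
      (XorAssumption → ∀ η : ℝ, 0 < η →
        ¬ ∃ L : PolyTimeLearner, L.NonTrivialOn fun n D =>
          AlmostRealizableWithMargin ((p.eval n : ℕ) : ℝ) η D) ∧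
      (StrongXorAssumption → ∀ ν : ℝ, 0 < ν →
        ¬ ∃ L : PolyTimeLearner, L.NonTrivialOn fun n D =>
          AlmostRealizableWithMargin ((p.eval n : ℕ) : ℝ)
            ((2 : ℝ) ^ (-(Real.log n ^ (1 - ν)))) D) := by
  -- The weight vector has norm at most `2 * (2 * d + 1) * N` in dimension `N`, and `2 * d + 1 ≤ N`,
  -- hence the bound `2 * N ^ 2`.
  have hp : ∀ n : ℕ, (((2 * Polynomial.X ^ 2 : Polynomial ℕ).eval n : ℕ) : ℝ) =
      2 * (n : ℝ) ^ 2 := fun n => by simp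
  refine ⟨2 * Polynomial.X ^ 2, fun h η hη ⟨L, hL⟩ => ?_, fun h ν hν ⟨L, hL⟩ => ?_⟩
  · simp only [hp] at hL
    exact not_nonTrivialOn_of_xorAssumption h hη L hL
  · simp only [hp] at hL
    exact not_nonTrivialOn_of_strongXorAssumption h hν L hL
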